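/- Let $M=(-\infty,0)\times(-\infty,0)\times\mathbb S^2$ with standard coordinates $(u,v)$ on the first two factors, and let $$g=-\frac{\Omega^2(u,v)}{2}\,(du\otimes dv+dv\otimes du)+r^2(u,v)\,\mathring\gamma,$$ where $\mathring\gamma$ is the standard metric on $\mathbb S^2$ and $\Omega,r:(-\infty,0)\times(-\infty,0)\to(0,\infty)$ are smooth. Time-orient $(M,g)$ by stipulating that $\partial_u+\partial_v$ is future directed. Assume that - $\Omega$ and $r$ extend continuously as positive functions to $(-\infty,0]\times(-\infty,0]$; - $\lim_{v\to0}\partial_v r(u,v)=-\infty$ for all $u\in(-\infty,0)$; - $\lim_{u\to0}\partial_u r(u,v)=-\infty$ for all $v\in(-\infty,0)$; - for every $u\in(-\infty,0)$ there is $v_0(u)\in(-\infty,0)$ such that $\partial_u r(u,v)<0$ for all $v\in[v_0(u),0)$; - for every $v\in(-\infty,0)$ there is $u_0(v)\in(-\infty,0)$ such that $\partial_v r(u,v)<0$ for all $u\in[u_0(v),0)$. Then $(M,g)$ is future $C^{0,1}_{\mathrm{loc}}$-inextendible, in the following sense. A $C^{0,1}_{\mathrm{loc}}$-extension of $(M,g)$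 is a smooth isometric embedding $\iota:M\hookrightarrow\tilde M$ into a smooth Lorentzian manifold $(\tilde M,\tilde g)$ of the same dimension, whose metric $\tilde g$ is locally Lipschitz (in every smooth chart its components are Lipschitz on compact sets), such that $\partial\iota(M)\subseteq\tilde M$ is non-empty. There is no $C^{0,1}_{\mathrm{loc}}$-extension $\iota:M\hookrightarrow\tilde M$ for which there exists a future directed timelike curve $\gamma:[a,b)\to M$ (continuous and piecewise smooth, with future directed timelike one-sided tangents everywhere) that is future inextendible, i.e. $\lim_{s\to b}\gamma(s)$ does not exist in $M$, and such that $\iota\circ\gamma$ has a future limit point in $\tilde M$, i.e. $\lim_{s\to b}\iota(\gamma(s))$ exists in $\tilde M$. -/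

import Mathlib

open Set Filter Topology Manifold
open scoped ContDiff

universe w

noncomputable section

/-! ### Lorentzian metrics, extensions, timelike curves -/

/-- A field of bilinear forms on the tangent spaces of `M` (no regularity imposed). -/
abbrev BilinField {E H : Type*} [NormedAddCommGroup E] [NormedSpace ℝ E] [TopologicalSpace H]
    (I : ModelWithCorners ℝ E H) (M : Type*) [TopologicalSpace M] [ChartedSpace H M] :=
  ∀ p : M, LinearMap.BilinForm ℝ (TangentSpace I p)

/-- A bilinear form on a `(d+1)`-dimensional space is Lorentzian if in some basis its matrix is
`diag(-1, 1, …, 1)`. -/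
def IsLorentzForm {V : Type*} [AddCommGroup V] [Module ℝ V] (d : ℕ)
    (B : LinearMap.BilinForm ℝ V) : Prop :=
  ∃ b : Module.Basis (Fin (d + 1)) ℝ V, ∀ i j,
    B (b i) (b j) = if i = j then (if i = 0 then -1 else 1) else 0

/-- The component `g_{μν} ∘ φ⁻¹` of `g` in the chart `φ`, i.e. `g` evaluated on the coordinate
vector fields `∂_μ`, `∂_ν` at the point with coordinates `x`. -/
def metricComponent {d : ℕ} {N : Type*} [TopologicalSpace N]
    [ChartedSpace (EuclideanSpace ℝ (Fin d)) N] (g : BilinField (𝓡 d) N)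
    (φ : OpenPartialHomeomorph N (EuclideanSpace ℝ (Fin d))) (μ ν : Fin d)
    (x : EuclideanSpace ℝ (Fin d)) : ℝ :=
  g (φ.symm x)
    (mfderiv (𝓡 d) (𝓡 d) φ.symm x (EuclideanSpace.single μ (1 : ℝ) : EuclideanSpace ℝ (Fin d)))
    (mfderiv (𝓡 d) (𝓡 d) φ.symm x (EuclideanSpace.single ν (1 : ℝ) : EuclideanSpace ℝ (Fin d)))

/-- `g` is of class `C^{0,1}_loc`: in every smooth chart every component is Lipschitz on every
compact subset of the range of the chart. -/
def IsLocLipschitzField {d : ℕ} {N : Type*} [TopologicalSpace N]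
    [ChartedSpace (EuclideanSpace ℝ (Fin d)) N] (g : BilinField (𝓡 d) N) : Prop :=
  ∀ φ ∈ IsManifold.maximalAtlas (𝓡 d) ∞ N, ∀ K ⊆ φ.target, IsCompact K →
    ∀ μ ν : Fin d, ∃ Λ : NNReal, LipschitzOnWith Λ (metricComponent g φ μ ν) K

section Extension

variable {E H : Type*} [NormedAddCommGroup E] [NormedSpace ℝ E] [TopologicalSpace H]
  (I : ModelWithCorners ℝ E H) {M : Type*} [TopologicalSpace M] [ChartedSpace H M]

/-- `ι : M → N` is a `C^{0,1}_loc`-extension of `(M, g)`: `(N, g')` is a Lorentzian manifold of the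
same dimension with locally Lipschitz metric `g'`, and `ι` is a smooth isometric embedding whose
image has non-empty boundary in `N`. -/
structure IsLocLipExtension (g : BilinField I M) {d : ℕ} {N : Type*} [TopologicalSpace N]
    [ChartedSpace (EuclideanSpace ℝ (Fin (d + 1))) N] (g' : BilinField (𝓡 (d + 1)) N)
    (ι : M → N) : Prop where
  same_dim : Module.finrank ℝ E = d + 1
  lorentzian : ∀ q, IsLorentzForm d (g' q)
  locLipschitz : IsLocLipschitzField g'
  smoothEmbedding : IsSmoothEmbedding I (𝓡 (d + 1)) ∞ ι
  isometric : ∀ (p : M) (X Y : TangentSpace I p),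
    g' (ι p) (mfderiv I (𝓡 (d + 1)) ι p X) (mfderiv I (𝓡 (d + 1)) ι p Y) = g p X Y
  frontier_nonempty : (frontier (range ι)).Nonempty

variable {I}

/-- `X` is timelike and future directed, for the time orientation in which the timelike vector
field `T` is future directed. -/
def IsFutureTimelike (g : BilinField I M) (T : ∀ p : M, TangentSpace I p) (p : M)
    (X : TangentSpace I p) : Prop :=
  g p X X < 0 ∧ g p X (T p) < 0

/-- `γ : [a, b) → M` is a future directed timelike curve: continuous and piecewise smooth (with
locally finitely many break points `t n`), all tangents, including both one-sided tangents at the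
break points, being timelike and future directed. -/
def IsFutureTimelikeCurve (g : BilinField I M) (T : ∀ p : M, TangentSpace I p)
    (γ : ℝ → M) (a b : ℝ) : Prop :=
  ∃ t : ℕ → ℝ, StrictMono t ∧ t 0 = a ∧ Tendsto t atTop (𝓝 b) ∧
    ∀ n, ContMDiffOn 𝓘(ℝ, ℝ) I ∞ γ (Icc (t n) (t (n + 1))) ∧
      ∀ s ∈ Icc (t n) (t (n + 1)), IsFutureTimelike g T (γ s)
        (mfderivWithin 𝓘(ℝ, ℝ) I γ (Icc (t n) (t (n + 1))) s (1 : ℝ))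

/-- A curve `[a, b) → M` is future inextendible if it has no limit in `M` at `b`. -/
def IsFutureInextendibleCurve (γ : ℝ → M) (b : ℝ) : Prop :=
  ¬ ∃ p : M, Tendsto γ (𝓝[<] b) (𝓝 p)

/-- `(M, g)`, time-oriented by `T`, is future `C^{0,1}_loc`-inextendible: no `C^{0,1}_loc`-extension
`ι : M → N` admits a future directed, future inextendible timelike curve `γ` in `M` such that
`ι ∘ γ` has a future limit point in `N`. -/
def FutureLocLipInextendible (g : BilinField I M) (T : ∀ p : M, TangentSpace I p) : Prop :=
  ∀ (d : ℕ) (N : Type w) [TopologicalSpace N] [T2Space N]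
    [ChartedSpace (EuclideanSpace ℝ (Fin (d + 1))) N] [IsManifold (𝓡 (d + 1)) ∞ N]
    (g' : BilinField (𝓡 (d + 1)) N) (ι : M → N), IsLocLipExtension I g g' ι →
      ¬ ∃ (γ : ℝ → M) (a b : ℝ), IsFutureTimelikeCurve g T γ a b ∧
        IsFutureInextendibleCurve γ b ∧ ∃ q : N, Tendsto (ι ∘ γ) (𝓝[<] b) (𝓝 q)

end Extension

/-! ### The spherically symmetric double null spacetime -/

/-- The interval `(-∞, 0)` as an open submanifold of `ℝ`. -/
abbrev NegLine : TopologicalSpace.Opens ℝ := ⟨Iio 0, isOpen_Iio⟩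

/-- The unit sphere in Euclidean 3-space. -/
abbrev UnitSphere : Type := Metric.sphere (0 : EuclideanSpace ℝ (Fin 3)) 1

/-- `M = (-∞, 0) × (-∞, 0) × 𝕊²`. -/
abbrev DoubleNull : Type := NegLine × NegLine × UnitSphere

/-- The model of `M`. -/
abbrev DoubleNullModel :=
  (𝓘(ℝ, ℝ)).prod ((𝓘(ℝ, ℝ)).prod (𝓡 2))

/-- The differential `du` at `p`. -/
def diffU (p : DoubleNull) : TangentSpace DoubleNullModel p →ₗ[ℝ] ℝ :=
  (mfderiv DoubleNullModel 𝓘(ℝ, ℝ) (fun x : DoubleNull => (x.1 : ℝ)) p).toLinearMap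

/-- The differential `dv` at `p`. -/
def diffV (p : DoubleNull) : TangentSpace DoubleNullModel p →ₗ[ℝ] ℝ :=
  (mfderiv DoubleNullModel 𝓘(ℝ, ℝ) (fun x : DoubleNull => (x.2.1 : ℝ)) p).toLinearMap

/-- The differential at `p` of `M → 𝕊² ⊆ ℝ³`. -/
def diffSphere (p : DoubleNull) :
    TangentSpace DoubleNullModel p →ₗ[ℝ] EuclideanSpace ℝ (Fin 3) :=
  (mfderiv DoubleNullModel 𝓘(ℝ, EuclideanSpace ℝ (Fin 3))
    (fun x : DoubleNull => (x.2.2 : EuclideanSpace ℝ (Fin 3))) p).toLinearMap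

/-- The standard metric of `𝕊²` (induced from `ℝ³`), pulled back to `M`. -/
def roundMetric (p : DoubleNull) : LinearMap.BilinForm ℝ (TangentSpace DoubleNullModel p) :=
  (innerₗ (EuclideanSpace ℝ (Fin 3))).compl₁₂ (diffSphere p) (diffSphere p)

/-- `g = -(Ω²/2) (du ⊗ dv + dv ⊗ du) + r² γ̊`. -/
def doubleNullMetric (Ω r : ℝ → ℝ → ℝ) : BilinField DoubleNullModel DoubleNull := fun p =>
  (-(Ω p.1 p.2.1 ^ 2 / 2)) •
      (LinearMap.BilinForm.linMulLin (diffU p) (diffV p) +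
        LinearMap.BilinForm.linMulLin (diffV p) (diffU p)) +
    (r p.1 p.2.1 ^ 2) • roundMetric p

/-- The vector field `∂_u + ∂_v`. -/
def timeVector (p : DoubleNull) : TangentSpace DoubleNullModel p :=
  ((1, 1, 0) : ℝ × ℝ × EuclideanSpace ℝ (Fin 2))

/-- `f : (-∞,0)² → (0,∞)` is smooth, positive, and extends continuously as a positive function to
`(-∞,0]²`. Values of `f` outside `(-∞,0)²` are irrelevant. -/
structure IsAdmissibleCoefficient (f : ℝ → ℝ → ℝ) : Prop where
  smooth : ContDiffOn ℝ ∞ (fun x : ℝ × ℝ => f x.1 x.2) (Iio 0 ×ˢ Iio 0)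
  pos : ∀ u < 0, ∀ v < 0, 0 < f u v
  extends_pos : ∃ F : ℝ × ℝ → ℝ, ContinuousOn F (Iic 0 ×ˢ Iic 0) ∧
    (∀ u < 0, ∀ v < 0, F (u, v) = f u v) ∧ ∀ u ≤ 0, ∀ v ≤ 0, 0 < F (u, v)

end

/-! Suppose a timelike curve without limit in the spacetime converges to a point `q` of an
extension. A chart at `q` yields a map `Y` into a vector space under which a Lipschitz metric `G`
pulls back to the given metric. The length of the sphere component of the curve is finite, so that
component converges; hence `u` or `v` must tend to `0`. By symmetry let it be `v`.

The obstruction is the bending of the symmetry spheres. A Lipschitz metric has essentially bounded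
Christoffel symbols, so second derivatives of `Y` agree with images of covariant derivatives up to
an error quadratic in first derivatives (`norm_fderiv_fderiv_sub_le`). With `R = r²` and `Q = Ω²`,
differentiating a unit tangent along a great circle produces `(∂_v R / Q) ∂_u + (∂_u R / Q) ∂_v`.
Its first coefficient tends to `-∞`, and the second is eventually non-positive, so it cannot
compensate. If a `v`-line ending at `v = 0` stays in the chart, so do the lines through a short arc
of a great circle, with bounded `∂_v` and sphere derivatives, because suitably rescaled frames are
almost parallel. Since `G(∂_u Y, ∂_v Y) = -Q/2`, the time component of `∂_u Y` is bounded below.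
Thus the time component of the tangent to the image of the arc is bounded, while its derivative
tends to `-∞` uniformly on an arc of fixed length. This is the contradiction in `false_of_line`.

It remains to find such a line with `u < 0`, although `u` may itself tend to `0` along the curve. A
timelike curve moves on the sphere strictly less than its `(u, v)` motion allows, so the whole
sphere motion fits along an initial part of its `(u, v)` projection (`exists_lag`). This delayed
causal curve converges inside the spacetime. A `v`-line followed by a `u`-line joins it to the
original curve. Causal curves in the chart have increments in a cone around a linear time function
`τ`, so everything causally between two nearby points of the curve stays in a small ball
(`mem_chartRegion_of_lag`). The limits of these `v`-lines form the required null line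
(`false_of_curve`).

The sphere is replaced by the cone `ℝ³ \ {0}`, so that ordinary calculus applies; the radial
direction is degenerate and `Y` does not see it. -/

noncomputable section

/-! ### The Gauss formula for a Lipschitz target metric -/

section Koszul

variable {F E : Type*} [NormedAddCommGroup F] [NormedSpace ℝ F]
  [NormedAddCommGroup E] [NormedSpace ℝ E]

/-- If a metric `g` is the pullback under `Y` of a Lipschitz metric `G`, then the derivative of `g`
is given by the second derivative of `Y` up to an error controlled by the Lipschitz constant. -/
theorem abs_deriv_pullback_sub_le {Y : F → E} {G : E → E →L[ℝ] E →L[ℝ] ℝ} {g : F → F → F → ℝ}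
    {x z₁ z₂ z₃ : F} {Λ g' : ℝ} (hY : ContDiffAt ℝ 2 Y x)
    (hg : ∀ᶠ p in 𝓝 x, ∀ z w, G (Y p) (fderiv ℝ Y p z) (fderiv ℝ Y p w) = g p z w)
    (hG : ∀ᶠ p in 𝓝 x, ‖G (Y p) - G (Y x)‖ ≤ Λ * ‖Y p - Y x‖)
    (hg' : HasDerivAt (fun t : ℝ => g (x + t • z₁) z₂ z₃) g' 0) :
    |g' - G (Y x) (fderiv ℝ (fderiv ℝ Y) x z₁ z₂) (fderiv ℝ Y x z₃)
      - G (Y x) (fderiv ℝ Y x z₂) (fderiv ℝ (fderiv ℝ Y) x z₁ z₃)|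
      ≤ Λ * ‖fderiv ℝ Y x z₁‖ * ‖fderiv ℝ Y x z₂‖ * ‖fderiv ℝ Y x z₃‖ := by
  have hline : HasDerivAt (fun t : ℝ => x + t • z₁) z₁ 0 := by
    simpa using ((hasDerivAt_id (0 : ℝ)).smul_const z₁).const_add x
  have hx0 : x + (0 : ℝ) • z₁ = x := by simp
  have htend : Tendsto (fun t : ℝ => x + t • z₁) (𝓝 0) (𝓝 x) := by
    simpa [hx0] using hline.continuousAt.tendsto
  have hY1 : HasFDerivAt Y (fderiv ℝ Y x) (x + (0 : ℝ) • z₁) := by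
    rw [hx0]; exact (hY.differentiableAt (by norm_num)).hasFDerivAt
  have hY2 : HasFDerivAt (fderiv ℝ Y) (fderiv ℝ (fderiv ℝ Y) x) (x + (0 : ℝ) • z₁) := by
    rw [hx0]
    exact ((hY.fderiv_right (m := 1) (by norm_num)).differentiableAt (by norm_num)).hasFDerivAt
  have hD : HasDerivAt (fun t : ℝ => fderiv ℝ Y (x + t • z₁)) (fderiv ℝ (fderiv ℝ Y) x z₁) 0 :=
    hY2.comp_hasDerivAt 0 hline
  have hy : HasDerivAt (fun t : ℝ => Y (x + t • z₁)) (fderiv ℝ Y x z₁) 0 :=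
    hY1.comp_hasDerivAt 0 hline
  have hDz (z : F) : HasDerivAt (fun t : ℝ => fderiv ℝ Y (x + t • z₁) z)
      (fderiv ℝ (fderiv ℝ Y) x z₁ z) 0 := by
    simpa using hD.clm_apply (hasDerivAt_const 0 z)
  -- The form is frozen at `Y x` here, so `G` is never differentiated; its variation enters only
  -- through difference quotients.
  have hB : HasDerivAt (fun t : ℝ => G (Y x) (fderiv ℝ Y (x + t • z₁) z₂)
      (fderiv ℝ Y (x + t • z₁) z₃))
      (G (Y x) (fderiv ℝ (fderiv ℝ Y) x z₁ z₂) (fderiv ℝ Y x z₃)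
        + G (Y x) (fderiv ℝ Y x z₂) (fderiv ℝ (fderiv ℝ Y) x z₁ z₃)) 0 := by
    have h1 : HasDerivAt (fun t : ℝ => G (Y x) (fderiv ℝ Y (x + t • z₁) z₂))
        (G (Y x) (fderiv ℝ (fderiv ℝ Y) x z₁ z₂)) 0 :=
      (G (Y x)).hasFDerivAt.comp_hasDerivAt 0 (hDz z₂)
    simpa [hx0] using h1.clm_apply (hDz z₃)
  have hh := (hg'.sub hB).tendsto_slope_zero
  have hbound := ((hy.tendsto_slope_zero.norm.const_mul Λ).mul
    ((hDz z₂).continuousAt.tendsto.norm.mono_left (nhdsWithin_le_nhds (s := {0}ᶜ)))).mul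
    ((hDz z₃).continuousAt.tendsto.norm.mono_left (nhdsWithin_le_nhds (s := {0}ᶜ)))
  simp only [hx0] at hbound
  have hx := hg.self_of_nhds
  rw [sub_sub]
  refine le_of_tendsto_of_tendsto hh.abs hbound ?_
  have hev := (htend.eventually (hg.and hG)).filter_mono (nhdsWithin_le_nhds (s := {0}ᶜ))
  filter_upwards [hev] with t ht
  obtain ⟨ht1, ht2⟩ := ht
  simp only [zero_add, smul_eq_mul, Pi.sub_apply, hx0]
  rw [← ht1, ← hx, sub_self, sub_zero, abs_mul]
  have e : G (Y (x + t • z₁)) (fderiv ℝ Y (x + t • z₁) z₂) (fderiv ℝ Y (x + t • z₁) z₃)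
      - G (Y x) (fderiv ℝ Y (x + t • z₁) z₂) (fderiv ℝ Y (x + t • z₁) z₃)
      = (G (Y (x + t • z₁)) - G (Y x)) (fderiv ℝ Y (x + t • z₁) z₂)
        (fderiv ℝ Y (x + t • z₁) z₃) := by simp
  rw [e, norm_smul, Real.norm_eq_abs]
  calc |t⁻¹| * |(G (Y (x + t • z₁)) - G (Y x)) (fderiv ℝ Y (x + t • z₁) z₂)
        (fderiv ℝ Y (x + t • z₁) z₃)|
      ≤ |t⁻¹| * ((Λ * ‖Y (x + t • z₁) - Y x‖) * ‖fderiv ℝ Y (x + t • z₁) z₂‖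
        * ‖fderiv ℝ Y (x + t • z₁) z₃‖) := by
        gcongr
        refine ((G (Y (x + t • z₁)) - G (Y x)).le_opNorm₂ _ _).trans ?_
        gcongr
    _ = _ := by ring

/-- The Gauss formula with a bounded error: if `c` is the covariant derivative of `z₂` along `z₁`
for `g`, then the second derivative of `Y` agrees with the image of `c` up to a quadratic error. -/
theorem norm_fderiv_fderiv_sub_le {Y : F → E} {G : E → E →L[ℝ] E →L[ℝ] ℝ} {g : F → F → F → ℝ}
    {x z₁ z₂ c : F} {Λ C : ℝ} {k₁ k₂ k₃ : F → ℝ} (hC : 0 ≤ C) (hΛ : 0 ≤ Λ)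
    (hY : ContDiffAt ℝ 2 Y x)
    (hg : ∀ᶠ p in 𝓝 x, ∀ z w, G (Y p) (fderiv ℝ Y p z) (fderiv ℝ Y p w) = g p z w)
    (hG : ∀ᶠ p in 𝓝 x, ‖G (Y p) - G (Y x)‖ ≤ Λ * ‖Y p - Y x‖)
    (hsymm : ∀ V W, G (Y x) V W = G (Y x) W V)
    (hnondeg : ∀ V, ‖V‖ ≤ C * ‖G (Y x) V‖)
    (hsurj : Function.Surjective (fderiv ℝ Y x))
    (h₁ : ∀ z, HasDerivAt (fun t : ℝ => g (x + t • z₁) z₂ z) (k₁ z) 0)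
    (h₂ : ∀ z, HasDerivAt (fun t : ℝ => g (x + t • z₂) z₁ z) (k₂ z) 0)
    (h₃ : ∀ z, HasDerivAt (fun t : ℝ => g (x + t • z) z₁ z₂) (k₃ z) 0)
    (hc : ∀ z, 2 * g x c z = k₁ z + k₂ z - k₃ z) :
    ‖fderiv ℝ (fderiv ℝ Y) x z₁ z₂ - fderiv ℝ Y x c‖
      ≤ 2 * C * Λ * ‖fderiv ℝ Y x z₁‖ * ‖fderiv ℝ Y x z₂‖ := by
  have hsym : ∀ a b, fderiv ℝ (fderiv ℝ Y) x a b = fderiv ℝ (fderiv ℝ Y) x b a := by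
    intro a b
    exact (hY.isSymmSndFDerivAt (by simp)) a b
  refine (hnondeg _).trans ?_
  have : ‖G (Y x) (fderiv ℝ (fderiv ℝ Y) x z₁ z₂ - fderiv ℝ Y x c)‖
      ≤ 2 * Λ * ‖fderiv ℝ Y x z₁‖ * ‖fderiv ℝ Y x z₂‖ := by
    refine ContinuousLinearMap.opNorm_le_bound _ (by positivity) fun Z => ?_
    obtain ⟨z, rfl⟩ := hsurj Z
    have b1 := abs_le.1 (abs_deriv_pullback_sub_le hY hg hG (h₁ z))
    have b2 := abs_le.1 (abs_deriv_pullback_sub_le hY hg hG (h₂ z))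
    have b3 := abs_le.1 (abs_deriv_pullback_sub_le hY hg hG (h₃ z))
    have e1 := hg.self_of_nhds c z
    rw [hsym z z₁, hsym z z₂, hsymm (fderiv ℝ (fderiv ℝ Y) x z₁ z)] at b3
    rw [hsym z₂ z₁] at b2
    have hc' := hc z
    rw [map_sub, sub_apply, e1, Real.norm_eq_abs, abs_le]
    have hpos : 0 ≤ Λ * ‖fderiv ℝ Y x z₁‖ * ‖fderiv ℝ Y x z₂‖ * ‖fderiv ℝ Y x z‖ := by positivity
    -- By symmetry of the second derivative, the Koszul combination leaves twice the wanted pairing.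
    -- The three errors sum to `3Λ`, and halving gives `3/2 ≤ 2`.
    constructor <;> nlinarith
  calc C * _ ≤ C * _ := mul_le_mul_of_nonneg_left this hC
    _ = _ := by ring

end Koszul

/-! ### The cone over the double null spacetime -/

/-- The coordinate space in which `𝕊²` is replaced by the cone `ℝ³ \ {0}` over it. -/
abbrev ConeSpace : Type := ℝ × ℝ × EuclideanSpace ℝ (Fin 3)

/-- The domain `u < 0`, `v < 0`, `x ≠ 0`. -/
def coneDomain : Set ConeSpace := {p | p.1 < 0 ∧ p.2.1 < 0 ∧ p.2.2 ≠ 0}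

theorem isOpen_coneDomain : IsOpen coneDomain := by
  refine (isOpen_lt continuous_fst continuous_const).inter
    ((isOpen_lt continuous_snd.fst continuous_const).inter
      (isOpen_ne_fun continuous_snd.snd continuous_const))

/-- The pullback of the round metric under `x ↦ x / ‖x‖`. -/
def coneRound (x a b : EuclideanSpace ℝ (Fin 3)) : ℝ :=
  inner ℝ a b / inner ℝ x x - inner ℝ x a * inner ℝ x b / inner ℝ x x ^ 2

/-- The pullback of `-(Q/2)(du ⊗ dv + dv ⊗ du) + R γ̊` to the cone. -/
def coneMetric (Q R : ℝ → ℝ → ℝ) (p z w : ConeSpace) : ℝ :=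
  -(Q p.1 p.2.1 / 2) * (z.1 * w.2.1 + z.2.1 * w.1) +
    R p.1 p.2.1 * coneRound p.2.2 z.2.2 w.2.2

/-- Only points of the unit sphere are needed, which is why the powers of `‖x‖` in the quotient rule
disappear. -/
theorem hasDerivAt_coneRound {x z a b : EuclideanSpace ℝ (Fin 3)} (hx : ‖x‖ = 1) :
    HasDerivAt (fun t : ℝ => coneRound (x + t • z) a b)
      (-2 * inner ℝ x z * inner ℝ a b - inner ℝ z a * inner ℝ x b - inner ℝ x a * inner ℝ z b
        + 4 * inner ℝ x a * inner ℝ x b * inner ℝ x z) 0 := by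
  have hline : HasDerivAt (fun t : ℝ => x + t • z) z 0 := by
    simpa using ((hasDerivAt_id (0 : ℝ)).smul_const z).const_add x
  have h1 := hline.inner ℝ hline
  have h2 := hline.inner ℝ (hasDerivAt_const 0 a)
  have h3 := hline.inner ℝ (hasDerivAt_const 0 b)
  have hx0 : x ≠ 0 := by rintro rfl; simp at hx
  have h4 := ((hasDerivAt_const (0 : ℝ) (inner ℝ a b : ℝ)).div h1 (by simp [hx0])).sub
    ((h2.mul h3).div (h1.pow 2) (by simp [hx0]))
  unfold coneRound
  convert! h4 using 1
  simp [hx, real_inner_comm x z]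
  ring

theorem hasDerivAt_coneMetric {Q R : ℝ → ℝ → ℝ} {Q' R' : ℝ × ℝ →L[ℝ] ℝ} {p z a b : ConeSpace}
    (hQ : HasFDerivAt (fun q : ℝ × ℝ => Q q.1 q.2) Q' (p.1, p.2.1))
    (hR : HasFDerivAt (fun q : ℝ × ℝ => R q.1 q.2) R' (p.1, p.2.1))
    (hp : ‖p.2.2‖ = 1) :
    HasDerivAt (fun t : ℝ => coneMetric Q R (p + t • z) a b)
      (-(Q' (z.1, z.2.1) / 2) * (a.1 * b.2.1 + a.2.1 * b.1) +
        (R' (z.1, z.2.1) * (inner ℝ a.2.2 b.2.2 - inner ℝ p.2.2 a.2.2 * inner ℝ p.2.2 b.2.2) +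
        R p.1 p.2.1 * (-2 * inner ℝ p.2.2 z.2.2 * inner ℝ a.2.2 b.2.2
          - inner ℝ z.2.2 a.2.2 * inner ℝ p.2.2 b.2.2 - inner ℝ p.2.2 a.2.2 * inner ℝ z.2.2 b.2.2
          + 4 * inner ℝ p.2.2 a.2.2 * inner ℝ p.2.2 b.2.2 * inner ℝ p.2.2 z.2.2))) 0 := by
  have hline : HasDerivAt (fun t : ℝ => (p.1 + t * z.1, p.2.1 + t * z.2.1)) (z.1, z.2.1) 0 := by
    have h1 := ((hasDerivAt_id (0 : ℝ)).mul_const z.1).const_add p.1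
    have h2 := ((hasDerivAt_id (0 : ℝ)).mul_const z.2.1).const_add p.2.1
    simpa using h1.prodMk h2
  have hQ1 : HasFDerivAt (fun q : ℝ × ℝ => Q q.1 q.2) Q'
    (p.1 + (0 : ℝ) * z.1, p.2.1 + (0 : ℝ) * z.2.1) := by simpa using hQ
  have hR1 : HasFDerivAt (fun q : ℝ × ℝ => R q.1 q.2) R'
    (p.1 + (0 : ℝ) * z.1, p.2.1 + (0 : ℝ) * z.2.1) := by simpa using hR
  have hQ2 := hQ1.comp_hasDerivAt 0 hline
  have hR2 := hR1.comp_hasDerivAt 0 hline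
  have hS := hasDerivAt_coneRound (x := p.2.2) (z := z.2.2) (a := a.2.2) (b := b.2.2) hp
  have := ((hQ2.div_const 2).neg.mul_const (a.1 * b.2.1 + a.2.1 * b.1)).add (hR2.mul hS)
  unfold coneMetric
  convert! this using 1
  · simp [coneRound, hp]

/-- A positive smooth function on `(-∞,0)²` which is bounded above and away from zero on every
bounded subset. -/
structure IsBoundedCoefficient (Q : ℝ → ℝ → ℝ) : Prop where
  smooth : ContDiffOn ℝ ∞ (fun x : ℝ × ℝ => Q x.1 x.2) (Iio 0 ×ˢ Iio 0)
  bounds : ∀ a < 0, ∃ m > 0, ∃ M, ∀ u ∈ Ico a 0, ∀ v ∈ Ico a 0, m ≤ Q u v ∧ Q u v ≤ M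

namespace IsBoundedCoefficient

variable {Q : ℝ → ℝ → ℝ}

theorem pos (hQ : IsBoundedCoefficient Q) {u v : ℝ} (hu : u < 0) (hv : v < 0) : 0 < Q u v := by
  obtain ⟨m, hm, M, h⟩ := hQ.bounds (min u v) (by simp [hu])
  exact hm.trans_le (h u ⟨by simp, hu⟩ v ⟨by simp, hv⟩).1

theorem hasFDerivAt (hQ : IsBoundedCoefficient Q) {u v : ℝ} (hu : u < 0) (hv : v < 0) :
    HasFDerivAt (fun x : ℝ × ℝ => Q x.1 x.2)
      (fderiv ℝ (fun x : ℝ × ℝ => Q x.1 x.2) (u, v)) (u, v) := by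
  have : Iio (0 : ℝ) ×ˢ Iio (0 : ℝ) ∈ 𝓝 (u, v) := prod_mem_nhds (Iio_mem_nhds hu) (Iio_mem_nhds hv)
  exact ((hQ.smooth.contDiffAt this).differentiableAt (by simp)).hasFDerivAt

theorem hasDerivAt_right (hQ : IsBoundedCoefficient Q) {u v : ℝ} (hu : u < 0) (hv : v < 0) :
    HasDerivAt (fun y => Q u y) (fderiv ℝ (fun x : ℝ × ℝ => Q x.1 x.2) (u, v) (0, 1)) v :=
  (hQ.hasFDerivAt hu hv).comp_hasDerivAt v ((hasDerivAt_const v u).prodMk (hasDerivAt_id v))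

end IsBoundedCoefficient

/-! ### Charts at a boundary point: frames, covariant derivatives, causal cones -/

/-- A map `Y` from an open subset `O` of the cone over the double null spacetime to the range of a
chart in which the metric `G` is Lipschitz and close to a constant metric with time function `τ`. -/
structure BoundaryChart {E : Type*} [NormedAddCommGroup E] [NormedSpace ℝ E] (Q R : ℝ → ℝ → ℝ)
    (Y : ConeSpace → E) (O : Set ConeSpace) (G : E → E →L[ℝ] E →L[ℝ] ℝ) (τ : E →L[ℝ] ℝ) (y₀ : E)
    (ρ Λ C : ℝ) : Prop where
  finrank_eq : Module.finrank ℝ E = 4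
  isOpen : IsOpen O
  subset : O ⊆ coneDomain
  smooth : ContDiffOn ℝ ∞ Y O
  closed : ∀ x ∈ coneDomain, x ∈ closure {p ∈ O | Y p ∈ Metric.closedBall y₀ ρ} → x ∈ O
  isometric : ∀ x ∈ O, ∀ z w, G (Y x) (fderiv ℝ Y x z) (fderiv ℝ Y x w) = coneMetric Q R x z w
  Lip_nonneg : 0 ≤ Λ
  lipschitz : ∀ x ∈ Metric.closedBall y₀ ρ, ∀ y ∈ Metric.closedBall y₀ ρ, ‖G x - G y‖ ≤ Λ * ‖x - y‖
  C_pos : 0 < C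
  symm : ∀ y ∈ Metric.closedBall y₀ ρ, ∀ V W, G y V W = G y W V
  nondegenerate : ∀ y ∈ Metric.closedBall y₀ ρ, ∀ V, ‖V‖ ≤ C * ‖G y V‖
  bounded : ∀ y ∈ Metric.closedBall y₀ ρ, ‖G y‖ ≤ C
  cone : ∀ y ∈ Metric.closedBall y₀ ρ, ∀ V, G y V V ≤ 0 → ‖V‖ ≤ C * |τ V|

/-- The set of points which `Y` maps to the closed ball of radius `σ`, and at which `∂_u + ∂_v` is
future directed with respect to `τ`. -/
def chartRegion {E : Type*} [NormedAddCommGroup E] [NormedSpace ℝ E] (Y : ConeSpace → E)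
    (O : Set ConeSpace) (τ : E →L[ℝ] ℝ) (y₀ : E) (σ : ℝ) : Set ConeSpace :=
  {x | x ∈ O ∧ Y x ∈ Metric.closedBall y₀ σ ∧ 0 < τ (fderiv ℝ Y x (1, 1, 0))}

theorem coneMetric_of_norm_eq_one {Q R : ℝ → ℝ → ℝ} {x : ConeSpace} (hx : ‖x.2.2‖ = 1)
    (z w : ConeSpace) :
    coneMetric Q R x z w = -(Q x.1 x.2.1 / 2) * (z.1 * w.2.1 + z.2.1 * w.1) +
      R x.1 x.2.1 * (inner ℝ z.2.2 w.2.2 - inner ℝ x.2.2 z.2.2 * inner ℝ x.2.2 w.2.2) := by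
  simp [coneMetric, coneRound, hx]

namespace BoundaryChart

variable {E : Type*} [NormedAddCommGroup E] [NormedSpace ℝ E] {Q R : ℝ → ℝ → ℝ}
    {Y : ConeSpace → E} {O : Set ConeSpace} {G : E → E →L[ℝ] E →L[ℝ] ℝ} {τ : E →L[ℝ] ℝ} {y₀ : E}
    {ρ Λ C : ℝ}

theorem contDiffAt (h : BoundaryChart Q R Y O G τ y₀ ρ Λ C) {x : ConeSpace} (hx : x ∈ O) :
    ContDiffAt ℝ ∞ Y x :=
  h.smooth.contDiffAt (h.isOpen.mem_nhds hx)

theorem hasFDerivAt (h : BoundaryChart Q R Y O G τ y₀ ρ Λ C) {x : ConeSpace} (hx : x ∈ O) :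
    HasFDerivAt Y (fderiv ℝ Y x) x :=
  ((h.contDiffAt hx).differentiableAt (by simp)).hasFDerivAt

theorem hasFDerivAt_fderiv (h : BoundaryChart Q R Y O G τ y₀ ρ Λ C) {x : ConeSpace}
    (hx : x ∈ O) : HasFDerivAt (fderiv ℝ Y) (fderiv ℝ (fderiv ℝ Y) x) x :=
  (((h.contDiffAt hx).fderiv_right (m := 1) (by norm_cast)).differentiableAt (by simp)).hasFDerivAt

theorem continuousOn (h : BoundaryChart Q R Y O G τ y₀ ρ Λ C) : ContinuousOn Y O :=
  h.smooth.continuousOn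

theorem continuousAt_fderiv (h : BoundaryChart Q R Y O G τ y₀ ρ Λ C) {x : ConeSpace}
    (hx : x ∈ O) : ContinuousAt (fderiv ℝ Y) x :=
  (h.hasFDerivAt_fderiv hx).continuousAt

/-- The pulled-back form degenerates only radially, so the kernel has dimension at most one and the
rank is at least `5 - 1 = 4`. Surjectivity is what allows testing against every vector of the
target. -/
theorem surjective_fderiv (h : BoundaryChart Q R Y O G τ y₀ ρ Λ C)
    (hQ : IsBoundedCoefficient Q) (hR : IsBoundedCoefficient R) {x : ConeSpace} (hx : x ∈ O)
    (hx1 : ‖x.2.2‖ = 1) : Function.Surjective (fderiv ℝ Y x) := by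
  have hdom := h.subset hx
  have hQx := hQ.pos hdom.1 hdom.2.1
  have hRx := hR.pos hdom.1 hdom.2.1
  have : FiniteDimensional ℝ E := Module.finite_of_finrank_pos (by rw [h.finrank_eq]; norm_num)
  have hker : LinearMap.ker (fderiv ℝ Y x).toLinearMap
      ≤ Submodule.span ℝ {((0, 0, x.2.2) : ConeSpace)} := by
    intro z hz
    have hz0 : fderiv ℝ Y x z = 0 := hz
    have hall (w) : coneMetric Q R x z w = 0 := by rw [← h.isometric x hx, hz0]; simp
    simp only [coneMetric_of_norm_eq_one hx1] at hall
    have h1 := hall (0, 1, 0)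
    have h2 := hall (1, 0, 0)
    have h3 := hall (0, 0, z.2.2 - (inner ℝ x.2.2 z.2.2 : ℝ) • x.2.2)
    simp [hQx.ne'] at h1 h2
    simp only [h1, h2, inner_sub_right, inner_smul_right, real_inner_self_eq_norm_sq x.2.2, hx1,
      real_inner_comm x.2.2 z.2.2] at h3
    have h4 : ‖z.2.2 - (inner ℝ x.2.2 z.2.2 : ℝ) • x.2.2‖ ^ 2 = 0 := by
      rw [← real_inner_self_eq_norm_sq]
      simp only [inner_sub_right, inner_sub_left, inner_smul_right, inner_smul_left,
        real_inner_self_eq_norm_sq x.2.2, hx1, real_inner_comm x.2.2 z.2.2]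
      have : R x.1 x.2.1 ≠ 0 := hRx.ne'
      simp [this] at h3 ⊢
      linarith
    rw [Submodule.mem_span_singleton]
    refine ⟨inner ℝ x.2.2 z.2.2, ?_⟩
    have h5 := sub_eq_zero.1 (norm_eq_zero.1 (pow_eq_zero_iff (two_ne_zero)|>.1 h4))
    ext1
    · simp [h1]
    · ext1
      · simp [h2]
      · simpa using h5.symm
  have hk : Module.finrank ℝ (LinearMap.ker (fderiv ℝ Y x).toLinearMap) ≤ 1 :=
    (Submodule.finrank_mono hker).trans ((finrank_span_le_card _).trans (by simp))
  have hrn := LinearMap.finrank_range_add_finrank_ker (fderiv ℝ Y x).toLinearMap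
  have hd : Module.finrank ℝ ConeSpace = 5 := by simp
  have hr : Module.finrank ℝ (LinearMap.range (fderiv ℝ Y x).toLinearMap) = Module.finrank ℝ E := by
    have := Submodule.finrank_le (LinearMap.range (fderiv ℝ Y x).toLinearMap)
    rw [hd] at hrn
    rw [h.finrank_eq] at this ⊢
    omega
  have := Submodule.eq_top_of_finrank_eq hr
  exact LinearMap.range_eq_top.1 this

/-- The image of the radial vector is `G`-orthogonal to the image of every vector, hence to
everything, and `G` is nondegenerate. -/
theorem fderiv_radial (h : BoundaryChart Q R Y O G τ y₀ ρ Λ C)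
    (hQ : IsBoundedCoefficient Q) (hR : IsBoundedCoefficient R) {x : ConeSpace} (hx : x ∈ O)
    (hy : Y x ∈ Metric.closedBall y₀ ρ) (hx1 : ‖x.2.2‖ = 1) :
    fderiv ℝ Y x (0, 0, x.2.2) = 0 := by
  have h0 : G (Y x) (fderiv ℝ Y x (0, 0, x.2.2)) = 0 := by
    ext Z
    obtain ⟨z, rfl⟩ := h.surjective_fderiv hQ hR hx hx1 Z
    rw [h.isometric x hx, coneMetric_of_norm_eq_one hx1]
    simp [hx1]
  have := h.nondegenerate _ hy (fderiv ℝ Y x (0, 0, x.2.2))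
  rw [h0] at this
  simpa using this

/-- Here `hc` is the Koszul identity for constant fields `z₁`, `z₂` tangent to the sphere. The
remaining derivatives of the cone metric, those proportional to `⟨x, z⟩⟨z₁, z₂⟩`, cancel in the
Koszul combination. -/
theorem gauss (h : BoundaryChart Q R Y O G τ y₀ ρ Λ C)
    (hQ : IsBoundedCoefficient Q) (hR : IsBoundedCoefficient R) {x : ConeSpace} (hx : x ∈ O)
    (hy : Y x ∈ Metric.ball y₀ ρ) (hx1 : ‖x.2.2‖ = 1) {z₁ z₂ c : ConeSpace}
    {Q' R' : ℝ × ℝ →L[ℝ] ℝ}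
    (hQ' : fderiv ℝ (fun x : ℝ × ℝ => Q x.1 x.2) (x.1, x.2.1) = Q')
    (hR' : fderiv ℝ (fun x : ℝ × ℝ => R x.1 x.2) (x.1, x.2.1) = R')
    (hz₁ : inner ℝ x.2.2 z₁.2.2 = (0 : ℝ)) (hz₂ : inner ℝ x.2.2 z₂.2.2 = (0 : ℝ))
    (hc : ∀ z, 2 * coneMetric Q R x c z =
      -(Q' (z₁.1, z₁.2.1) / 2) * (z₂.1 * z.2.1 + z₂.2.1 * z.1)
      + R' (z₁.1, z₁.2.1) * inner ℝ z₂.2.2 z.2.2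
      - (Q' (z₂.1, z₂.2.1) / 2) * (z₁.1 * z.2.1 + z₁.2.1 * z.1)
      + R' (z₂.1, z₂.2.1) * inner ℝ z₁.2.2 z.2.2
      + (Q' (z.1, z.2.1) / 2) * (z₁.1 * z₂.2.1 + z₁.2.1 * z₂.1)
      - R' (z.1, z.2.1) * inner ℝ z₁.2.2 z₂.2.2) :
    ‖fderiv ℝ (fderiv ℝ Y) x z₁ z₂ - fderiv ℝ Y x c‖
      ≤ 2 * C * Λ * ‖fderiv ℝ Y x z₁‖ * ‖fderiv ℝ Y x z₂‖ := by
  have hdom := h.subset hx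
  have hyc := Metric.ball_subset_closedBall hy
  have hQd := hQ.hasFDerivAt hdom.1 hdom.2.1
  have hRd := hR.hasFDerivAt hdom.1 hdom.2.1
  rw [hQ'] at hQd
  rw [hR'] at hRd
  refine norm_fderiv_fderiv_sub_le h.C_pos.le h.Lip_nonneg
    ((h.contDiffAt hx).of_le (by norm_cast))
    (Filter.mem_of_superset (h.isOpen.mem_nhds hx) fun p hp => h.isometric p hp)
    ?_ (h.symm _ hyc) (h.nondegenerate _ hyc) (h.surjective_fderiv hQ hR hx hx1)
    (fun z => hasDerivAt_coneMetric hQd hRd hx1) (fun z => hasDerivAt_coneMetric hQd hRd hx1)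
    (fun z => hasDerivAt_coneMetric hQd hRd hx1) ?_
  · filter_upwards [(h.contDiffAt hx).continuousAt.preimage_mem_nhds
      (Metric.isOpen_ball.mem_nhds hy)] with p hp
    exact h.lipschitz _ (Metric.ball_subset_closedBall hp) _ hyc
  · intro z
    rw [hc]
    simp only [hz₁, hz₂, real_inner_comm z₁.2.2 z₂.2.2]
    ring

/-- The `v`-lines are null geodesics up to parametrisation, with acceleration `(∂_v Q / Q) ∂_v`. -/
theorem gauss_vv (h : BoundaryChart Q R Y O G τ y₀ ρ Λ C)
    (hQ : IsBoundedCoefficient Q) (hR : IsBoundedCoefficient R) {x : ConeSpace} (hx : x ∈ O)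
    (hy : Y x ∈ Metric.ball y₀ ρ) (hx1 : ‖x.2.2‖ = 1) :
    ‖fderiv ℝ (fderiv ℝ Y) x (0, 1, 0) (0, 1, 0) -
        (fderiv ℝ (fun x : ℝ × ℝ => Q x.1 x.2) (x.1, x.2.1) (0, 1) / Q x.1 x.2.1) •
          fderiv ℝ Y x (0, 1, 0)‖
      ≤ 2 * C * Λ * ‖fderiv ℝ Y x (0, 1, 0)‖ * ‖fderiv ℝ Y x (0, 1, 0)‖ := by
  have hQx := hQ.pos (h.subset hx).1 (h.subset hx).2.1
  rw [← map_smul]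
  refine h.gauss hQ hR hx hy hx1 rfl rfl (by simp) (by simp) fun z => ?_
  rw [coneMetric_of_norm_eq_one hx1]
  simp
  field_simp
  ring

/-- Sphere vectors are transported along `v`-lines up to the logarithmic derivative of `√R`. -/
theorem gauss_va (h : BoundaryChart Q R Y O G τ y₀ ρ Λ C)
    (hQ : IsBoundedCoefficient Q) (hR : IsBoundedCoefficient R) {x : ConeSpace} (hx : x ∈ O)
    (hy : Y x ∈ Metric.ball y₀ ρ) (hx1 : ‖x.2.2‖ = 1) {a : EuclideanSpace ℝ (Fin 3)}
    (ha : inner ℝ x.2.2 a = (0 : ℝ)) :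
    ‖fderiv ℝ (fderiv ℝ Y) x (0, 1, 0) (0, 0, a) -
        (fderiv ℝ (fun x : ℝ × ℝ => R x.1 x.2) (x.1, x.2.1) (0, 1) / (2 * R x.1 x.2.1)) •
          fderiv ℝ Y x (0, 0, a)‖
      ≤ 2 * C * Λ * ‖fderiv ℝ Y x (0, 1, 0)‖ * ‖fderiv ℝ Y x (0, 0, a)‖ := by
  have hRx := hR.pos (h.subset hx).1 (h.subset hx).2.1
  rw [← map_smul]
  refine h.gauss hQ hR hx hy hx1 rfl rfl (by simp) (by simpa using ha) fun z => ?_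
  rw [coneMetric_of_norm_eq_one hx1]
  have h0 : fderiv ℝ (fun x : ℝ × ℝ => Q x.1 x.2) (x.1, x.2.1) (0, 0) = 0 := map_zero _
  simp [inner_smul_left, inner_smul_right, ha, h0]
  field_simp

/-- This is the second fundamental form of the symmetry spheres. The `∂_u` coefficient `∂_v R / Q`
is the quantity that blows up. -/
theorem gauss_aa (h : BoundaryChart Q R Y O G τ y₀ ρ Λ C)
    (hQ : IsBoundedCoefficient Q) (hR : IsBoundedCoefficient R) {x : ConeSpace} (hx : x ∈ O)
    (hy : Y x ∈ Metric.ball y₀ ρ) (hx1 : ‖x.2.2‖ = 1) {a : EuclideanSpace ℝ (Fin 3)}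
    (ha : inner ℝ x.2.2 a = (0 : ℝ)) (ha1 : ‖a‖ = 1) :
    ‖fderiv ℝ (fderiv ℝ Y) x (0, 0, a) (0, 0, a) -
        ((fderiv ℝ (fun x : ℝ × ℝ => R x.1 x.2) (x.1, x.2.1) (0, 1) / Q x.1 x.2.1) •
          fderiv ℝ Y x (1, 0, 0) +
        (fderiv ℝ (fun x : ℝ × ℝ => R x.1 x.2) (x.1, x.2.1) (1, 0) / Q x.1 x.2.1) •
          fderiv ℝ Y x (0, 1, 0))‖
      ≤ 2 * C * Λ * ‖fderiv ℝ Y x (0, 0, a)‖ * ‖fderiv ℝ Y x (0, 0, a)‖ := by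
  have hQx := hQ.pos (h.subset hx).1 (h.subset hx).2.1
  rw [← map_smul, ← map_smul, ← map_add]
  refine h.gauss hQ hR hx hy hx1 rfl rfl (by simpa using ha) (by simpa using ha) fun z => ?_
  rw [coneMetric_of_norm_eq_one hx1]
  have hz : fderiv ℝ (fun x : ℝ × ℝ => R x.1 x.2) (x.1, x.2.1) (z.1, z.2.1) =
      z.1 * fderiv ℝ (fun x : ℝ × ℝ => R x.1 x.2) (x.1, x.2.1) (1, 0)
      + z.2.1 * fderiv ℝ (fun x : ℝ × ℝ => R x.1 x.2) (x.1, x.2.1) (0, 1) := by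
    rw [← smul_eq_mul, ← smul_eq_mul, ← map_smul, ← map_smul, ← map_add]
    simp
  have h0 : fderiv ℝ (fun x : ℝ × ℝ => R x.1 x.2) (x.1, x.2.1) (0, 0) = 0 := map_zero _
  simp [ha1, h0, hz]
  field_simp
  ring

/-- Only the sign in the cone estimate needs an argument. Were `τ` negative on the image of the
future causal vector `X`, adding a positive multiple `l` of `∂_u + ∂_v` would give a timelike vector
on which `τ` vanishes, contradicting the cone estimate. -/
theorem norm_fderiv_le (h : BoundaryChart Q R Y O G τ y₀ ρ Λ C) (hQ : IsBoundedCoefficient Q)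
    {σ : ℝ} (hσ : σ ≤ ρ) {x X : ConeSpace} (hx : x ∈ chartRegion Y O τ y₀ σ)
    (hX1 : 0 ≤ X.1) (hX2 : 0 ≤ X.2.1) (hX : coneMetric Q R x X X ≤ 0) :
    ‖fderiv ℝ Y x X‖ ≤ C * τ (fderiv ℝ Y x X) := by
  obtain ⟨hxO, hxY, hT⟩ := hx
  have hQx := hQ.pos (h.subset hxO).1 (h.subset hxO).2.1
  have hy := Metric.closedBall_subset_closedBall hσ hxY
  have key : 0 ≤ τ (fderiv ℝ Y x X) := by
    by_contra! hneg
    set l := -τ (fderiv ℝ Y x X) / τ (fderiv ℝ Y x (1, 1, 0)) with hl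
    have hlpos : 0 < l := div_pos (by linarith) hT
    have h0 : τ (fderiv ℝ Y x (X + l • (1, 1, 0))) = 0 := by
      rw [map_add, map_smul, map_add, map_smul, hl, smul_eq_mul]
      field_simp
      ring
    have hm : coneMetric Q R x (X + l • (1, 1, 0)) (X + l • (1, 1, 0)) < 0 := by
      have : coneMetric Q R x (X + l • (1, 1, 0)) (X + l • (1, 1, 0))
          = coneMetric Q R x X X - Q x.1 x.2.1 * l * (X.1 + X.2.1 + l) := by
        simp [coneMetric]
        ring
      rw [this]
      have : 0 < Q x.1 x.2.1 * l * (X.1 + X.2.1 + l) := by positivity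
      linarith
    rw [← h.isometric x hxO] at hm
    have h2 := h.cone _ hy _ hm.le
    rw [h0] at h2
    have h3 : fderiv ℝ Y x (X + l • (1, 1, 0)) = 0 := by simpa using h2
    rw [h3] at hm
    simp at hm
  have := h.cone _ hy (fderiv ℝ Y x X) (by rw [h.isometric x hxO]; exact hX)
  rwa [abs_of_nonneg key] at this

/-- The closed half of every continuity argument below. Membership in `O` comes from the field
`closed`, and the strict sign survives the limit because `τ` cannot vanish on a timelike vector. -/
theorem mem_chartRegion_of_mem_closure (h : BoundaryChart Q R Y O G τ y₀ ρ Λ C)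
    (hQ : IsBoundedCoefficient Q) {σ : ℝ} (hσ : σ ≤ ρ) {x : ConeSpace} (hx : x ∈ coneDomain)
    (hcl : x ∈ closure (chartRegion Y O τ y₀ σ)) : x ∈ chartRegion Y O τ y₀ σ := by
  have hsub : chartRegion Y O τ y₀ σ ⊆ {p ∈ O | Y p ∈ Metric.closedBall y₀ ρ} := fun p hp =>
    ⟨hp.1, Metric.closedBall_subset_closedBall hσ hp.2.1⟩
  have hxO : x ∈ O := h.closed x hx (closure_mono hsub hcl)
  have hYx : Y x ∈ Metric.closedBall y₀ σ := by
    have h1 := (h.contDiffAt hxO).continuousAt.continuousWithinAt.mem_closure_image hcl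
    refine closure_minimal ?_ Metric.isClosed_closedBall h1
    rintro _ ⟨p, hp, rfl⟩
    exact hp.2.1
  have hQx := hQ.pos hx.1 hx.2.1
  refine ⟨hxO, hYx, ?_⟩
  have hge : 0 ≤ τ (fderiv ℝ Y x (1, 1, 0)) := by
    have hc : ContinuousAt (fun p => τ (fderiv ℝ Y p (1, 1, 0))) x :=
      τ.continuous.continuousAt.comp ((h.continuousAt_fderiv hxO).clm_apply continuousAt_const)
    have h1 := hc.continuousWithinAt.mem_closure_image hcl
    refine closure_minimal ?_ isClosed_Ici h1
    rintro _ ⟨p, hp, rfl⟩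
    exact hp.2.2.le
  refine lt_of_le_of_ne hge fun h0 => ?_
  have hm : coneMetric Q R x (1, 1, 0) (1, 1, 0) < 0 := by
    simp [coneMetric, coneRound, hQx]
  rw [← h.isometric x hxO] at hm
  have h2 := h.cone _ (Metric.closedBall_subset_closedBall hσ hYx) _ hm.le
  rw [← h0] at h2
  have h3 : fderiv ℝ Y x (1, 1, 0) = 0 := by simpa using h2
  rw [h3] at hm
  simp at hm

/-- The open half: being open costs an arbitrarily small increase of the radius, so the arguments
below first improve the radius strictly. -/
theorem eventually_mem_chartRegion (h : BoundaryChart Q R Y O G τ y₀ ρ Λ C)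
    {σ σ' : ℝ} (hσσ' : σ < σ') {x : ConeSpace} (hx : x ∈ chartRegion Y O τ y₀ σ) :
    ∀ᶠ p in 𝓝 x, p ∈ chartRegion Y O τ y₀ σ' := by
  have hc : ContinuousAt (fun p => τ (fderiv ℝ Y p (1, 1, 0))) x :=
    τ.continuous.continuousAt.comp ((h.continuousAt_fderiv hx.1).clm_apply continuousAt_const)
  have hb : Y x ∈ Metric.ball y₀ σ' := Metric.closedBall_subset_ball hσσ' hx.2.1
  filter_upwards [h.isOpen.mem_nhds hx.1, (h.contDiffAt hx.1).continuousAt.preimage_mem_nhds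
    (Metric.isOpen_ball.mem_nhds hb), hc.eventually (lt_mem_nhds hx.2.2)] with p h1 h2 h3
  exact ⟨h1, Metric.ball_subset_closedBall h2, h3⟩

end BoundaryChart

/-! ### Null lines inside a chart -/

/-- Continuous induction: a relatively closed subset of `[a, b]` which contains `a` and in which one
can always move a little to the right contains all of `[a, b]`. -/
theorem Icc_subset_of_isClosed_of_eventually {a b : ℝ} {S : Set ℝ} (hS : IsClosed (S ∩ Icc a b))
    (ha : a ∈ S) (h : ∀ x ∈ Ico a b, Icc a x ⊆ S → ∀ᶠ y in 𝓝[>] x, y ∈ S) : Icc a b ⊆ S := by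
  have hcl : IsClosed ({x | Icc a x ⊆ S} ∩ Icc a b) := by
    refine isClosed_of_closure_subset fun x hx => ?_
    have hxI : x ∈ Icc a b :=
      closure_minimal inter_subset_right isClosed_Icc hx
    refine ⟨fun y hy => ?_, hxI⟩
    rcases hy.2.lt_or_eq with hlt | rfl
    · obtain ⟨z, hz1, hz2⟩ := mem_closure_iff.1 hx (Ioi y) isOpen_Ioi hlt
      exact hz2.1 ⟨hy.1, le_of_lt hz1⟩
    · refine (closure_minimal (fun z hz => ?_) hS hx : y ∈ S ∩ Icc a b).1
      exact ⟨hz.1 ⟨hz.2.1, le_rfl⟩, hz.2⟩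
  have := hcl.Icc_subset_of_forall_exists_gt (by simpa using ha) fun x hx y hy => by
    obtain ⟨z, hz⟩ := mem_nhdsGT_iff_exists_Ioo_subset.1 (h x hx.2 hx.1)
    obtain ⟨hz0, hz1⟩ := hz
    have hxm : x < min y ((x + z) / 2) := lt_min hy (by have : x < z := hz0; linarith)
    refine ⟨min y ((x + z) / 2), fun t ht => ?_, hxm, min_le_left _ _⟩
    rcases le_or_gt t x with htx | htx
    · exact hx.1 ⟨ht.1, htx⟩
    · refine hz1 ⟨htx, ht.2.trans_lt ((min_le_right _ _).trans_lt ?_)⟩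
      have : x < z := hz0
      linarith
  exact fun x hx => this hx ⟨hx.1, le_rfl⟩

theorem exists_unit_orthogonal (e : EuclideanSpace ℝ (Fin 3)) :
    ∃ f : EuclideanSpace ℝ (Fin 3), ‖f‖ = 1 ∧ inner ℝ e f = (0 : ℝ) := by
  have hne : (Submodule.span ℝ {e})ᗮ ≠ ⊥ := by
    rw [Ne, Submodule.orthogonal_eq_bot_iff]
    intro h
    have h1 : Module.finrank ℝ (Submodule.span ℝ {e}) ≤ 1 :=
      (finrank_span_le_card _).trans (by simp)
    rw [h] at h1
    simp at h1
  obtain ⟨f, hf, hf0⟩ := Submodule.exists_mem_ne_zero_of_ne_bot hne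
  refine ⟨‖f‖⁻¹ • f, by simp [norm_smul, hf0], ?_⟩
  rw [inner_smul_right, Submodule.mem_orthogonal_singleton_iff_inner_right.1 hf, mul_zero]

namespace BoundaryChart

variable {E : Type*} [NormedAddCommGroup E] [NormedSpace ℝ E] {Q R : ℝ → ℝ → ℝ}
    {Y : ConeSpace → E} {O : Set ConeSpace} {G : E → E →L[ℝ] E →L[ℝ] ℝ} {τ : E →L[ℝ] ℝ} {y₀ : E}
    {ρ Λ C : ℝ}

theorem hasDerivAt_line (h : BoundaryChart Q R Y O G τ y₀ ρ Λ C) {u v : ℝ}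
    {e : EuclideanSpace ℝ (Fin 3)} (hx : (u, v, e) ∈ O) :
    HasDerivAt (fun v => Y (u, v, e)) (fderiv ℝ Y (u, v, e) (0, 1, 0)) v :=
  (h.hasFDerivAt hx).comp_hasDerivAt v
    ((hasDerivAt_const v u).prodMk ((hasDerivAt_id v).prodMk (hasDerivAt_const v e)))

/-- A rescaled frame vector is parallel along a `v`-line, up to a bounded error. -/
theorem hasDerivAt_scaled_frame (h : BoundaryChart Q R Y O G τ y₀ ρ Λ C) {u v κ : ℝ}
    {e : EuclideanSpace ℝ (Fin 3)} {z : ConeSpace} {f : ℝ → ℝ} (hx : (u, v, e) ∈ O)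
    (hf0 : 0 ≤ f v) (hf : HasDerivAt f (-(f v * κ)) v)
    (hz : ‖fderiv ℝ (fderiv ℝ Y) (u, v, e) (0, 1, 0) z - κ • fderiv ℝ Y (u, v, e) z‖
      ≤ 2 * C * Λ * ‖fderiv ℝ Y (u, v, e) (0, 1, 0)‖ * ‖fderiv ℝ Y (u, v, e) z‖) :
    ∃ j', HasDerivAt (fun v => f v • fderiv ℝ Y (u, v, e) z) j' v ∧
      ‖j'‖ ≤ 2 * C * Λ * ‖fderiv ℝ Y (u, v, e) (0, 1, 0)‖ * ‖f v • fderiv ℝ Y (u, v, e) z‖ := by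
  have h1 : HasDerivAt (fun v => fderiv ℝ Y (u, v, e))
      (fderiv ℝ (fderiv ℝ Y) (u, v, e) (0, 1, 0)) v :=
    (h.hasFDerivAt_fderiv hx).comp_hasDerivAt v
      ((hasDerivAt_const v u).prodMk ((hasDerivAt_id v).prodMk (hasDerivAt_const v e)))
  have h2 : HasDerivAt (fun v => fderiv ℝ Y (u, v, e) z)
      (fderiv ℝ (fderiv ℝ Y) (u, v, e) (0, 1, 0) z) v := by
    simpa using h1.clm_apply (hasDerivAt_const v z)
  refine ⟨_, hf.smul h2, ?_⟩
  have e1 : f v • fderiv ℝ (fderiv ℝ Y) (u, v, e) (0, 1, 0) z +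
      (-(f v * κ)) • fderiv ℝ Y (u, v, e) z =
      f v • (fderiv ℝ (fderiv ℝ Y) (u, v, e) (0, 1, 0) z - κ • fderiv ℝ Y (u, v, e) z) := by
    rw [smul_sub, smul_smul, neg_smul, sub_eq_add_neg]
  rw [e1, norm_smul, norm_smul, Real.norm_of_nonneg hf0]
  calc f v * _ ≤ f v * _ := mul_le_mul_of_nonneg_left hz hf0
    _ = _ := by ring

/-- The factor `Q⁻¹` turns `∂_v` into an affine null tangent: its logarithmic derivative cancels the
acceleration. -/
theorem hasDerivAt_null_frame (h : BoundaryChart Q R Y O G τ y₀ ρ Λ C)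
    (hQ : IsBoundedCoefficient Q) (hR : IsBoundedCoefficient R) {u v σ : ℝ} (hσ : σ < ρ)
    {e : EuclideanSpace ℝ (Fin 3)} (he : ‖e‖ = 1) (hx : (u, v, e) ∈ chartRegion Y O τ y₀ σ) :
    ∃ j', HasDerivAt (fun v => (Q u v)⁻¹ • fderiv ℝ Y (u, v, e) (0, 1, 0)) j' v ∧
      ‖j'‖ ≤ 2 * C * Λ * ‖fderiv ℝ Y (u, v, e) (0, 1, 0)‖ *
        ‖(Q u v)⁻¹ • fderiv ℝ Y (u, v, e) (0, 1, 0)‖ := by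
  have hdom := h.subset hx.1
  have hQx : 0 < Q u v := hQ.pos hdom.1 hdom.2.1
  refine h.hasDerivAt_scaled_frame hx.1 (f := fun v => (Q u v)⁻¹) (by positivity) ?_
    (h.gauss_vv hQ hR hx.1 (Metric.closedBall_subset_ball hσ hx.2.1) he)
  convert! (hQ.hasDerivAt_right hdom.1 hdom.2.1).inv hQx.ne' using 1
  field_simp

/-- The factor `1/√R` cancels the stretching of the spheres, so the possibly unbounded `∂_v R` no
longer appears. -/
theorem hasDerivAt_sphere_frame (h : BoundaryChart Q R Y O G τ y₀ ρ Λ C)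
    (hQ : IsBoundedCoefficient Q) (hR : IsBoundedCoefficient R) {u v σ : ℝ} (hσ : σ < ρ)
    {e a : EuclideanSpace ℝ (Fin 3)} (he : ‖e‖ = 1) (ha : inner ℝ e a = (0 : ℝ))
    (hx : (u, v, e) ∈ chartRegion Y O τ y₀ σ) :
    ∃ j', HasDerivAt (fun v => (√(R u v))⁻¹ • fderiv ℝ Y (u, v, e) (0, 0, a)) j' v ∧
      ‖j'‖ ≤ 2 * C * Λ * ‖fderiv ℝ Y (u, v, e) (0, 1, 0)‖ *
        ‖(√(R u v))⁻¹ • fderiv ℝ Y (u, v, e) (0, 0, a)‖ := by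
  have hdom := h.subset hx.1
  have hRx : 0 < R u v := hR.pos hdom.1 hdom.2.1
  refine h.hasDerivAt_scaled_frame hx.1 (f := fun v => (√(R u v))⁻¹) (by positivity) ?_
    (h.gauss_va hQ hR hx.1 (Metric.closedBall_subset_ball hσ hx.2.1) he ha)
  convert! ((hR.hasDerivAt_right hdom.1 hdom.2.1).sqrt hRx.ne').inv
    (Real.sqrt_pos.2 hRx).ne' using 1
  have := Real.sqrt_pos.2 hRx
  have h2 : R u v = √(R u v) ^ 2 := (Real.sq_sqrt hRx.le).symm
  simp only
  rw [neg_div]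
  congr 1
  rw [← h2]
  field_simp

theorem norm_fderiv_v_le (h : BoundaryChart Q R Y O G τ y₀ ρ Λ C) (hQ : IsBoundedCoefficient Q)
    {σ : ℝ} (hσ : σ ≤ ρ) {x : ConeSpace} (hx : x ∈ chartRegion Y O τ y₀ σ) :
    ‖fderiv ℝ Y x (0, 1, 0)‖ ≤ C * τ (fderiv ℝ Y x (0, 1, 0)) :=
  h.norm_fderiv_le hQ hσ hx (by simp) (by simp) (by simp [coneMetric, coneRound])

theorem norm_fderiv_u_le (h : BoundaryChart Q R Y O G τ y₀ ρ Λ C) (hQ : IsBoundedCoefficient Q)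
    {σ : ℝ} (hσ : σ ≤ ρ) {x : ConeSpace} (hx : x ∈ chartRegion Y O τ y₀ σ) :
    ‖fderiv ℝ Y x (1, 0, 0)‖ ≤ C * τ (fderiv ℝ Y x (1, 0, 0)) :=
  h.norm_fderiv_le hQ hσ hx (by simp) (by simp) (by simp [coneMetric, coneRound])

/-- The tangent of a null line inside the chart stays bounded. -/
theorem exists_norm_null_frame_le (h : BoundaryChart Q R Y O G τ y₀ ρ Λ C)
    (hQ : IsBoundedCoefficient Q) (hR : IsBoundedCoefficient R) {u v₁ σ : ℝ} (hσ : σ < ρ)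
    {e : EuclideanSpace ℝ (Fin 3)} (he : ‖e‖ = 1)
    (hline : ∀ v ∈ Ico v₁ 0, (u, v, e) ∈ chartRegion Y O τ y₀ σ) :
    ∃ N, ∀ v ∈ Ico v₁ 0, ‖(Q u v)⁻¹ • fderiv ℝ Y (u, v, e) (0, 1, 0)‖ ≤ N := by
  set j : ℝ → E := fun v => (Q u v)⁻¹ • fderiv ℝ Y (u, v, e) (0, 1, 0) with hj
  have hC := h.C_pos
  have hΛ := h.Lip_nonneg
  set K := 2 * C * Λ with hK
  have hK0 : 0 ≤ K := by positivity
  refine ⟨(‖j v₁‖ + 1) * Real.exp (K * C * (‖τ‖ * (2 * σ)) + (-v₁)), fun v hv => ?_⟩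
  have hsub : ∀ x ∈ Icc v₁ v, x ∈ Ico v₁ 0 := fun x hx => ⟨hx.1, hx.2.trans_lt hv.2⟩
  choose! j' hj' using fun x (hx : x ∈ Icc v₁ v) =>
    h.hasDerivAt_null_frame hQ hR hσ he (hline x (hsub x hx))
  -- The speed `‖∂_v Y‖` is at most `C` times the derivative of `τ ∘ Y`, so Grönwall's exponent is
  -- controlled by the oscillation of `τ` on the ball. The `+ 1` and the term `x - v₁` make the
  -- barrier inequality strict.
  set B : ℝ → ℝ := fun x =>
    (‖j v₁‖ + 1) * Real.exp (K * C * (τ (Y (u, x, e)) - τ (Y (u, v₁, e))) + (x - v₁)) with hB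
  have hBd : ∀ x ∈ Icc v₁ v, HasDerivAt B (B x *
      (K * C * τ (fderiv ℝ Y (u, x, e) (0, 1, 0)) + 1)) x := by
    intro x hx
    have h1 := τ.hasFDerivAt.comp_hasDerivAt x (h.hasDerivAt_line (hline x (hsub x hx)).1)
    have h2 := ((((h1.sub_const (τ (Y (u, v₁, e)))).const_mul (K * C)).add
      ((hasDerivAt_id x).sub_const v₁)).exp).const_mul (‖j v₁‖ + 1)
    convert! h2 using 1
    simp [hB]
    ring
  have hjB := image_norm_le_of_norm_deriv_right_lt_deriv_boundary' (f := j) (a := v₁) (b := v)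
    (f' := j') (fun x hx => (hj' x hx).1.continuousAt.continuousWithinAt)
    (fun x hx => (hj' x ⟨hx.1, hx.2.le⟩).1.hasDerivWithinAt) (B := B) (by simp [hB])
    (fun x hx => (hBd x hx).continuousAt.continuousWithinAt)
    (fun x hx => (hBd x ⟨hx.1, hx.2.le⟩).hasDerivWithinAt) (fun x hx hxB => by
      have hx' : x ∈ Icc v₁ v := ⟨hx.1, hx.2.le⟩
      refine (hj' x hx').2.trans_lt ?_
      have h3 := h.norm_fderiv_v_le hQ hσ.le (hline x (hsub x hx'))
      have hBpos : 0 < B x := by simp only [hB]; positivity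
      change K * _ * ‖j x‖ < _
      rw [hxB]
      calc K * ‖fderiv ℝ Y (u, x, e) (0, 1, 0)‖ * B x
          ≤ K * (C * τ (fderiv ℝ Y (u, x, e) (0, 1, 0))) * B x := by gcongr
        _ < B x * (K * C * τ (fderiv ℝ Y (u, x, e) (0, 1, 0)) + 1) := by nlinarith)
  refine (hjB ⟨hv.1, le_rfl⟩).trans ?_
  have hY1 := mem_closedBall_iff_norm.1 (hline v hv).2.1
  have hY2 := mem_closedBall_iff_norm.1 (hline v₁ ⟨le_rfl, hv.1.trans_lt hv.2⟩).2.1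
  have h4 : τ (Y (u, v, e)) - τ (Y (u, v₁, e)) ≤ ‖τ‖ * (2 * σ) := by
    rw [← map_sub]
    refine (le_abs_self _).trans ((τ.le_opNorm _).trans ?_)
    gcongr
    have : Y (u, v, e) - Y (u, v₁, e) = (Y (u, v, e) - y₀) - (Y (u, v₁, e) - y₀) := by abel
    rw [this]
    exact (norm_sub_le _ _).trans (by linarith)
  have h5 : v - v₁ ≤ -v₁ := by linarith [hv.2]
  simp only [hB]
  gcongr

/-- A null line which starts close enough to `v = 0` with bounded tangent stays inside the chart. -/
theorem mem_chartRegion_of_norm_null_frame_le (h : BoundaryChart Q R Y O G τ y₀ ρ Λ C)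
    (hQ : IsBoundedCoefficient Q) (hR : IsBoundedCoefficient R) {u v₂ σ σ' N M : ℝ} (hσ : σ < σ')
    (hσ' : σ' < ρ) {e : EuclideanSpace ℝ (Fin 3)} (he : ‖e‖ = 1) (hu : u < 0)
    (hN : 0 < N) (hM : ∀ v ∈ Ico v₂ 0, Q u v ≤ M)
    (hstart : (u, v₂, e) ∈ chartRegion Y O τ y₀ σ)
    (hj : ‖(Q u v₂)⁻¹ • fderiv ℝ Y (u, v₂, e) (0, 1, 0)‖ ≤ N)
    (hs₁ : 2 * C * Λ * (M * (2 * N)) * (2 * N) * (-v₂) ≤ N / 2)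
    (hs₂ : M * (2 * N) * (-v₂) ≤ (σ' - σ) / 2) :
    ∀ v ∈ Ico v₂ 0, (u, v, e) ∈ chartRegion Y O τ y₀ σ' ∧
      ‖(Q u v)⁻¹ • fderiv ℝ Y (u, v, e) (0, 1, 0)‖ ≤ 2 * N ∧
      ‖fderiv ℝ Y (u, v, e) (0, 1, 0)‖ ≤ M * (2 * N) := by
  intro V hV
  set j : ℝ → E := fun v => (Q u v)⁻¹ • fderiv ℝ Y (u, v, e) (0, 1, 0) with hjdef
  have hC := h.C_pos
  have hΛ := h.Lip_nonneg
  have hv2 : v₂ < 0 := hV.1.trans_lt hV.2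
  have hM0 : 0 < M := (hQ.pos hu hv2).trans_le (hM v₂ ⟨le_rfl, hv2⟩)
  have hDv : ∀ v ∈ Ico v₂ 0, ‖j v‖ ≤ 2 * N →
      ‖fderiv ℝ Y (u, v, e) (0, 1, 0)‖ ≤ M * (2 * N) := by
    intro v hv hjv
    have hQx := hQ.pos hu hv.2
    have : fderiv ℝ Y (u, v, e) (0, 1, 0) = Q u v • j v := by
      simp only [hjdef]; rw [smul_smul, mul_inv_cancel₀ hQx.ne', one_smul]
    rw [this, norm_smul, Real.norm_of_nonneg hQx.le]
    exact mul_le_mul (hM v hv) hjv (norm_nonneg _) hM0.le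
  set S : Set ℝ := {v | (u, v, e) ∈ chartRegion Y O τ y₀ σ' ∧ ‖j v‖ ≤ 2 * N} with hS
  have hjc : ∀ v, (u, v, e) ∈ chartRegion Y O τ y₀ σ' → ContinuousAt j v := fun v hv =>
    (h.hasDerivAt_null_frame hQ hR hσ' he hv).choose_spec.1.continuousAt
  have hpt : Continuous fun v : ℝ => ((u, v, e) : ConeSpace) := by fun_prop
  have hstart' : (u, v₂, e) ∈ chartRegion Y O τ y₀ σ' :=
    ⟨hstart.1, Metric.closedBall_subset_closedBall hσ.le hstart.2.1, hstart.2.2⟩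
  have key : Icc v₂ V ⊆ S := by
    refine Icc_subset_of_isClosed_of_eventually ?_ ⟨hstart', hj.trans (by linarith)⟩ ?_
    · refine isClosed_of_closure_subset fun x hx => ?_
      have hxI : x ∈ Icc v₂ V := closure_minimal inter_subset_right isClosed_Icc hx
      have he0 : e ≠ 0 := by rintro rfl; simp at he
      have hxR : (u, x, e) ∈ chartRegion Y O τ y₀ σ' :=
        h.mem_chartRegion_of_mem_closure hQ hσ'.le ⟨hu, hxI.2.trans_lt hV.2, he0⟩
          (map_mem_closure (f := fun v : ℝ => ((u, v, e) : ConeSpace)) hpt hx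
            fun y (hy : y ∈ S ∩ Icc v₂ V) => hy.1.1)
      refine ⟨⟨hxR, ?_⟩, hxI⟩
      have := (hjc x hxR).norm.continuousWithinAt.mem_closure_image hx
      refine closure_minimal ?_ isClosed_Iic this
      rintro _ ⟨y, hy, rfl⟩
      exact hy.1.2
    · intro x hx hIcc
      have hneg : ∀ y ∈ Icc v₂ x, y ∈ Ico v₂ 0 := fun y hy =>
        ⟨hy.1, hy.2.trans_lt (hx.2.trans hV.2)⟩
      choose! j' hj' using fun y (hy : y ∈ Icc v₂ x) =>
        h.hasDerivAt_null_frame hQ hR hσ' he (hIcc hy).1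
      have h1 := norm_image_sub_le_of_norm_deriv_right_le_segment (f := j) (f' := j')
        (C := 2 * C * Λ * (M * (2 * N)) * (2 * N))
        (fun y hy => (hj' y hy).1.continuousAt.continuousWithinAt)
        (fun y hy => (hj' y ⟨hy.1, hy.2.le⟩).1.hasDerivWithinAt)
        (fun y hy => by
          have hy' : y ∈ Icc v₂ x := ⟨hy.1, hy.2.le⟩
          refine (hj' y hy').2.trans ?_
          have := hDv y (hneg y hy') (hIcc hy').2
          have h2 := (hIcc hy').2
          gcongr) x ⟨hx.1, le_rfl⟩
      have h2 := norm_image_sub_le_of_norm_deriv_right_le_segment (f := fun v => Y (u, v, e))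
        (f' := fun v => fderiv ℝ Y (u, v, e) (0, 1, 0)) (C := M * (2 * N))
        (fun y hy => (h.hasDerivAt_line (hIcc hy).1.1).continuousAt.continuousWithinAt)
        (fun y hy => (h.hasDerivAt_line (hIcc ⟨hy.1, hy.2.le⟩).1.1).hasDerivWithinAt)
        (fun y hy => hDv y (hneg y ⟨hy.1, hy.2.le⟩) (hIcc ⟨hy.1, hy.2.le⟩).2) x ⟨hx.1, le_rfl⟩
      -- The bootstrap: smallness of `-v₂` improves the bound `2N` to below `2N` and the radius `σ'`
      -- to `(σ + σ') / 2`.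
      have hxv : x - v₂ ≤ -v₂ := by linarith [hx.2, hV.2]
      have h3 : ‖j x - j v₂‖ ≤ N / 2 := h1.trans (le_trans (by gcongr) hs₁)
      have h4 : ‖Y (u, x, e) - Y (u, v₂, e)‖ ≤ (σ' - σ) / 2 := h2.trans (le_trans (by gcongr) hs₂)
      have h5 : ‖j x‖ < 2 * N := by
        have := norm_le_norm_add_norm_sub' (j x) (j v₂)
        have : ‖j v₂‖ ≤ N := hj
        linarith
      have h6 : (u, x, e) ∈ chartRegion Y O τ y₀ ((σ + σ') / 2) := by
        have hxS := (hIcc ⟨hx.1, le_rfl⟩).1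
        refine ⟨hxS.1, ?_, hxS.2.2⟩
        rw [mem_closedBall_iff_norm]
        have h7 := mem_closedBall_iff_norm.1 hstart.2.1
        have : Y (u, x, e) - y₀ = (Y (u, x, e) - Y (u, v₂, e)) + (Y (u, v₂, e) - y₀) := by abel
        rw [this]
        exact (norm_add_le _ _).trans (by linarith)
      have h7 := hpt.continuousAt.eventually (h.eventually_mem_chartRegion
        (show (σ + σ') / 2 < σ' by linarith) h6)
      have h8 := (hjc x (hIcc ⟨hx.1, le_rfl⟩).1).norm.eventually (gt_mem_nhds h5)
      filter_upwards [nhdsWithin_le_nhds h7, nhdsWithin_le_nhds h8] with y hy1 hy2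
      exact ⟨hy1, hy2.le⟩
  have hVS := key ⟨hV.1, le_rfl⟩
  exact ⟨hVS.1, hVS.2, hDv V hV hVS.2⟩

end BoundaryChart

/-! ### Great circles -/

section Arc

variable {e f : EuclideanSpace ℝ (Fin 3)}

/-- The great circle through `e` with initial velocity `f`. -/
def greatCircle (e f : EuclideanSpace ℝ (Fin 3)) (α : ℝ) : EuclideanSpace ℝ (Fin 3) :=
  Real.cos α • e + Real.sin α • f

/-- The velocity of the great circle through `e` with initial velocity `f`. -/
def greatCircleDeriv (e f : EuclideanSpace ℝ (Fin 3)) (α : ℝ) : EuclideanSpace ℝ (Fin 3) :=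
  -Real.sin α • e + Real.cos α • f

theorem hasDerivAt_greatCircle (α : ℝ) :
    HasDerivAt (greatCircle e f) (greatCircleDeriv e f α) α :=
  ((Real.hasDerivAt_cos α).smul_const e).add ((Real.hasDerivAt_sin α).smul_const f)

theorem hasDerivAt_greatCircleDeriv (α : ℝ) :
    HasDerivAt (greatCircleDeriv e f) (-greatCircle e f α) α := by
  convert! ((Real.hasDerivAt_sin α).neg.smul_const e).add
    ((Real.hasDerivAt_cos α).smul_const f) using 1
  simp [greatCircle, add_comm]

theorem norm_greatCircle (he : ‖e‖ = 1) (hf : ‖f‖ = 1) (hef : inner ℝ e f = (0 : ℝ)) (α : ℝ) :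
    ‖greatCircle e f α‖ = 1 := by
  rw [← sq_eq_sq₀ (norm_nonneg _) zero_le_one, ← real_inner_self_eq_norm_sq]
  simp only [greatCircle, inner_add_left, inner_add_right, inner_smul_left, inner_smul_right, hef,
    real_inner_comm e f, real_inner_self_eq_norm_sq, he, hf]
  simp
  nlinarith [Real.sin_sq_add_cos_sq α]

theorem norm_greatCircleDeriv (he : ‖e‖ = 1) (hf : ‖f‖ = 1) (hef : inner ℝ e f = (0 : ℝ)) (α : ℝ) :
    ‖greatCircleDeriv e f α‖ = 1 := by
  rw [← sq_eq_sq₀ (norm_nonneg _) zero_le_one, ← real_inner_self_eq_norm_sq]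
  simp only [greatCircleDeriv, inner_add_left, inner_add_right, inner_smul_left, inner_smul_right,
    hef, real_inner_comm e f, real_inner_self_eq_norm_sq, he, hf]
  simp
  nlinarith [Real.sin_sq_add_cos_sq α]

theorem inner_greatCircle_greatCircleDeriv (he : ‖e‖ = 1) (hf : ‖f‖ = 1)
    (hef : inner ℝ e f = (0 : ℝ)) (α : ℝ) :
    inner ℝ (greatCircle e f α) (greatCircleDeriv e f α) = (0 : ℝ) := by
  simp only [greatCircle, greatCircleDeriv, inner_add_left, inner_add_right, inner_smul_left,
    inner_smul_right, hef, real_inner_comm e f, real_inner_self_eq_norm_sq, he, hf]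
  simp
  ring

end Arc

/-! ### Bending of the symmetry spheres and the contradiction on a null line -/

namespace BoundaryChart

variable {E : Type*} [NormedAddCommGroup E] [NormedSpace ℝ E] {Q R : ℝ → ℝ → ℝ}
    {Y : ConeSpace → E} {O : Set ConeSpace} {G : E → E →L[ℝ] E →L[ℝ] ℝ} {τ : E →L[ℝ] ℝ} {y₀ : E}
    {ρ Λ C : ℝ}

/-- Grönwall applies to the rescaled vector; `(√m)⁻¹` and `√M` pay for passing to the rescaled
vector and back. -/
theorem norm_sphere_frame_le (h : BoundaryChart Q R Y O G τ y₀ ρ Λ C)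
    (hQ : IsBoundedCoefficient Q) (hR : IsBoundedCoefficient R) {u v₂ σ D A m M : ℝ} (hσ : σ < ρ)
    {e a : EuclideanSpace ℝ (Fin 3)} (he : ‖e‖ = 1) (ha : inner ℝ e a = (0 : ℝ)) (hm : 0 < m)
    (hM : ∀ v ∈ Ico v₂ 0, m ≤ R u v ∧ R u v ≤ M)
    (hline : ∀ v ∈ Ico v₂ 0, (u, v, e) ∈ chartRegion Y O τ y₀ σ ∧
      ‖fderiv ℝ Y (u, v, e) (0, 1, 0)‖ ≤ D)
    (hA : ‖fderiv ℝ Y (u, v₂, e) (0, 0, a)‖ ≤ A) :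
    ∀ v ∈ Ico v₂ 0, ‖fderiv ℝ Y (u, v, e) (0, 0, a)‖
      ≤ √M * ((√m)⁻¹ * A * Real.exp (2 * C * Λ * D * (-v₂))) := by
  intro v hv
  have hC := h.C_pos
  have hΛ := h.Lip_nonneg
  have hv2 : v₂ ∈ Ico v₂ 0 := ⟨le_rfl, hv.1.trans_lt hv.2⟩
  have hD0 : 0 ≤ D := (norm_nonneg _).trans (hline v₂ hv2).2
  have hA0 : 0 ≤ A := (norm_nonneg _).trans hA
  have hneg : ∀ y ∈ Icc v₂ v, y ∈ Ico v₂ 0 := fun y hy => ⟨hy.1, hy.2.trans_lt hv.2⟩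
  choose! j' hj' using fun y (hy : y ∈ Icc v₂ v) =>
    h.hasDerivAt_sphere_frame hQ hR hσ he ha (hline y (hneg y hy)).1
  have hsm : 0 < √m := Real.sqrt_pos.2 hm
  have h1 := norm_le_gronwallBound_of_norm_deriv_right_le
    (f := fun v => (√(R u v))⁻¹ • fderiv ℝ Y (u, v, e) (0, 0, a)) (f' := j')
    (δ := (√m)⁻¹ * A) (K := 2 * C * Λ * D) (ε := 0)
    (fun y hy => (hj' y hy).1.continuousAt.continuousWithinAt)
    (fun y hy => (hj' y ⟨hy.1, hy.2.le⟩).1.hasDerivWithinAt)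
    (by
      have hs : √m ≤ √(R u v₂) := Real.sqrt_le_sqrt (hM v₂ hv2).1
      rw [norm_smul, Real.norm_of_nonneg (by positivity)]
      gcongr)
    (fun y hy => by
      have hy' : y ∈ Icc v₂ v := ⟨hy.1, hy.2.le⟩
      have := (hline y (hneg y hy')).2
      rw [add_zero]
      refine (hj' y hy').2.trans ?_
      gcongr) v ⟨hv.1, le_rfl⟩
  rw [gronwallBound_ε0] at h1
  have hRm := hM v hv
  have hsR : 0 < √(R u v) := Real.sqrt_pos.2 (hm.trans_le hRm.1)
  have h2 : fderiv ℝ Y (u, v, e) (0, 0, a) =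
      √(R u v) • ((√(R u v))⁻¹ • fderiv ℝ Y (u, v, e) (0, 0, a)) := by
    rw [smul_smul, mul_inv_cancel₀ hsR.ne', one_smul]
  rw [h2, norm_smul, Real.norm_of_nonneg hsR.le]
  have h3 : v - v₂ ≤ -v₂ := by linarith [hv.2]
  have h4 : √(R u v) ≤ √M := Real.sqrt_le_sqrt hRm.2
  refine mul_le_mul h4 (h1.trans ?_) (norm_nonneg _) (Real.sqrt_nonneg _)
  gcongr

/-- The expansion of the spheres tends to `-∞` in the time direction of the chart. -/
theorem apply_fderiv_fderiv_sphere_le (h : BoundaryChart Q R Y O G τ y₀ ρ Λ C)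
    (hQ : IsBoundedCoefficient Q) (hR : IsBoundedCoefficient R) {u v σ D A B m M : ℝ} (hσ : σ < ρ)
    {e a : EuclideanSpace ℝ (Fin 3)} (he : ‖e‖ = 1) (ha : inner ℝ e a = (0 : ℝ)) (ha1 : ‖a‖ = 1)
    (hx : (u, v, e) ∈ chartRegion Y O τ y₀ σ) (hm : 0 < m) (hmQ : m ≤ Q u v) (hQM : Q u v ≤ M)
    (hD : ‖fderiv ℝ Y (u, v, e) (0, 1, 0)‖ ≤ D) (hD0 : 0 < D)
    (hA : ‖fderiv ℝ Y (u, v, e) (0, 0, a)‖ ≤ A) (hB : 0 ≤ B)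
    (hRv : fderiv ℝ (fun x : ℝ × ℝ => R x.1 x.2) (u, v) (0, 1) ≤ -B)
    (hRu : fderiv ℝ (fun x : ℝ × ℝ => R x.1 x.2) (u, v) (1, 0) ≤ 0) :
    τ (fderiv ℝ (fderiv ℝ Y) (u, v, e) (0, 0, a) (0, 0, a)) ≤
      ‖τ‖ * (2 * C * Λ * A * A) - B / M * (m / (2 * C * D) / C) := by
  have hC := h.C_pos
  have hΛ := h.Lip_nonneg
  have hQpos : 0 < Q u v := hm.trans_le hmQ
  have hg := h.gauss_aa hQ hR hx.1 (Metric.closedBall_subset_ball hσ hx.2.1) he ha ha1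
  simp only at hg
  set Rv := fderiv ℝ (fun x : ℝ × ℝ => R x.1 x.2) (u, v) (0, 1)
  set Ru := fderiv ℝ (fun x : ℝ × ℝ => R x.1 x.2) (u, v) (1, 0)
  set W := fderiv ℝ (fderiv ℝ Y) (u, v, e) (0, 0, a) (0, 0, a)
  set c := (Rv / Q u v) • fderiv ℝ Y (u, v, e) (1, 0, 0) +
    (Ru / Q u v) • fderiv ℝ Y (u, v, e) (0, 1, 0) with hc
  have h1 : τ W ≤ τ c + ‖τ‖ * (2 * C * Λ * A * A) := by
    have : τ W = τ c + τ (W - c) := by rw [← map_add]; congr 1; abel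
    rw [this]
    have h2 : τ (W - c) ≤ ‖τ‖ * ‖W - c‖ := (le_abs_self _).trans (τ.le_opNorm _)
    have h3 : ‖W - c‖ ≤ 2 * C * Λ * A * A := by
      refine hg.trans ?_
      have hA0 : 0 ≤ A := (norm_nonneg _).trans hA
      gcongr
    have : ‖τ‖ * ‖W - c‖ ≤ ‖τ‖ * (2 * C * Λ * A * A) := by gcongr
    linarith
  have hv0 : 0 ≤ τ (fderiv ℝ Y (u, v, e) (0, 1, 0)) := by
    have := (norm_nonneg _).trans (h.norm_fderiv_v_le hQ hσ.le hx)
    exact nonneg_of_mul_nonneg_right this hC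
  -- As `|G(∂_u Y, ∂_v Y)| = Q/2` while `∂_v Y` is bounded by `D`, the vector `∂_u Y` cannot be
  -- short; being future causal, it then has a definite time component.
  have hu0 : m / (2 * C * D) / C ≤ τ (fderiv ℝ Y (u, v, e) (1, 0, 0)) := by
    have h4 := h.norm_fderiv_u_le hQ hσ.le hx
    have h5 := h.isometric _ hx.1 (1, 0, 0) (0, 1, 0)
    have h6 := (G (Y (u, v, e))).le_opNorm₂ (fderiv ℝ Y (u, v, e) (1, 0, 0))
      (fderiv ℝ Y (u, v, e) (0, 1, 0))
    rw [h5] at h6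
    have h7 := h.bounded _ (Metric.closedBall_subset_closedBall hσ.le hx.2.1)
    have h8 : ‖coneMetric Q R (u, v, e) (1, 0, 0) (0, 1, 0)‖ = Q u v / 2 := by
      simp [coneMetric, coneRound, hQpos.le]
    rw [h8] at h6
    have h9 : m / 2 ≤ C * ‖fderiv ℝ Y (u, v, e) (1, 0, 0)‖ * D := by
      refine le_trans (by linarith) (h6.trans ?_)
      gcongr
    rw [div_div, div_le_iff₀ (by positivity)]
    have : C * ‖fderiv ℝ Y (u, v, e) (1, 0, 0)‖ * D
      ≤ C * (C * τ (fderiv ℝ Y (u, v, e) (1, 0, 0))) * D := by gcongr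
    nlinarith
  have h10 : τ c ≤ - (B / M * (m / (2 * C * D) / C)) := by
    rw [hc, map_add, map_smul, map_smul, smul_eq_mul, smul_eq_mul]
    -- The sign of `∂_u R` ensures that the `∂_v` term cannot offset the divergent one.
    have h11 : Ru / Q u v * τ (fderiv ℝ Y (u, v, e) (0, 1, 0)) ≤ 0 :=
      mul_nonpos_of_nonpos_of_nonneg (div_nonpos_of_nonpos_of_nonneg hRu hQpos.le) hv0
    have h12 : B / M ≤ -(Rv / Q u v) := by
      rw [← neg_div]
      exact div_le_div₀ (by linarith) (by linarith) hQpos hQM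
    have h13 : B / M * (m / (2 * C * D) / C)
        ≤ -(Rv / Q u v) * τ (fderiv ℝ Y (u, v, e) (1, 0, 0)) := by
      have : 0 ≤ B / M := div_nonneg hB (hQpos.le.trans hQM)
      have : 0 ≤ m / (2 * C * D) / C := by positivity
      gcongr
      linarith
    linarith
  linarith

/-- No null line towards a point where the expansion of the spheres blows up can stay inside a
chart in which the metric is Lipschitz. -/
theorem false_of_line (h : BoundaryChart Q R Y O G τ y₀ ρ Λ C)
    (hQ : IsBoundedCoefficient Q) (hR : IsBoundedCoefficient R) {u v₁ σ : ℝ} (hσ : σ < ρ)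
    {e : EuclideanSpace ℝ (Fin 3)} (he : ‖e‖ = 1) (hu : u < 0) (hv₁ : v₁ < 0)
    (hline : ∀ v ∈ Ico v₁ 0, (u, v, e) ∈ chartRegion Y O τ y₀ σ)
    (hRv : Tendsto (fun v => fderiv ℝ (fun x : ℝ × ℝ => R x.1 x.2) (u, v) (0, 1)) (𝓝[<] 0) atBot)
    (hRu : ∀ᶠ v in 𝓝[<] 0, fderiv ℝ (fun x : ℝ × ℝ => R x.1 x.2) (u, v) (1, 0) ≤ 0) : False := by
  have hC := h.C_pos
  have hΛ := h.Lip_nonneg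
  obtain ⟨N₀, hN₀⟩ := h.exists_norm_null_frame_le hQ hR hσ he hline
  have hN₀0 : 0 ≤ N₀ := (norm_nonneg _).trans (hN₀ v₁ ⟨le_rfl, hv₁⟩)
  -- The extra `1` leaves room for the bound to persist on neighbouring lines.
  set N := N₀ + 1 with hNdef
  have hN : 0 < N := by positivity
  have hmin : min u v₁ < 0 := min_lt_of_left_lt hu
  obtain ⟨mQ, hmQ, MQ, hQb⟩ := hQ.bounds (min u v₁) hmin
  obtain ⟨mR, hmR, MR, hRb⟩ := hR.bounds (min u v₁) hmin
  have huI : u ∈ Ico (min u v₁) 0 := ⟨min_le_left _ _, hu⟩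
  have hQb' : ∀ v ∈ Ico v₁ 0, mQ ≤ Q u v ∧ Q u v ≤ MQ := fun v hv =>
    hQb u huI v ⟨(min_le_right _ _).trans hv.1, hv.2⟩
  have hRb' : ∀ v ∈ Ico v₁ 0, mR ≤ R u v ∧ R u v ≤ MR := fun v hv =>
    hRb u huI v ⟨(min_le_right _ _).trans hv.1, hv.2⟩
  have hMQ : 0 < MQ := hmQ.trans_le ((hQb' v₁ ⟨le_rfl, hv₁⟩).1.trans (hQb' v₁ ⟨le_rfl, hv₁⟩).2)
  obtain ⟨σ₁, hσ₁, hσ₁'⟩ := exists_between hσ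
  obtain ⟨σ₂, hσ₂, hσ₂'⟩ := exists_between hσ₁'
  -- So close to `v = 0`, lines starting near `(u, v₂, e)` have too little parameter left to leave
  -- the chart.
  obtain ⟨v₂, hv₂, hs₁, hs₂⟩ : ∃ v₂ ∈ Ico v₁ 0,
      2 * C * Λ * (MQ * (2 * N)) * (2 * N) * (-v₂) ≤ N / 2 ∧
      MQ * (2 * N) * (-v₂) ≤ (σ₂ - σ₁) / 2 := by
    have t1 : Tendsto (fun v : ℝ => 2 * C * Λ * (MQ * (2 * N)) * (2 * N) * (-v)) (𝓝[<] 0)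
        (𝓝 0) := by
      have : Continuous (fun v : ℝ => 2 * C * Λ * (MQ * (2 * N)) * (2 * N) * (-v)) := by fun_prop
      simpa using (this.tendsto 0).mono_left nhdsWithin_le_nhds
    have t2 : Tendsto (fun v : ℝ => MQ * (2 * N) * (-v)) (𝓝[<] 0) (𝓝 0) := by
      have : Continuous (fun v : ℝ => MQ * (2 * N) * (-v)) := by fun_prop
      simpa using (this.tendsto 0).mono_left nhdsWithin_le_nhds
    have := ((t1.eventually (ge_mem_nhds (show (0 : ℝ) < N / 2 by positivity))).and
      (t2.eventually (ge_mem_nhds (show (0 : ℝ) < (σ₂ - σ₁) / 2 by linarith)))).and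
      (Ico_mem_nhdsLT hv₁)
    obtain ⟨v, hv⟩ := this.exists
    exact ⟨v, hv.2, hv.1.1, hv.1.2⟩
  have hsub : ∀ v ∈ Ico v₂ 0, v ∈ Ico v₁ 0 := fun v hv => ⟨hv₂.1.trans hv.1, hv.2⟩
  obtain ⟨f, hf, hef⟩ := exists_unit_orthogonal e
  have hx₂ := hline v₂ hv₂
  set p : ℝ → ConeSpace := fun α => (u, v₂, greatCircle e f α) with hp
  have hp0 : p 0 = (u, v₂, e) := by simp [hp, greatCircle]
  have hpc : ContinuousAt p 0 :=
    continuousAt_const.prodMk (continuousAt_const.prodMk (hasDerivAt_greatCircle 0).continuousAt)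
  have hfc : ContinuousAt (fderiv ℝ Y) (p 0) := by rw [hp0]; exact h.continuousAt_fderiv hx₂.1
  have hev1 : ∀ᶠ α in 𝓝 0, p α ∈ chartRegion Y O τ y₀ σ₁ :=
    hpc.eventually (by rw [hp0]; exact h.eventually_mem_chartRegion hσ₁ hx₂)
  have hev2 : ∀ᶠ α in 𝓝 0, ‖(Q u v₂)⁻¹ • fderiv ℝ Y (p α) (0, 1, 0)‖ < N := by
    have : ContinuousAt (fun α => ‖(Q u v₂)⁻¹ • fderiv ℝ Y (p α) (0, 1, 0)‖) 0 :=
      (((hfc.comp hpc).clm_apply continuousAt_const).const_smul _).norm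
    refine this.eventually (gt_mem_nhds ?_)
    simp only [hp0]
    exact (hN₀ v₂ hv₂).trans_lt (by rw [hNdef]; linarith)
  set A₀ := ‖fderiv ℝ Y (p 0) (0, 0, greatCircleDeriv e f 0)‖ + 1
  have hev3 : ∀ᶠ α in 𝓝 0, ‖fderiv ℝ Y (p α) (0, 0, greatCircleDeriv e f α)‖ < A₀ := by
    have : ContinuousAt (fun α => ‖fderiv ℝ Y (p α) (0, 0, greatCircleDeriv e f α)‖) 0 :=
      ((hfc.comp hpc).clm_apply (continuousAt_const.prodMk
        (continuousAt_const.prodMk (hasDerivAt_greatCircleDeriv 0).continuousAt))).norm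
    exact this.eventually (gt_mem_nhds (lt_add_one _))
  obtain ⟨δ', hδ', hball⟩ := Metric.eventually_nhds_iff.1 (hev1.and (hev2.and hev3))
  set δ := δ' / 2 with hδ
  have hδ0 : 0 < δ := by positivity
  set D := MQ * (2 * N) with hD
  have hD0 : 0 < D := by positivity
  set A := √MR * ((√mR)⁻¹ * A₀ * Real.exp (2 * C * Λ * D * (-v₂))) with hA
  have hstrip : ∀ α ∈ Icc 0 δ, ∀ v ∈ Ico v₂ 0,
      (u, v, greatCircle e f α) ∈ chartRegion Y O τ y₀ σ₂ ∧
      ‖fderiv ℝ Y (u, v, greatCircle e f α) (0, 1, 0)‖ ≤ D ∧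
      ‖fderiv ℝ Y (u, v, greatCircle e f α) (0, 0, greatCircleDeriv e f α)‖ ≤ A := by
    intro α hα v hv
    obtain ⟨b1, b2, b3⟩ := hball (y := α) (by
      rw [Real.dist_eq, sub_zero, abs_of_nonneg hα.1]; linarith [hα.2])
    have hn := norm_greatCircle he hf hef α
    have hl := h.mem_chartRegion_of_norm_null_frame_le hQ hR hσ₂ hσ₂' hn hu hN
      (fun v hv => (hQb' v (hsub v hv)).2) b1 b2.le hs₁ hs₂
    refine ⟨(hl v hv).1, (hl v hv).2.2, ?_⟩
    exact h.norm_sphere_frame_le hQ hR hσ₂' hn (inner_greatCircle_greatCircleDeriv he hf hef α) hmR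
      (fun v hv => hRb' v (hsub v hv)) (fun v hv => ⟨(hl v hv).1, (hl v hv).2.2⟩) b3.le v hv
  have hA0 : 0 ≤ A := (norm_nonneg _).trans (hstrip 0 ⟨le_rfl, hδ0.le⟩ v₂ ⟨le_rfl, hv₂.2⟩).2.2
  set c₀ := mQ / (2 * C * D) / C with hc₀
  have hc₀0 : 0 < c₀ := by positivity
  -- A slope of at most `-L` over the arc `[0, δ]` forces a drop of at least `2‖τ‖A + 1`, more than
  -- a function bounded by `‖τ‖A` can have. `B` is the size of `-∂_v R` that yields this slope.
  set L := (2 * (‖τ‖ * A) + 1) / δ with hL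
  set B := MQ * (‖τ‖ * (2 * C * Λ * A * A) + L) / c₀ with hB
  have hB0 : 0 ≤ B := by positivity
  have hBL : ‖τ‖ * (2 * C * Λ * A * A) - B / MQ * c₀ = -L := by
    rw [hB]; field_simp; ring
  obtain ⟨v, ⟨hRvB, hRu0⟩, hv⟩ :=
    (((hRv.eventually (eventually_le_atBot (-B))).and hRu).and (Ico_mem_nhdsLT hv₂.2)).exists
  set q : ℝ → ℝ := fun α =>
    τ (fderiv ℝ Y (u, v, greatCircle e f α) (0, 0, greatCircleDeriv e f α)) with hq
  have hqd : ∀ α ∈ Icc 0 δ, HasDerivAt q (τ (fderiv ℝ (fderiv ℝ Y) (u, v, greatCircle e f α)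
      (0, 0, greatCircleDeriv e f α) (0, 0, greatCircleDeriv e f α))) α := by
    intro α hα
    have hmem := (hstrip α hα v hv).1
    have d1 : HasDerivAt (fun α => ((u, v, greatCircle e f α) : ConeSpace))
        (0, 0, greatCircleDeriv e f α) α :=
      (hasDerivAt_const α u).prodMk ((hasDerivAt_const α v).prodMk (hasDerivAt_greatCircle α))
    have d2 : HasDerivAt (fun α => ((0, 0, greatCircleDeriv e f α) : ConeSpace))
        (0, 0, -greatCircle e f α) α :=
      (hasDerivAt_const α (0 : ℝ)).prodMk
        ((hasDerivAt_const α (0 : ℝ)).prodMk (hasDerivAt_greatCircleDeriv α))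
    have d3 : HasDerivAt (fun α => fderiv ℝ Y (u, v, greatCircle e f α))
        (fderiv ℝ (fderiv ℝ Y) (u, v, greatCircle e f α) (0, 0, greatCircleDeriv e f α)) α :=
      (h.hasFDerivAt_fderiv hmem.1).comp_hasDerivAt α d1
    -- The acceleration of a great circle is radial, hence annihilated by the derivative of `Y`.
    have hrad := h.fderiv_radial hQ hR hmem.1
      (Metric.closedBall_subset_closedBall hσ₂'.le hmem.2.1) (norm_greatCircle he hf hef α)
    have hneg : ((0, 0, -greatCircle e f α) : ConeSpace) = -(0, 0, greatCircle e f α) := by simp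
    have d4 := τ.hasFDerivAt.comp_hasDerivAt α (d3.clm_apply d2)
    rw [hneg, map_neg] at d4
    simp only at hrad
    rw [hrad, neg_zero, add_zero] at d4
    exact d4
  obtain ⟨α, hα, hslope⟩ := exists_hasDerivAt_eq_slope q _ hδ0
    (fun α hα => (hqd α hα).continuousAt.continuousWithinAt)
    (fun α hα => hqd α ⟨hα.1.le, hα.2.le⟩)
  have hα' : α ∈ Icc 0 δ := ⟨hα.1.le, hα.2.le⟩
  obtain ⟨s1, s2, s3⟩ := hstrip α hα' v hv
  have hfin := h.apply_fderiv_fderiv_sphere_le hQ hR hσ₂' (norm_greatCircle he hf hef α)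
    (inner_greatCircle_greatCircleDeriv he hf hef α) (norm_greatCircleDeriv he hf hef α) s1 hmQ
    (hQb' v (hsub v hv)).1 (hQb' v (hsub v hv)).2 s2 hD0 s3 hB0 hRvB hRu0
  rw [hBL, hslope, sub_zero, div_le_iff₀ hδ0, hL, neg_mul, div_mul_cancel₀ _ hδ0.ne'] at hfin
  have hqA : ∀ α ∈ Icc 0 δ, |q α| ≤ ‖τ‖ * A := fun α hα =>
    (τ.le_opNorm _).trans (by gcongr; exact (hstrip α hα v hv).2.2)
  have q0 := abs_le.1 (hqA 0 ⟨le_rfl, hδ0.le⟩)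
  have q1 := abs_le.1 (hqA δ ⟨hδ0.le, le_rfl⟩)
  linarith [q0.1, q0.2, q1.1, q1.2]

end BoundaryChart

/-! ### Calculus with right derivatives -/

section RightDerivative

variable {E : Type*} [NormedAddCommGroup E] [NormedSpace ℝ E]

theorem norm_sub_le_of_norm_deriv_right_le {f f' : ℝ → E} {B B' : ℝ → ℝ} {a b : ℝ}
    (hf : ContinuousOn f (Icc a b)) (hf' : ∀ x ∈ Ico a b, HasDerivWithinAt f (f' x) (Ici x) x)
    (hB : ContinuousOn B (Icc a b)) (hB' : ∀ x ∈ Ico a b, HasDerivWithinAt B (B' x) (Ici x) x)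
    (bound : ∀ x ∈ Ico a b, ‖f' x‖ ≤ B' x) {x : ℝ} (hx : x ∈ Icc a b) :
    ‖f x - f a‖ ≤ B x - B a :=
  image_norm_le_of_norm_deriv_right_le_deriv_boundary' (f := fun x => f x - f a)
    (B := fun x => B x - B a) (hf.sub continuousOn_const) (fun x hx => (hf' x hx).sub_const _)
    (by simp) (hB.sub continuousOn_const) (fun x hx => (hB' x hx).sub_const _) bound hx

/-- A curve whose velocities lie in a cone around `τ` has increments in that cone. -/
theorem norm_sub_le_of_deriv_right_mem_cone {f f' : ℝ → E} {τ : E →L[ℝ] ℝ} {C a b : ℝ}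
    (hf : ContinuousOn f (Icc a b)) (hf' : ∀ x ∈ Ico a b, HasDerivWithinAt f (f' x) (Ici x) x)
    (bound : ∀ x ∈ Ico a b, ‖f' x‖ ≤ C * τ (f' x)) {x : ℝ} (hx : x ∈ Icc a b) :
    ‖f x - f a‖ ≤ C * (τ (f x) - τ (f a)) := by
  rw [mul_sub]
  exact norm_sub_le_of_norm_deriv_right_le hf hf'
    (B := fun x => C * τ (f x)) (continuousOn_const.mul (τ.continuous.comp_continuousOn hf))
    (fun x hx => (τ.hasFDerivAt.comp_hasDerivWithinAt x (hf' x hx)).const_mul C) bound hx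

theorem sub_nonneg_of_deriv_right_nonneg {f f' : ℝ → ℝ} {a b : ℝ}
    (hf : ContinuousOn f (Icc a b)) (hf' : ∀ x ∈ Ico a b, HasDerivWithinAt f (f' x) (Ici x) x)
    (bound : ∀ x ∈ Ico a b, 0 ≤ f' x) (hab : a ≤ b) : f a ≤ f b := by
  have := norm_sub_le_of_norm_deriv_right_le (f := fun _ => (0 : ℝ)) (f' := fun _ => 0)
    continuousOn_const (fun x _ => hasDerivWithinAt_const _ _ _) hf hf' (by simpa using bound)
    (right_mem_Icc.2 hab)
  simpa using this

/-- Equality at two points would make the monotone function constant between them, contradicting the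
positive right derivative at the left end. -/
theorem strictMonoOn_of_deriv_right_pos {f f' : ℝ → ℝ} {a b : ℝ}
    (hf : ContinuousOn f (Ico a b)) (hf' : ∀ x ∈ Ico a b, HasDerivWithinAt f (f' x) (Ici x) x)
    (hpos : ∀ x ∈ Ico a b, 0 < f' x) : StrictMonoOn f (Ico a b) := by
  have hmono : ∀ s ∈ Ico a b, ∀ t ∈ Ico a b, s ≤ t → f s ≤ f t := fun s hs t ht hst =>
    sub_nonneg_of_deriv_right_nonneg
      (hf.mono fun x hx => ⟨hs.1.trans hx.1, hx.2.trans_lt ht.2⟩)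
      (fun x hx => hf' x ⟨hs.1.trans hx.1, hx.2.trans ht.2⟩)
      (fun x hx => (hpos x ⟨hs.1.trans hx.1, hx.2.trans ht.2⟩).le) hst
  intro s hs t ht hst
  refine lt_of_le_of_ne (hmono s hs t ht hst.le) fun heq => ?_
  have hconst : ∀ x ∈ Icc s t, f x = f s := fun x hx =>
    le_antisymm ((hmono x ⟨hs.1.trans hx.1, hx.2.trans_lt ht.2⟩ t ht hx.2).trans heq.ge)
      (hmono s hs x ⟨hs.1.trans hx.1, hx.2.trans_lt ht.2⟩ hx.1)
  have h1 : HasDerivWithinAt f 0 (Icc s t) s :=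
    (hasDerivWithinAt_const s _ (f s)).congr (fun x hx => hconst x hx) rfl
  have h2 : HasDerivWithinAt f (f' s) (Icc s t) s := (hf' s hs).mono Icc_subset_Ici_self
  have h3 := (uniqueDiffOn_Icc hst s ⟨le_rfl, hst.le⟩).eq_deriv _ h1 h2
  exact (hpos s hs).ne h3

/-- The right derivative of `k`, where `F ∘ k = l` and `F` is increasing. -/
theorem hasDerivWithinAt_of_comp_eq {F l k : ℝ → ℝ} {t f l' : ℝ}
    (hF : HasDerivWithinAt F f (Ici (k t)) (k t)) (hf : f ≠ 0)
    (hk : Tendsto k (𝓝[>] t) (𝓝[≥] (k t))) (hcomp : ∀ᶠ x in 𝓝[>] t, F (k x) = l x)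
    (ht : F (k t) = l t) (hl : HasDerivWithinAt l l' (Ici t) t) :
    HasDerivWithinAt k (l' / f) (Ici t) t := by
  classical
  -- The difference quotient of `F`, filled in by `f` at `k t`: the curve `k` may stand still, and
  -- then the plain quotient would be meaningless.
  set S : ℝ → ℝ := fun y => if y = k t then f else slope F (k t) y with hS
  have hmul : ∀ y, F y - F (k t) = S y * (y - k t) := by
    intro y
    by_cases hy : y = k t
    · simp [hy]
    · simp only [hS, hy, if_false, slope_def_field]
      rw [div_mul_cancel₀ _ (sub_ne_zero.2 hy)]
  have hSt : Tendsto S (𝓝[≥] (k t)) (𝓝 f) := by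
    rw [← Ioi_insert, nhdsWithin_insert, tendsto_sup]
    constructor
    · rw [tendsto_pure_left]
      intro s hs
      simpa [hS] using mem_of_mem_nhds hs
    · have h1 := (hasDerivWithinAt_iff_tendsto_slope' (by simp)).1 (hasDerivWithinAt_Ioi_iff_Ici.2 hF)
      refine h1.congr' ?_
      filter_upwards [self_mem_nhdsWithin] with y hy
      have : y ≠ k t := (show k t < y from hy).ne'
      simp [hS, this]
  rw [← hasDerivWithinAt_Ioi_iff_Ici, hasDerivWithinAt_iff_tendsto_slope' (by simp)]
  have h2 := (hasDerivWithinAt_iff_tendsto_slope' (by simp)).1 (hasDerivWithinAt_Ioi_iff_Ici.2 hl)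
  refine (h2.div (hSt.comp hk) hf).congr' ?_
  filter_upwards [hcomp, (hSt.comp hk).eventually_ne hf] with x hx hne
  have h3 := hmul (k x)
  rw [hx, ht] at h3
  simp only [Function.comp_apply] at hne ⊢
  simp only [slope_def_field, Pi.div_apply, Function.comp_apply]
  rw [h3]
  field_simp

/-- Continuity of the inverse of a strictly increasing function; continuity of `F` plays no role. -/
theorem tendsto_of_strictMonoOn {α : Type*} {F : ℝ → ℝ} {a T κ : ℝ} {k : α → ℝ} {l : Filter α}
    (hF : StrictMonoOn F (Icc a T)) (hκ : κ ∈ Icc a T) (hk : ∀ᶠ x in l, k x ∈ Icc a T)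
    (h : Tendsto (fun x => F (k x)) l (𝓝 (F κ))) : Tendsto k l (𝓝 κ) := by
  rw [tendsto_order]
  constructor
  · intro c hc
    rcases lt_or_ge c a with hca | hca
    · filter_upwards [hk] with x hx using hca.trans_le hx.1
    · have hcI : c ∈ Icc a T := ⟨hca, hc.le.trans hκ.2⟩
      filter_upwards [hk, h.eventually (lt_mem_nhds (hF hcI hκ hc))] with x hx hx2
      exact (hF.lt_iff_lt hcI hx).1 hx2
  · intro c hc
    rcases lt_or_ge T c with hca | hca
    · filter_upwards [hk] with x hx using hx.2.trans_lt hca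
    · have hcI : c ∈ Icc a T := ⟨hκ.1.trans hc.le, hca⟩
      filter_upwards [hk, h.eventually (gt_mem_nhds (hF hκ hcI hc))] with x hx hx2
      exact (hF.lt_iff_lt hx hcI).1 hx2

theorem exists_tendsto_of_monotoneOn {f : ℝ → ℝ} {a b B : ℝ} (hab : a < b) (hf : MonotoneOn f (Ico a b))
    (hB : ∀ t ∈ Ico a b, f t ≤ B) :
    ∃ c, Tendsto f (𝓝[<] b) (𝓝 c) ∧ ∀ t ∈ Ico a b, f t ≤ c := by
  have h1 := MonotoneOn.tendsto_nhdsWithin_Ioo_left (nonempty_Ioo.2 hab)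
    (hf.mono Ioo_subset_Ico_self)
    ⟨B, by rintro _ ⟨t, ht, rfl⟩; exact hB t (Ioo_subset_Ico_self ht)⟩
  refine ⟨_, h1, fun t ht => ?_⟩
  refine ge_of_tendsto h1 ?_
  filter_upwards [Ico_mem_nhdsLT ht.2] with x hx
  exact hf ht ⟨ht.1.trans hx.1, hx.2⟩ hx.1

end RightDerivative

/-! ### Timelike curves and their delayed companions -/

/-- A future directed timelike curve `(u, v, θ)` in the double null spacetime, with right
derivatives `u'`, `v'`, `θ'`, together with the length `l` of its projection to the sphere and the
maximal length `F` which is compatible with its projection to the `(u, v)` plane. -/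
structure IsConeCurve (Q R : ℝ → ℝ → ℝ) (u v u' v' F l : ℝ → ℝ)
    (θ θ' : ℝ → EuclideanSpace ℝ (Fin 3)) (a b : ℝ) : Prop where
  lt : a < b
  u_neg : ∀ t ∈ Ico a b, u t < 0
  v_neg : ∀ t ∈ Ico a b, v t < 0
  norm_eq : ∀ t ∈ Ico a b, ‖θ t‖ = 1
  u_cont : ContinuousOn u (Ico a b)
  v_cont : ContinuousOn v (Ico a b)
  θ_cont : ContinuousOn θ (Ico a b)
  F_cont : ContinuousOn F (Ico a b)
  l_cont : ContinuousOn l (Ico a b)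
  u_deriv : ∀ t ∈ Ico a b, HasDerivWithinAt u (u' t) (Ici t) t
  v_deriv : ∀ t ∈ Ico a b, HasDerivWithinAt v (v' t) (Ici t) t
  θ_deriv : ∀ t ∈ Ico a b, HasDerivWithinAt θ (θ' t) (Ici t) t
  F_deriv : ∀ t ∈ Ico a b,
    HasDerivWithinAt F (√(Q (u t) (v t) / R (u t) (v t) * (u' t * v' t))) (Ici t) t
  l_deriv : ∀ t ∈ Ico a b, HasDerivWithinAt l ‖θ' t‖ (Ici t) t
  u'_pos : ∀ t ∈ Ico a b, 0 < u' t
  v'_pos : ∀ t ∈ Ico a b, 0 < v' t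
  timelike : ∀ t ∈ Ico a b, R (u t) (v t) * ‖θ' t‖ ^ 2 < Q (u t) (v t) * (u' t * v' t)

namespace IsConeCurve

variable {Q R : ℝ → ℝ → ℝ} {u v u' v' F l : ℝ → ℝ} {θ θ' : ℝ → EuclideanSpace ℝ (Fin 3)} {a b : ℝ}

theorem mono_left (h : IsConeCurve Q R u v u' v' F l θ θ' a b) {s : ℝ} (hs : s ∈ Ico a b) :
    IsConeCurve Q R u v u' v' F l θ θ' s b := by
  have hsub : ∀ t ∈ Ico s b, t ∈ Ico a b := fun t ht => ⟨hs.1.trans ht.1, ht.2⟩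
  have hsub' : Ico s b ⊆ Ico a b := hsub
  exact ⟨hs.2, fun t ht => h.u_neg t (hsub t ht), fun t ht => h.v_neg t (hsub t ht),
    fun t ht => h.norm_eq t (hsub t ht), h.u_cont.mono hsub', h.v_cont.mono hsub',
    h.θ_cont.mono hsub', h.F_cont.mono hsub', h.l_cont.mono hsub',
    fun t ht => h.u_deriv t (hsub t ht), fun t ht => h.v_deriv t (hsub t ht),
    fun t ht => h.θ_deriv t (hsub t ht), fun t ht => h.F_deriv t (hsub t ht),
    fun t ht => h.l_deriv t (hsub t ht), fun t ht => h.u'_pos t (hsub t ht),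
    fun t ht => h.v'_pos t (hsub t ht), fun t ht => h.timelike t (hsub t ht)⟩

theorem u_strictMono (h : IsConeCurve Q R u v u' v' F l θ θ' a b) : StrictMonoOn u (Ico a b) :=
  strictMonoOn_of_deriv_right_pos h.u_cont h.u_deriv h.u'_pos

theorem v_strictMono (h : IsConeCurve Q R u v u' v' F l θ θ' a b) : StrictMonoOn v (Ico a b) :=
  strictMonoOn_of_deriv_right_pos h.v_cont h.v_deriv h.v'_pos

theorem norm_θ'_lt (h : IsConeCurve Q R u v u' v' F l θ θ' a b) (hR : IsBoundedCoefficient R)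
    {t : ℝ} (ht : t ∈ Ico a b) :
    ‖θ' t‖ < √(Q (u t) (v t) / R (u t) (v t) * (u' t * v' t)) := by
  have hRt := hR.pos (h.u_neg t ht) (h.v_neg t ht)
  refine Real.lt_sqrt_of_sq_lt ?_
  rw [div_mul_eq_mul_div, lt_div_iff₀ hRt]
  linarith [h.timelike t ht]

theorem F_strictMono (h : IsConeCurve Q R u v u' v' F l θ θ' a b) (hR : IsBoundedCoefficient R) :
    StrictMonoOn F (Ico a b) :=
  strictMonoOn_of_deriv_right_pos h.F_cont h.F_deriv fun _ ht =>
    (norm_nonneg _).trans_lt (h.norm_θ'_lt hR ht)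

/-- Strictness of the timelike condition: the available length outruns the length used. This surplus
is what makes a delay possible. -/
theorem F_sub_l_strictMono (h : IsConeCurve Q R u v u' v' F l θ θ' a b)
    (hR : IsBoundedCoefficient R) : StrictMonoOn (fun t => F t - l t) (Ico a b) :=
  strictMonoOn_of_deriv_right_pos (h.F_cont.sub h.l_cont)
    (fun t ht => (h.F_deriv t ht).sub (h.l_deriv t ht)) fun _ ht =>
    sub_pos.2 (h.norm_θ'_lt hR ht)

theorem norm_θ_sub_le (h : IsConeCurve Q R u v u' v' F l θ θ' a b) {s t : ℝ} (hs : a ≤ s)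
    (hst : s ≤ t) (ht : t < b) : ‖θ t - θ s‖ ≤ l t - l s := by
  have hsub : Icc s t ⊆ Ico a b := fun x hx => ⟨hs.trans hx.1, hx.2.trans_lt ht⟩
  exact norm_sub_le_of_norm_deriv_right_le (h.θ_cont.mono hsub)
    (fun x hx => h.θ_deriv x (hsub ⟨hx.1, hx.2.le⟩)) (h.l_cont.mono hsub)
    (fun x hx => h.l_deriv x (hsub ⟨hx.1, hx.2.le⟩)) (fun x _ => le_rfl) ⟨hst, le_rfl⟩

theorem l_monotone (h : IsConeCurve Q R u v u' v' F l θ θ' a b) : MonotoneOn l (Ico a b) := by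
  intro s hs t ht hst
  have := (norm_nonneg _).trans (h.norm_θ_sub_le hs.1 hst ht.2)
  linarith

/-- The elementary bound `u' v' ≤ (u' + v')²` bounds the integrand by a multiple of `u' + v'`, and
`u + v` stays below `0`. -/
theorem exists_F_le (h : IsConeCurve Q R u v u' v' F l θ θ' a b) (hQ : IsBoundedCoefficient Q)
    (hR : IsBoundedCoefficient R) : ∃ B, ∀ t ∈ Ico a b, F t ≤ B := by
  have ha : a ∈ Ico a b := ⟨le_rfl, h.lt⟩
  have hneg : min (u a) (v a) < 0 := min_lt_of_left_lt (h.u_neg a ha)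
  obtain ⟨mR, hmR, MR, hRb⟩ := hR.bounds _ hneg
  obtain ⟨mQ, hmQ, MQ, hQb⟩ := hQ.bounds _ hneg
  have huI : ∀ t ∈ Ico a b, u t ∈ Ico (min (u a) (v a)) 0 := fun t ht =>
    ⟨(min_le_left _ _).trans (h.u_strictMono.monotoneOn ha ht ht.1), h.u_neg t ht⟩
  have hvI : ∀ t ∈ Ico a b, v t ∈ Ico (min (u a) (v a)) 0 := fun t ht =>
    ⟨(min_le_right _ _).trans (h.v_strictMono.monotoneOn ha ht ht.1), h.v_neg t ht⟩
  set c := √(MQ / mR) with hc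
  refine ⟨F a + c * (-(u a) - v a), fun t ht => ?_⟩
  have hsub : Icc a t ⊆ Ico a b := fun x hx => ⟨hx.1, hx.2.trans_lt ht.2⟩
  have h1 := norm_sub_le_of_norm_deriv_right_le (h.F_cont.mono hsub)
    (fun x hx => h.F_deriv x (hsub ⟨hx.1, hx.2.le⟩))
    (B := fun x => c * (u x + v x)) (B' := fun x => c * (u' x + v' x))
    (continuousOn_const.mul ((h.u_cont.mono hsub).add (h.v_cont.mono hsub)))
    (fun x hx => ((h.u_deriv x (hsub ⟨hx.1, hx.2.le⟩)).add
      (h.v_deriv x (hsub ⟨hx.1, hx.2.le⟩))).const_mul c) (fun x hx => by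
      have hx' := hsub ⟨hx.1, hx.2.le⟩
      have hu' := h.u'_pos x hx'
      have hv' := h.v'_pos x hx'
      have q1 := hQb _ (huI x hx') _ (hvI x hx')
      have q2 := hRb _ (huI x hx') _ (hvI x hx')
      have hQ0 := hmQ.trans_le q1.1
      have hR0 := hmR.trans_le q2.1
      rw [Real.norm_of_nonneg (Real.sqrt_nonneg _)]
      have h2 : u' x * v' x ≤ (u' x + v' x) ^ 2 := by nlinarith
      have h3 : Q (u x) (v x) / R (u x) (v x) ≤ MQ / mR :=
        div_le_div₀ (hQ0.le.trans q1.2) q1.2 hmR q2.1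
      have h4 : 0 ≤ MQ / mR := (div_pos hQ0 hR0).le.trans h3
      calc √(Q (u x) (v x) / R (u x) (v x) * (u' x * v' x))
          ≤ √(MQ / mR * (u' x + v' x) ^ 2) := Real.sqrt_le_sqrt (by gcongr)
        _ = c * (u' x + v' x) := by rw [Real.sqrt_mul h4, Real.sqrt_sq (by positivity)])
    (right_mem_Icc.2 ht.1)
  have h5 := (le_abs_self _).trans h1
  have h6 : 0 ≤ c := Real.sqrt_nonneg _
  have h7 : c * (u t + v t) ≤ 0 :=
    mul_nonpos_of_nonneg_of_nonpos h6 (by linarith [h.u_neg t ht, h.v_neg t ht])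
  nlinarith

theorem exists_tendsto_l (h : IsConeCurve Q R u v u' v' F l θ θ' a b)
    (hQ : IsBoundedCoefficient Q) (hR : IsBoundedCoefficient R) :
    ∃ c, Tendsto l (𝓝[<] b) (𝓝 c) ∧ ∀ t ∈ Ico a b, l t ≤ c := by
  obtain ⟨B, hB⟩ := h.exists_F_le hQ hR
  refine exists_tendsto_of_monotoneOn (B := B - (F a - l a)) h.lt h.l_monotone fun t ht => ?_
  have h1 : F a - l a ≤ F t - l t :=
    (h.F_sub_l_strictMono hR).monotoneOn ⟨le_rfl, h.lt⟩ ht ht.1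
  linarith [hB t ht]

/-- Finite length makes the sphere component Cauchy. -/
theorem exists_tendsto_θ (h : IsConeCurve Q R u v u' v' F l θ θ' a b)
    (hQ : IsBoundedCoefficient Q) (hR : IsBoundedCoefficient R) :
    ∃ e, ‖e‖ = 1 ∧ Tendsto θ (𝓝[<] b) (𝓝 e) := by
  obtain ⟨c, hc, -⟩ := h.exists_tendsto_l hQ hR
  have hcau : Cauchy (map θ (𝓝[<] b)) := by
    rw [Metric.cauchy_iff]
    refine ⟨inferInstance, fun ε hε => ?_⟩
    have hl := (Metric.tendsto_nhds.1 hc (ε / 2) (by positivity)).and (Ico_mem_nhdsLT h.lt)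
    refine ⟨θ '' {t | dist (l t) c < ε / 2 ∧ t ∈ Ico a b}, image_mem_map hl, ?_⟩
    have key : ∀ s ∈ Ico a b, ∀ t ∈ Ico a b, dist (l s) c < ε / 2 → dist (l t) c < ε / 2 → s ≤ t →
        dist (θ s) (θ t) < ε := by
      intro s hs t ht h1 h2 hst
      rw [dist_comm, dist_eq_norm]
      refine (h.norm_θ_sub_le hs.1 hst ht.2).trans_lt ?_
      rw [Real.dist_eq, abs_lt] at h1 h2
      linarith [h1.1, h2.2]
    rintro _ ⟨s, ⟨h1, hs⟩, rfl⟩ _ ⟨t, ⟨h2, ht⟩, rfl⟩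
    rcases le_total s t with hst | hst
    · exact key s hs t ht h1 h2 hst
    · rw [dist_comm]
      exact key t ht s hs h2 h1 hst
  obtain ⟨e, he⟩ := cauchy_map_iff_exists_tendsto.1 hcau
  refine ⟨e, tendsto_nhds_unique he.norm (tendsto_const_nhds.congr' ?_), he⟩
  filter_upwards [Ico_mem_nhdsLT h.lt] with t ht using (h.norm_eq t ht).symm

/-- The sphere component of a timelike curve can be traversed along the same `(u, v)` curve in less
than the available time. -/
theorem exists_lag (h : IsConeCurve Q R u v u' v' F l θ θ' a b)
    (hQ : IsBoundedCoefficient Q) (hR : IsBoundedCoefficient R) :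
    ∃ (k k' : ℝ → ℝ) (κ : ℝ), k a = a ∧ κ ∈ Ico a b ∧ (∀ t ∈ Ico a b, k t ∈ Icc a t) ∧
      (∀ t ∈ Ico a b, k t ≤ κ) ∧ MonotoneOn k (Ico a b) ∧ ContinuousOn k (Ico a b) ∧ Tendsto k (𝓝[<] b) (𝓝 κ) ∧
      ∀ t ∈ Ico a b, HasDerivWithinAt k (k' t) (Ici t) t ∧ 0 ≤ k' t ∧
        R (u (k t)) (v (k t)) * ‖θ' t‖ ^ 2 ≤
          Q (u (k t)) (v (k t)) * ((u' (k t) * k' t) * (v' (k t) * k' t)) := by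
  have ha : a ∈ Ico a b := ⟨le_rfl, h.lt⟩
  obtain ⟨B, hB⟩ := h.exists_F_le hQ hR
  obtain ⟨cF, hcF, hcF'⟩ := exists_tendsto_of_monotoneOn h.lt (h.F_strictMono hR).monotoneOn hB
  obtain ⟨cl, hcl, hcl'⟩ := h.exists_tendsto_l hQ hR
  obtain ⟨s₁, hs₁⟩ := exists_between h.lt
  have hs₁' : s₁ ∈ Ico a b := ⟨hs₁.1.le, hs₁.2⟩
  -- The surplus gained up to the intermediate time `s₁` is never lost, so the inequality stays
  -- strict in the limit.
  have hlag : F a - l a < cF - cl := by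
    refine ((h.F_sub_l_strictMono hR) ha hs₁' hs₁.1).trans_le ?_
    refine ge_of_tendsto (hcF.sub hcl) ?_
    filter_upwards [Ico_mem_nhdsLT hs₁.2] with t ht
    exact (h.F_sub_l_strictMono hR).monotoneOn hs₁' ⟨hs₁'.1.trans ht.1, ht.2⟩ ht.1
  -- By time `T < b` there is already room for the total sphere length. The delay `k` inverts `F` on
  -- `[a, T]`, matching used length with available length.
  obtain ⟨T, hT, hTI⟩ := ((hcF.eventually (lt_mem_nhds
    (show F a + (cl - l a) < cF by linarith))).and (Ico_mem_nhdsLT h.lt)).exists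
  have hIcc : Icc a T ⊆ Ico a b := fun x hx => ⟨hx.1, hx.2.trans_lt hTI.2⟩
  have hFm : StrictMonoOn F (Icc a T) := (h.F_strictMono hR).mono hIcc
  have hivt : ∀ y ∈ Icc (l a) cl, ∃ x ∈ Icc a T, F x = F a + (y - l a) := fun y hy =>
    intermediate_value_Icc hTI.1 (h.F_cont.mono hIcc) ⟨by linarith [hy.1], by linarith [hy.2]⟩
  have hlI : ∀ t ∈ Ico a b, l t ∈ Icc (l a) cl := fun t ht =>
    ⟨h.l_monotone ha ht ht.1, hcl' t ht⟩
  choose! k hkI hkF using fun t (ht : t ∈ Ico a b) => hivt (l t) (hlI t ht)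
  obtain ⟨κ, hκI, hκF⟩ := hivt cl ⟨hcl' a ha, le_rfl⟩
  have hcont : ContinuousOn k (Ico a b) := by
    intro t ht
    refine tendsto_of_strictMonoOn hFm (hkI t ht)
      (by filter_upwards [self_mem_nhdsWithin] with x hx using hkI x hx) ?_
    rw [hkF t ht]
    refine (((h.l_cont t ht).sub_const (l a)).const_add (F a)).congr' ?_
    filter_upwards [self_mem_nhdsWithin] with x hx using (hkF x hx).symm
  have hkm : MonotoneOn k (Ico a b) := fun s hs t ht hst => by
    rw [← hFm.le_iff_le (hkI s hs) (hkI t ht), hkF s hs, hkF t ht]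
    linarith [h.l_monotone hs ht hst]
  refine ⟨k, fun t => ‖θ' t‖ / √(Q (u (k t)) (v (k t)) / R (u (k t)) (v (k t)) *
    (u' (k t) * v' (k t))), κ, ?_, hIcc hκI, ?_, ?_, hkm, hcont, ?_, ?_⟩
  · exact hFm.injOn (hkI a ha) ⟨le_rfl, hTI.1⟩ (by rw [hkF a ha]; ring)
  · intro t ht
    refine ⟨(hkI t ht).1, ?_⟩
    rw [← (h.F_strictMono hR).le_iff_le (hIcc (hkI t ht)) ht, hkF t ht]
    have : F a - l a ≤ F t - l t := (h.F_sub_l_strictMono hR).monotoneOn ha ht ht.1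
    linarith
  · intro t ht
    rw [← hFm.le_iff_le (hkI t ht) hκI, hkF t ht, hκF]
    linarith [hcl' t ht]
  · refine tendsto_of_strictMonoOn hFm hκI
      (by filter_upwards [Ico_mem_nhdsLT h.lt] with x hx using hkI x hx) ?_
    rw [hκF]
    refine ((hcl.sub_const (l a)).const_add (F a)).congr' ?_
    filter_upwards [Ico_mem_nhdsLT h.lt] with x hx using (hkF x hx).symm
  · intro t ht
    have hkt := hIcc (hkI t ht)
    have hf := (norm_nonneg _).trans_lt (h.norm_θ'_lt hR hkt)
    have hIoo : ∀ᶠ x in 𝓝[>] t, x ∈ Ico a b := by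
      filter_upwards [Ioo_mem_nhdsGT ht.2] with x hx using ⟨ht.1.trans hx.1.le, hx.2⟩
    refine ⟨?_, by positivity, ?_⟩
    · refine hasDerivWithinAt_of_comp_eq (l := fun t => F a + (l t - l a)) (h.F_deriv _ hkt) hf.ne'
        ?_ (hIoo.mono hkF) (hkF t ht) (((h.l_deriv t ht).sub_const _).const_add _)
      refine tendsto_nhdsWithin_iff.2 ⟨(hcont t ht).mono_left ?_, ?_⟩
      · exact nhdsWithin_le_of_mem hIoo
      · filter_upwards [hIoo, self_mem_nhdsWithin] with x hx hx2
        exact hkm ht hx (le_of_lt hx2)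
    · have hQk := hQ.pos (h.u_neg _ hkt) (h.v_neg _ hkt)
      have hRk := hR.pos (h.u_neg _ hkt) (h.v_neg _ hkt)
      have hu' := h.u'_pos _ hkt
      have hv' := h.v'_pos _ hkt
      have hsq := Real.sq_sqrt (show 0 ≤ Q (u (k t)) (v (k t)) / R (u (k t)) (v (k t)) *
        (u' (k t) * v' (k t)) by positivity)
      -- The delayed curve uses its whole allowance: it is null.
      refine le_of_eq ?_
      set w := √(Q (u (k t)) (v (k t)) / R (u (k t)) (v (k t)) * (u' (k t) * v' (k t))) with hw
      have h1 : R (u (k t)) (v (k t)) * w ^ 2 = Q (u (k t)) (v (k t)) * (u' (k t) * v' (k t)) := by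
        rw [hsq]; field_simp
      calc R (u (k t)) (v (k t)) * ‖θ' t‖ ^ 2
          = (R (u (k t)) (v (k t)) * w ^ 2) * (‖θ' t‖ / w) ^ 2 := by field_simp
        _ = _ := by rw [h1]; ring

end IsConeCurve

/-! ### Trapping null lines between a timelike curve and its delay -/

namespace BoundaryChart

variable {E : Type*} [NormedAddCommGroup E] [NormedSpace ℝ E] {Q R : ℝ → ℝ → ℝ}
    {Y : ConeSpace → E} {O : Set ConeSpace} {G : E → E →L[ℝ] E →L[ℝ] ℝ} {τ : E →L[ℝ] ℝ} {y₀ : E}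
    {ρ Λ C : ℝ}

/-- Future directed causal curves inside the chart have increments in a cone around `τ`. -/
theorem norm_sub_le_of_causal (h : BoundaryChart Q R Y O G τ y₀ ρ Λ C)
    (hQ : IsBoundedCoefficient Q) {σ a b : ℝ} (hσ : σ ≤ ρ) {c c' : ℝ → ConeSpace}
    (hc : ContinuousOn c (Icc a b)) (hc' : ∀ t ∈ Ico a b, HasDerivWithinAt c (c' t) (Ici t) t)
    (hmem : ∀ t ∈ Icc a b, c t ∈ chartRegion Y O τ y₀ σ)
    (hcausal : ∀ t ∈ Ico a b, 0 ≤ (c' t).1 ∧ 0 ≤ (c' t).2.1 ∧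
      coneMetric Q R (c t) (c' t) (c' t) ≤ 0) {t : ℝ} (ht : t ∈ Icc a b) :
    ‖Y (c t) - Y (c a)‖ ≤ C * (τ (Y (c t)) - τ (Y (c a))) :=
  norm_sub_le_of_deriv_right_mem_cone (f := fun t => Y (c t))
    (f' := fun t => fderiv ℝ Y (c t) (c' t))
    (h.continuousOn.comp hc fun t ht => (hmem t ht).1)
    (fun t ht => (h.hasFDerivAt (hmem t ⟨ht.1, ht.2.le⟩).1).comp_hasDerivWithinAt t (hc' t ht))
    (fun t ht => h.norm_fderiv_le hQ hσ (hmem t ⟨ht.1, ht.2.le⟩) (hcausal t ht).1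
      (hcausal t ht).2.1 (hcausal t ht).2.2) ht

theorem isClosed_setOf_forall_mem_chartRegion (h : BoundaryChart Q R Y O G τ y₀ ρ Λ C)
    (hQ : IsBoundedCoefficient Q) {σ a b : ℝ} (hσ : σ ≤ ρ) {L : ℝ → ℝ → ConeSpace} {K : Set ℝ}
    (hL : ∀ s ∈ K, ContinuousOn (fun t => L t s) (Icc a b))
    (hdom : ∀ t ∈ Icc a b, ∀ s ∈ K, L t s ∈ coneDomain) :
    IsClosed ({t | ∀ s ∈ K, L t s ∈ chartRegion Y O τ y₀ σ} ∩ Icc a b) := by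
  refine isClosed_of_closure_subset fun x hx => ?_
  have hxI : x ∈ Icc a b := closure_minimal inter_subset_right isClosed_Icc hx
  refine ⟨fun s hs => h.mem_chartRegion_of_mem_closure hQ hσ (hdom x hxI s hs) ?_, hxI⟩
  have h1 := ((hL s hs x hxI).mono inter_subset_right).mem_closure_image hx
  refine closure_mono ?_ h1
  rintro _ ⟨t, ht, rfl⟩
  exact ht.1 s hs

/-- Compactness of `K` (the tube lemma) makes the neighbourhood of the time uniform in the line
parameter. -/
theorem eventually_forall_mem_chartRegion (h : BoundaryChart Q R Y O G τ y₀ ρ Λ C)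
    {σ σ' x : ℝ} (hσ : σ < σ') {L : ℝ → ℝ → ConeSpace} {K : Set ℝ} {l : Filter ℝ}
    (hK : IsCompact K)
    (hL : ∀ s ∈ K, Tendsto (fun p : ℝ × ℝ => L p.1 p.2) (l ×ˢ 𝓝 s) (𝓝 (L x s)))
    (hx : ∀ s ∈ K, L x s ∈ chartRegion Y O τ y₀ σ) :
    ∀ᶠ t in l, ∀ s ∈ K, L t s ∈ chartRegion Y O τ y₀ σ' := by
  have h1 : {p : ℝ × ℝ | L p.1 p.2 ∈ chartRegion Y O τ y₀ σ'} ∈ l ×ˢ 𝓝ˢ K :=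
    hK.mem_prod_nhdsSet_of_forall fun s hs =>
      (hL s hs).eventually (h.eventually_mem_chartRegion hσ (hx s hs))
  obtain ⟨A, hA, B, hB, hAB⟩ := mem_prod_iff.1 h1
  filter_upwards [hA] with t ht s hs
  have hts : (t, s) ∈ A ×ˢ B := ⟨ht, subset_of_mem_nhdsSet hB hs⟩
  exact hAB hts

/-- The null lines between the delayed curve and a timelike curve which stays in a small ball of the
chart are contained in the chart. -/
theorem mem_chartRegion_of_lag (h : BoundaryChart Q R Y O G τ y₀ ρ Λ C)
    (hQ : IsBoundedCoefficient Q) (hR : IsBoundedCoefficient R) {u v u' v' F l : ℝ → ℝ}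
    {θ θ' : ℝ → EuclideanSpace ℝ (Fin 3)} {a b : ℝ}
    (hc : IsConeCurve Q R u v u' v' F l θ θ' a b) {k k' : ℝ → ℝ} (hka : k a = a)
    (hk : ∀ t ∈ Ico a b, k t ∈ Icc a t) (hkc : ContinuousOn k (Ico a b))
    (hk' : ∀ t ∈ Ico a b, HasDerivWithinAt k (k' t) (Ici t) t ∧ 0 ≤ k' t ∧
        R (u (k t)) (v (k t)) * ‖θ' t‖ ^ 2 ≤
          Q (u (k t)) (v (k t)) * ((u' (k t) * k' t) * (v' (k t) * k' t)))
    (hkm : MonotoneOn k (Ico a b))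
    {σ σ' ε : ℝ} (hσ : σ < σ') (hσ' : σ' ≤ ρ)
    (hε : ∀ t ∈ Ico a b, ‖Y (u t, v t, θ t) - y₀‖ ≤ ε) (hεσ : ε + C * (‖τ‖ * (2 * ε)) ≤ σ)
    (hstart : (u a, v a, θ a) ∈ chartRegion Y O τ y₀ σ) :
    ∀ t ∈ Ico a b, ∀ s ∈ Icc (0 : ℝ) 1,
      (u (k t), v (k t) + s * (v t - v (k t)), θ t) ∈ chartRegion Y O τ y₀ σ' := by
  have ha : a ∈ Ico a b := ⟨le_rfl, hc.lt⟩
  have hkI : ∀ t ∈ Ico a b, k t ∈ Ico a b := fun t ht => ⟨(hk t ht).1, (hk t ht).2.trans_lt ht.2⟩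
  have huk : ContinuousOn (fun t => u (k t)) (Ico a b) := hc.u_cont.comp hkc hkI
  have hvk : ContinuousOn (fun t => v (k t)) (Ico a b) := hc.v_cont.comp hkc hkI
  -- Monotonicity of `k` is known only before `b`, so the chain rule is applied on `Ici t ∩ Iio b`.
  have hukd : ∀ t ∈ Ico a b, HasDerivWithinAt (fun t => u (k t)) (u' (k t) * k' t) (Ici t ∩ Iio b)
      t := fun t ht =>
    (hc.u_deriv _ (hkI t ht)).comp t ((hk' t ht).1.mono inter_subset_left)
      fun x hx => hkm ht ⟨ht.1.trans hx.1, hx.2⟩ hx.1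
  have hvkd : ∀ t ∈ Ico a b, HasDerivWithinAt (fun t => v (k t)) (v' (k t) * k' t) (Ici t ∩ Iio b)
      t := fun t ht =>
    (hc.v_deriv _ (hkI t ht)).comp t ((hk' t ht).1.mono inter_subset_left)
      fun x hx => hkm ht ⟨ht.1.trans hx.1, hx.2⟩ hx.1
  have hle_u : ∀ t ∈ Ico a b, u (k t) ≤ u t := fun t ht =>
    hc.u_strictMono.monotoneOn (hkI t ht) ht (hk t ht).2
  have hle_v : ∀ t ∈ Ico a b, v (k t) ≤ v t := fun t ht =>
    hc.v_strictMono.monotoneOn (hkI t ht) ht (hk t ht).2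
  -- With the sphere point fixed, `L₁` is the `v`-line leaving the delayed curve and `L₂` the
  -- `u`-line from its end to the original curve. Both must be tracked, since the upper bound on `τ`
  -- along `L₁` comes through `L₂`.
  set L₁ : ℝ → ℝ → ConeSpace := fun t s => (u (k t), v (k t) + s * (v t - v (k t)), θ t) with hL₁
  set L₂ : ℝ → ℝ → ConeSpace := fun t s => (u (k t) + s * (u t - u (k t)), v t, θ t) with hL₂
  have hL₁0 (t) : L₁ t 0 = (u (k t), v (k t), θ t) := by simp [hL₁]
  have hL₁₂ (t) : L₂ t 0 = L₁ t 1 := by simp [hL₁, hL₂]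
  have hL₂1 (t) : L₂ t 1 = (u t, v t, θ t) := by simp [hL₂]
  have hne : ∀ t ∈ Ico a b, θ t ≠ 0 := fun t ht h0 => by
    have := hc.norm_eq t ht
    simp [h0] at this
  have hdom₁ : ∀ t ∈ Ico a b, ∀ s ∈ Icc (0 : ℝ) 1, L₁ t s ∈ coneDomain := by
    intro t ht s hs
    refine ⟨hc.u_neg _ (hkI t ht), ?_, hne t ht⟩
    have := hc.v_neg t ht
    have := hle_v t ht
    simp only [hL₁]
    nlinarith [hs.1, hs.2]
  have hdom₂ : ∀ t ∈ Ico a b, ∀ s ∈ Icc (0 : ℝ) 1, L₂ t s ∈ coneDomain := by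
    intro t ht s hs
    refine ⟨?_, hc.v_neg t ht, hne t ht⟩
    have := hc.u_neg t ht
    have := hle_u t ht
    simp only [hL₂]
    nlinarith [hs.1, hs.2]
  have hstart' : (u a, v a, θ a) ∈ chartRegion Y O τ y₀ σ' :=
    ⟨hstart.1, Metric.closedBall_subset_closedBall hσ.le hstart.2.1, hstart.2.2⟩
  intro V hV
  have hsub : Icc a V ⊆ Ico a b := fun x hx => ⟨hx.1, hx.2.trans_lt hV.2⟩
  set S₁ : Set ℝ := {t | ∀ s ∈ Icc (0 : ℝ) 1, L₁ t s ∈ chartRegion Y O τ y₀ σ'}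
  set S₂ : Set ℝ := {t | ∀ s ∈ Icc (0 : ℝ) 1, L₂ t s ∈ chartRegion Y O τ y₀ σ'}
  have key : Icc a V ⊆ S₁ ∩ S₂ := by
    refine Icc_subset_of_isClosed_of_eventually ?_ ?_ ?_
    · have c1 : IsClosed (S₁ ∩ Icc a V) := h.isClosed_setOf_forall_mem_chartRegion hQ hσ'
        (fun s _ => ((huk.mono hsub).prodMk (((hvk.mono hsub).add (continuousOn_const.mul
          ((hc.v_cont.mono hsub).sub (hvk.mono hsub)))).prodMk (hc.θ_cont.mono hsub))))
        (fun t ht => hdom₁ t (hsub ht))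
      have c2 : IsClosed (S₂ ∩ Icc a V) := h.isClosed_setOf_forall_mem_chartRegion hQ hσ'
        (fun s _ => (((huk.mono hsub).add (continuousOn_const.mul
          ((hc.u_cont.mono hsub).sub (huk.mono hsub)))).prodMk
          ((hc.v_cont.mono hsub).prodMk (hc.θ_cont.mono hsub))))
        (fun t ht => hdom₂ t (hsub ht))
      have := c1.inter c2
      rwa [← inter_inter_distrib_right] at this
    · constructor <;> intro s _
      · simpa [hL₁, hka] using hstart'
      · simpa [hL₂, hka] using hstart'
    · intro x hx hIcc
      have hxb : x ∈ Ico a b := hsub ⟨hx.1, hx.2.le⟩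
      have hxx : x ∈ Icc a x := ⟨hx.1, le_rfl⟩
      have hsubx : Icc a x ⊆ Ico a b := fun y hy => ⟨hy.1, hy.2.trans_lt hxb.2⟩
      have m₁ : ∀ s ∈ Icc (0 : ℝ) 1, L₁ x s ∈ chartRegion Y O τ y₀ σ' := (hIcc hxx).1
      have m₂ : ∀ s ∈ Icc (0 : ℝ) 1, L₂ x s ∈ chartRegion Y O τ y₀ σ' := (hIcc hxx).2
      have i0 : (0 : ℝ) ∈ Icc (0 : ℝ) 1 := by simp
      have i1 : (1 : ℝ) ∈ Icc (0 : ℝ) 1 := by simp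
      have hC := h.C_pos
      -- Cone estimates along the delayed curve (`e₀`), the `v`-line (`e₁`) and the `u`-line (`e₂`);
      -- chained together, they trap every intermediate point.
      have e₀ : ‖Y (L₁ x 0) - Y (u a, v a, θ a)‖ ≤
          C * (τ (Y (L₁ x 0)) - τ (Y (u a, v a, θ a))) := by
        have := h.norm_sub_le_of_causal hQ hσ' (c := fun t => L₁ t 0)
          (c' := fun t => (u' (k t) * k' t, v' (k t) * k' t, θ' t)) (a := a) (b := x)
          (by
            simp only [hL₁0]
            exact (huk.mono hsubx).prodMk ((hvk.mono hsubx).prodMk (hc.θ_cont.mono hsubx)))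
          (fun t ht => by
            have ht' := hsubx ⟨ht.1, ht.2.le⟩
            simp only [hL₁0]
            have hd := (hukd t ht').prodMk ((hvkd t ht').prodMk
              ((hc.θ_deriv t ht').mono inter_subset_left))
            exact hd.mono_of_mem_nhdsWithin
              (inter_mem self_mem_nhdsWithin (mem_nhdsWithin_of_mem_nhds (Iio_mem_nhds ht'.2))))
          (fun t ht => (hIcc ht).1 0 i0)
          (fun t ht => by
            have ht' := hsubx ⟨ht.1, ht.2.le⟩
            obtain ⟨-, q1, q2⟩ := hk' t ht'
            refine ⟨mul_nonneg (hc.u'_pos _ (hkI t ht')).le q1,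
              mul_nonneg (hc.v'_pos _ (hkI t ht')).le q1, ?_⟩
            rw [coneMetric_of_norm_eq_one (by rw [hL₁0]; exact hc.norm_eq t ht')]
            simp only [hL₁0, real_inner_self_eq_norm_sq]
            have hRk := hR.pos (hc.u_neg _ (hkI t ht')) (hc.v_neg _ (hkI t ht'))
            nlinarith [mul_nonneg hRk.le (mul_self_nonneg (inner ℝ (θ t) (θ' t) : ℝ))]) hxx
        simpa only [hL₁0, hka] using this
      have e₁ : ∀ p ∈ Icc (0 : ℝ) 1, ∀ q ∈ Icc p 1,
          ‖Y (L₁ x q) - Y (L₁ x p)‖ ≤ C * (τ (Y (L₁ x q)) - τ (Y (L₁ x p))) := fun p hp q hq =>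
        h.norm_sub_le_of_causal hQ hσ' (c := fun s => L₁ x s)
          (c' := fun _ => (0, v x - v (k x), 0)) (a := p) (b := 1)
          (by simp only [hL₁]; fun_prop)
          (fun t _ => by
            have := ((hasDerivAt_id t).mul_const (v x - v (k x))).const_add (v (k x))
            have h2 := (hasDerivAt_const t (u (k x))).prodMk
              (this.prodMk (hasDerivAt_const t (θ x)))
            simpa using h2.hasDerivWithinAt)
          (fun t ht => m₁ t ⟨hp.1.trans ht.1, ht.2⟩)
          (fun t _ => ⟨le_rfl, sub_nonneg.2 (hle_v x hxb), by simp [coneMetric, coneRound]⟩) hq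
      have e₂ : ∀ p ∈ Icc (0 : ℝ) 1, ∀ q ∈ Icc p 1,
          ‖Y (L₂ x q) - Y (L₂ x p)‖ ≤ C * (τ (Y (L₂ x q)) - τ (Y (L₂ x p))) := fun p hp q hq =>
        h.norm_sub_le_of_causal hQ hσ' (c := fun s => L₂ x s)
          (c' := fun _ => (u x - u (k x), 0, 0)) (a := p) (b := 1)
          (by simp only [hL₂]; fun_prop)
          (fun t _ => by
            have := ((hasDerivAt_id t).mul_const (u x - u (k x))).const_add (u (k x))
            have h2 := this.prodMk ((hasDerivAt_const t (v x)).prodMk (hasDerivAt_const t (θ x)))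
            simpa using h2.hasDerivWithinAt)
          (fun t ht => m₂ t ⟨hp.1.trans ht.1, ht.2⟩)
          (fun t _ => ⟨sub_nonneg.2 (hle_u x hxb), le_rfl, by simp [coneMetric, coneRound]⟩) hq
      have mono : ∀ {p q : E}, ‖p - q‖ ≤ C * (τ p - τ q) → τ q ≤ τ p := fun hpq =>
        sub_nonneg.1 (nonneg_of_mul_nonneg_right ((norm_nonneg _).trans hpq) hC)
      have trans' : ∀ {p q r : E}, ‖p - q‖ ≤ C * (τ p - τ q) → ‖q - r‖ ≤ C * (τ q - τ r) →
          ‖p - r‖ ≤ C * (τ p - τ r) := fun {p q r} h1 h2 => by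
        have : p - r = (p - q) + (q - r) := by abel
        rw [this]
        refine (norm_add_le _ _).trans ?_
        linarith
      -- A point causally between two points of the curve has its `τ` value between theirs, which
      -- differ by at most `2ε‖τ‖`; the cone estimate converts this into a distance.
      have fin : ∀ p ∈ O, p ∈ chartRegion Y O τ y₀ σ' →
          ‖Y p - Y (u a, v a, θ a)‖ ≤ C * (τ (Y p) - τ (Y (u a, v a, θ a))) →
          ‖Y (u x, v x, θ x) - Y p‖ ≤ C * (τ (Y (u x, v x, θ x)) - τ (Y p)) →
          p ∈ chartRegion Y O τ y₀ σ := by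
        intro p hpO hp f1 f2
        refine ⟨hpO, ?_, hp.2.2⟩
        rw [mem_closedBall_iff_norm]
        have f3 := mono f2
        have f4 : τ (Y (u x, v x, θ x)) - τ (Y (u a, v a, θ a)) ≤ ‖τ‖ * (2 * ε) := by
          rw [← map_sub]
          refine (le_abs_self _).trans ((τ.le_opNorm _).trans ?_)
          gcongr
          have : Y (u x, v x, θ x) - Y (u a, v a, θ a) =
            (Y (u x, v x, θ x) - y₀) - (Y (u a, v a, θ a) - y₀) := by abel
          rw [this]
          exact (norm_sub_le _ _).trans (by linarith [hε x hxb, hε a ha])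
        have : Y p - y₀ = (Y p - Y (u a, v a, θ a)) + (Y (u a, v a, θ a) - y₀) := by abel
        rw [this]
        refine (norm_add_le _ _).trans (le_trans ?_ hεσ)
        have f5 : C * (τ (Y p) - τ (Y (u a, v a, θ a))) ≤ C * (‖τ‖ * (2 * ε)) :=
          mul_le_mul_of_nonneg_left (by linarith) hC.le
        linarith [hε a ha]
      have g₁ : ∀ s ∈ Icc (0 : ℝ) 1, L₁ x s ∈ chartRegion Y O τ y₀ σ := fun s hs => by
        refine fin _ (m₁ s hs).1 (m₁ s hs) (trans' (e₁ 0 i0 s hs) e₀) ?_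
        rw [← hL₂1]
        refine trans' (e₂ 0 i0 1 i1) ?_
        rw [hL₁₂]
        exact e₁ s hs 1 ⟨hs.2, le_rfl⟩
      have g₂ : ∀ s ∈ Icc (0 : ℝ) 1, L₂ x s ∈ chartRegion Y O τ y₀ σ := fun s hs => by
        refine fin _ (m₂ s hs).1 (m₂ s hs) (trans' (e₂ 0 i0 s hs) ?_) ?_
        · rw [hL₁₂]; exact trans' (e₁ 0 i0 1 i1) e₀
        · rw [← hL₂1]; exact e₂ s hs 1 ⟨hs.2, le_rfl⟩
      have hIoo : Ico a b ∈ 𝓝[>] x := by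
        filter_upwards [Ioo_mem_nhdsGT hxb.2] with y hy using ⟨hxb.1.trans hy.1.le, hy.2⟩
      have tl : 𝓝[>] x ≤ 𝓝[Ico a b] x := nhdsWithin_le_of_mem hIoo
      have tu := ((hc.u_cont x hxb).mono_left tl)
      have tv := ((hc.v_cont x hxb).mono_left tl)
      have tθ := ((hc.θ_cont x hxb).mono_left tl)
      have tuk := ((huk x hxb).mono_left tl)
      have tvk := ((hvk x hxb).mono_left tl)
      have w₁ := h.eventually_forall_mem_chartRegion hσ isCompact_Icc (L := L₁) (l := 𝓝[>] x)
        (fun s _ => (tuk.comp tendsto_fst).prodMk_nhds (((tvk.comp tendsto_fst).add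
          (tendsto_snd.mul ((tv.comp tendsto_fst).sub (tvk.comp tendsto_fst)))).prodMk_nhds
          (tθ.comp tendsto_fst))) g₁
      have w₂ := h.eventually_forall_mem_chartRegion hσ isCompact_Icc (L := L₂) (l := 𝓝[>] x)
        (fun s _ => ((tuk.comp tendsto_fst).add
          (tendsto_snd.mul ((tu.comp tendsto_fst).sub (tuk.comp tendsto_fst)))).prodMk_nhds
          ((tv.comp tendsto_fst).prodMk_nhds (tθ.comp tendsto_fst))) g₂
      filter_upwards [w₁, w₂] with t ht1 ht2 using ⟨ht1, ht2⟩
  exact (key ⟨hV.1, le_rfl⟩).1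

end BoundaryChart

/-! ### From a curve to a null line, and the exchange of `u` and `v` -/

namespace BoundaryChart

variable {E : Type*} [NormedAddCommGroup E] [NormedSpace ℝ E] {Q R : ℝ → ℝ → ℝ}
    {Y : ConeSpace → E} {O : Set ConeSpace} {G : E → E →L[ℝ] E →L[ℝ] ℝ} {τ : E →L[ℝ] ℝ} {y₀ : E}
    {ρ Λ C : ℝ}

theorem neg (h : BoundaryChart Q R Y O G τ y₀ ρ Λ C) : BoundaryChart Q R Y O G (-τ) y₀ ρ Λ C :=
  { h with cone := fun y hy V hV => by simpa using h.cone y hy V hV }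

theorem apply_timeVector_ne_zero (h : BoundaryChart Q R Y O G τ y₀ ρ Λ C)
    (hQ : IsBoundedCoefficient Q) {x : ConeSpace} (hx : x ∈ O) (hY : Y x ∈ Metric.closedBall y₀ ρ) :
    τ (fderiv ℝ Y x (1, 1, 0)) ≠ 0 := by
  intro h0
  have hQx := hQ.pos (h.subset hx).1 (h.subset hx).2.1
  have hm : coneMetric Q R x (1, 1, 0) (1, 1, 0) < 0 := by
    simp [coneMetric, coneRound, hQx]
  rw [← h.isometric x hx] at hm
  have h2 := h.cone _ hY _ hm.le
  rw [h0] at h2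
  have h3 : fderiv ℝ Y x (1, 1, 0) = 0 := by simpa using h2
  rw [h3] at hm
  simp at hm

/-- No future directed timelike curve along which `v → 0` can converge inside a chart in which the
metric is Lipschitz. -/
theorem false_of_curve (h : BoundaryChart Q R Y O G τ y₀ ρ Λ C) (hρ : 0 < ρ)
    (hQ : IsBoundedCoefficient Q) (hR : IsBoundedCoefficient R) {u v u' v' F l : ℝ → ℝ}
    {θ θ' : ℝ → EuclideanSpace ℝ (Fin 3)} {a b : ℝ}
    (hc : IsConeCurve Q R u v u' v' F l θ θ' a b)
    (hO : ∀ᶠ t in 𝓝[<] b, (u t, v t, θ t) ∈ O)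
    (hY : Tendsto (fun t => Y (u t, v t, θ t)) (𝓝[<] b) (𝓝 y₀))
    (hv : Tendsto v (𝓝[<] b) (𝓝 0))
    (hRv : ∀ u < 0, Tendsto (fun v => fderiv ℝ (fun x : ℝ × ℝ => R x.1 x.2) (u, v) (0, 1))
      (𝓝[<] 0) atBot)
    (hRu : ∀ u < 0, ∀ᶠ v in 𝓝[<] 0, fderiv ℝ (fun x : ℝ × ℝ => R x.1 x.2) (u, v) (1, 0) ≤ 0) :
    False := by
  have hC := h.C_pos
  -- Chosen so that causal diamonds between points of the `ε`-ball fit in the ball of radius `ρ /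
  -- 4`.
  set ε := ρ / 4 / (1 + C * (‖τ‖ * 2)) with hε
  have hden : 0 < 1 + C * (‖τ‖ * 2) := by positivity
  have hε0 : 0 < ε := by positivity
  have hεσ : ε + C * (‖τ‖ * (2 * ε)) ≤ ρ / 4 := by
    have : ε * (1 + C * (‖τ‖ * 2)) = ρ / 4 := by rw [hε]; field_simp
    linarith
  have hερ : ε ≤ ρ / 4 := by
    have : 0 ≤ C * (‖τ‖ * (2 * ε)) := by positivity
    linarith
  have hev := (hO.and (hY.eventually (Metric.closedBall_mem_nhds y₀ hε0))).and
    (Ico_mem_nhdsLT hc.lt)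
  obtain ⟨s, hsb, hs⟩ := (mem_nhdsLT_iff_exists_Ico_subset).1 hev
  have hsI : s ∈ Ico a b := (hs ⟨le_rfl, hsb⟩).2
  replace hc := hc.mono_left hsI
  have hsO := (hs ⟨le_rfl, hsb⟩).1.1
  have hεb : ∀ t ∈ Ico s b, ‖Y (u t, v t, θ t) - y₀‖ ≤ ε := fun t ht =>
    mem_closedBall_iff_norm.1 (hs ht).1.2
  have hsY : Y (u s, v s, θ s) ∈ Metric.closedBall y₀ (ρ / 4) :=
    mem_closedBall_iff_norm.2 ((hεb s ⟨le_rfl, hsb⟩).trans hερ)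
  clear_value ε
  -- The chart fixes time orientation only up to sign, and the estimates are invariant under `τ ↦
  -- -τ`.
  wlog hτ : 0 < τ (fderiv ℝ Y (u s, v s, θ s) (1, 1, 0)) generalizing τ
  · refine this h.neg (by simpa using hε) (by simpa using hden) (by simpa using hεσ) ?_
    have h1 := h.apply_timeVector_ne_zero hQ hsO
      (Metric.closedBall_subset_closedBall (by linarith) hsY)
    simpa using lt_of_le_of_ne (not_lt.1 hτ) h1
  obtain ⟨k, k', κ, hka, hκ, hk, hkκ, hkm, hkc, hkt, hk'⟩ := hc.exists_lag hQ hR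
  obtain ⟨e, he, hθ⟩ := hc.exists_tendsto_θ hQ hR
  have hmem := h.mem_chartRegion_of_lag hQ hR hc hka hk hkc hk' hkm
    (show ρ / 4 < ρ / 2 by linarith) (show ρ / 2 ≤ ρ by linarith) hεb hεσ ⟨hsO, hsY, hτ⟩
  have hvκ := hc.v_neg κ hκ
  have huκ := hc.u_neg κ hκ
  have he0 : e ≠ 0 := by rintro rfl; simp at he
  have huk : Tendsto (fun t => u (k t)) (𝓝[<] b) (𝓝 (u κ)) := by
    refine (hc.u_cont κ hκ).tendsto.comp (tendsto_nhdsWithin_iff.2 ⟨hkt, ?_⟩)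
    filter_upwards [Ico_mem_nhdsLT hc.lt] with t ht
    exact ⟨(hk t ht).1, (hk t ht).2.trans_lt ht.2⟩
  -- Starting at `v κ / 2` keeps `y` strictly above every `v (k t)`, so each such height eventually
  -- lies on the `v`-line at time `t`; closedness of the region passes this to the limit line.
  have hline : ∀ y ∈ Ico (v κ / 2) 0, (u κ, y, e) ∈ chartRegion Y O τ y₀ (ρ / 2) := by
    intro y hy
    refine h.mem_chartRegion_of_mem_closure hQ (by linarith) ⟨huκ, hy.2, he0⟩ ?_
    have ht : Tendsto (fun t => ((u (k t), y, θ t) : ConeSpace)) (𝓝[<] b) (𝓝 (u κ, y, e)) :=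
      huk.prodMk_nhds (tendsto_const_nhds.prodMk_nhds hθ)
    refine mem_closure_of_tendsto ht ?_
    filter_upwards [Ico_mem_nhdsLT hc.lt, hv.eventually (lt_mem_nhds hy.2)] with t ht hyt
    have hvk : v (k t) < y := by
      have : v (k t) ≤ v κ := hc.v_strictMono.monotoneOn
        ⟨(hk t ht).1, (hk t ht).2.trans_lt ht.2⟩ hκ (hkκ t ht)
      linarith [hy.1]
    have hpos : 0 < v t - v (k t) := by linarith
    have := hmem t ht ((y - v (k t)) / (v t - v (k t)))
      ⟨div_nonneg (by linarith) hpos.le, (div_le_one hpos).2 (by linarith)⟩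
    rwa [div_mul_cancel₀ _ hpos.ne', add_sub_cancel] at this
  exact h.false_of_line hQ hR (show ρ / 2 < ρ by linarith) he huκ (by linarith) hline
    (hRv _ huκ) (hRu _ huκ)

/-- The map which exchanges `u` and `v`. -/
def swapNull : ConeSpace ≃L[ℝ] ConeSpace :=
  ((ContinuousLinearEquiv.prodAssoc ℝ ℝ ℝ (EuclideanSpace ℝ (Fin 3))).symm.trans
    ((ContinuousLinearEquiv.prodComm ℝ ℝ ℝ).prodCongr (ContinuousLinearEquiv.refl ℝ _))).trans
    (ContinuousLinearEquiv.prodAssoc ℝ ℝ ℝ (EuclideanSpace ℝ (Fin 3)))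

@[simp]
theorem swapNull_apply (x : ConeSpace) : swapNull x = (x.2.1, x.1, x.2.2) := rfl

/-- The exchange is linear and carries the cone metric to the one with transposed coefficients, so
only the case `v → 0` has to be treated. -/
theorem swap (h : BoundaryChart Q R Y O G τ y₀ ρ Λ C) :
    BoundaryChart (fun u v => Q v u) (fun u v => R v u) (Y ∘ swapNull) (swapNull ⁻¹' O) G τ y₀ ρ Λ C
    where
  finrank_eq := h.finrank_eq
  isOpen := h.isOpen.preimage swapNull.continuous
  subset := fun x hx => by
    obtain ⟨h1, h2, h3⟩ := h.subset hx
    exact ⟨h2, h1, h3⟩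
  smooth := h.smooth.comp swapNull.contDiff.contDiffOn fun _ hx => hx
  closed := fun x hx hcl => by
    refine h.closed (swapNull x) ⟨hx.2.1, hx.1, hx.2.2⟩ ?_
    exact map_mem_closure swapNull.continuous hcl fun p hp => hp
  isometric := fun x hx z w => by
    have hd : fderiv ℝ (Y ∘ swapNull) x = (fderiv ℝ Y (swapNull x)).comp
        (swapNull : ConeSpace →L[ℝ] ConeSpace) :=
      ((h.hasFDerivAt hx).comp x swapNull.hasFDerivAt).fderiv
    have := h.isometric _ hx (swapNull z) (swapNull w)
    rw [hd]
    refine this.trans ?_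
    simp only [coneMetric, swapNull_apply]
    ring
  Lip_nonneg := h.Lip_nonneg
  lipschitz := h.lipschitz
  C_pos := h.C_pos
  symm := h.symm
  nondegenerate := h.nondegenerate
  bounded := h.bounded
  cone := h.cone

end BoundaryChart

theorem IsBoundedCoefficient.swap {Q : ℝ → ℝ → ℝ} (hQ : IsBoundedCoefficient Q) :
    IsBoundedCoefficient fun u v => Q v u where
  smooth := hQ.smooth.comp (f := fun x : ℝ × ℝ => (x.2, x.1)) (by fun_prop)
    fun _ hx => ⟨hx.2, hx.1⟩
  bounds := fun a ha => by
    obtain ⟨m, hm, M, h⟩ := hQ.bounds a ha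
    exact ⟨m, hm, M, fun u hu v hv => h v hv u hu⟩

theorem IsConeCurve.swap {Q R : ℝ → ℝ → ℝ} {u v u' v' F l : ℝ → ℝ}
    {θ θ' : ℝ → EuclideanSpace ℝ (Fin 3)} {a b : ℝ}
    (hc : IsConeCurve Q R u v u' v' F l θ θ' a b) :
    IsConeCurve (fun u v => Q v u) (fun u v => R v u) v u v' u' F l θ θ' a b :=
  { hc with
    u_neg := hc.v_neg
    v_neg := hc.u_neg
    u_cont := hc.v_cont
    v_cont := hc.u_cont
    u_deriv := hc.v_deriv
    v_deriv := hc.u_deriv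
    u'_pos := hc.v'_pos
    v'_pos := hc.u'_pos
    F_deriv := fun t ht => by simpa only [mul_comm (v' t)] using hc.F_deriv t ht
    timelike := fun t ht => by simpa only [mul_comm (v' t)] using hc.timelike t ht }

/-! ### Cone coordinates on the spacetime -/

theorem hasMFDerivAt_negLine_val (x : NegLine) :
    HasMFDerivAt 𝓘(ℝ, ℝ) 𝓘(ℝ, ℝ) (Subtype.val : NegLine → ℝ) x (ContinuousLinearMap.id ℝ ℝ) := by
  refine ⟨continuous_subtype_val.continuousAt, ?_⟩
  have hev : writtenInExtChartAt 𝓘(ℝ, ℝ) 𝓘(ℝ, ℝ) x (Subtype.val : NegLine → ℝ)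
      =ᶠ[𝓝 (extChartAt 𝓘(ℝ, ℝ) x x)] id := by
    filter_upwards [extChartAt_target_mem_nhds (I := 𝓘(ℝ, ℝ)) x] with y hy
    exact (extChartAt 𝓘(ℝ, ℝ) x).right_inv hy
  exact ((hasFDerivAt_id _).congr_of_eventuallyEq hev).hasFDerivWithinAt

theorem hasMFDerivAt_u (p : DoubleNull) :
    HasMFDerivAt DoubleNullModel 𝓘(ℝ, ℝ) (fun x : DoubleNull => (x.1 : ℝ)) p
      ((ContinuousLinearMap.id ℝ ℝ).comp
        (ContinuousLinearMap.fst ℝ ℝ (ℝ × EuclideanSpace ℝ (Fin 2)))) :=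
  (hasMFDerivAt_negLine_val p.1).comp p (hasMFDerivAt_fst p)

theorem hasMFDerivAt_v (p : DoubleNull) :
    HasMFDerivAt DoubleNullModel 𝓘(ℝ, ℝ) (fun x : DoubleNull => (x.2.1 : ℝ)) p
      ((ContinuousLinearMap.id ℝ ℝ).comp
        ((ContinuousLinearMap.fst ℝ ℝ (EuclideanSpace ℝ (Fin 2))).comp
          (ContinuousLinearMap.snd ℝ ℝ (ℝ × EuclideanSpace ℝ (Fin 2))))) :=
  (hasMFDerivAt_negLine_val p.2.1).comp p ((hasMFDerivAt_fst p.2).comp p (hasMFDerivAt_snd p))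

theorem mdifferentiableAt_sphere_val (x : UnitSphere) :
    MDifferentiableAt (𝓡 2) 𝓘(ℝ, EuclideanSpace ℝ (Fin 3))
      ((↑) : UnitSphere → EuclideanSpace ℝ (Fin 3)) x := by
  have : Fact (Module.finrank ℝ (EuclideanSpace ℝ (Fin 3)) = 2 + 1) := ⟨by simp⟩
  exact (contMDiff_coe_sphere (n := 2) (m := 1) x).mdifferentiableAt one_ne_zero

theorem hasMFDerivAt_sphere (p : DoubleNull) :
    HasMFDerivAt DoubleNullModel 𝓘(ℝ, EuclideanSpace ℝ (Fin 3))
      (fun x : DoubleNull => (x.2.2 : EuclideanSpace ℝ (Fin 3))) p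
      ((mfderiv (𝓡 2) 𝓘(ℝ, EuclideanSpace ℝ (Fin 3))
        ((↑) : UnitSphere → EuclideanSpace ℝ (Fin 3)) p.2.2).comp
        ((ContinuousLinearMap.snd ℝ ℝ (EuclideanSpace ℝ (Fin 2))).comp
          (ContinuousLinearMap.snd ℝ ℝ (ℝ × EuclideanSpace ℝ (Fin 2))))) :=
  (mdifferentiableAt_sphere_val p.2.2).hasMFDerivAt.comp p
    ((hasMFDerivAt_snd p.2).comp p (hasMFDerivAt_snd p))

theorem diffU_timeVector (p : DoubleNull) : diffU p (timeVector p) = 1 := by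
  unfold diffU
  rw [(hasMFDerivAt_u p).mfderiv]
  rfl

theorem diffV_timeVector (p : DoubleNull) : diffV p (timeVector p) = 1 := by
  unfold diffV
  rw [(hasMFDerivAt_v p).mfderiv]
  rfl

theorem diffSphere_timeVector (p : DoubleNull) : diffSphere p (timeVector p) = 0 := by
  unfold diffSphere
  rw [(hasMFDerivAt_sphere p).mfderiv]
  exact map_zero (mfderiv (𝓡 2) 𝓘(ℝ, EuclideanSpace ℝ (Fin 3))
        ((↑) : UnitSphere → EuclideanSpace ℝ (Fin 3)) p.2.2)

theorem doubleNullMetric_apply (Ω r : ℝ → ℝ → ℝ) (p : DoubleNull)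
    (X Y : TangentSpace DoubleNullModel p) :
    doubleNullMetric Ω r p X Y = -(Ω p.1 p.2.1 ^ 2 / 2) *
      (diffU p X * diffV p Y + diffV p X * diffU p Y) +
      r p.1 p.2.1 ^ 2 * inner ℝ (diffSphere p X) (diffSphere p Y) := by
  simp [doubleNullMetric, roundMetric]
  ring

/-- A point of `(-∞, 0)` from a negative real number. -/
def negPoint (t : ℝ) : NegLine := if h : t < 0 then ⟨t, h⟩ else ⟨-1, by simp⟩

theorem coe_negPoint {t : ℝ} (h : t < 0) : (negPoint t : ℝ) = t := by simp [negPoint, h]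

theorem contMDiffAt_negPoint {t : ℝ} (h : t < 0) :
    ContMDiffAt 𝓘(ℝ, ℝ) 𝓘(ℝ, ℝ) ∞ negPoint t := by
  rw [← ContMDiffAt.subtypeVal_comp_iff]
  refine contMDiffAt_id.congr_of_eventuallyEq ?_
  filter_upwards [Iio_mem_nhds h] with s hs using coe_negPoint hs

/-- The radial projection of `ℝ³ \ {0}` to the sphere. -/
def spherePoint (x : EuclideanSpace ℝ (Fin 3)) : UnitSphere :=
  if h : x = 0 then ⟨EuclideanSpace.single 0 1, by simp⟩
  else ⟨‖x‖⁻¹ • x, by simp [norm_smul, h]⟩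

theorem coe_spherePoint {x : EuclideanSpace ℝ (Fin 3)} (h : x ≠ 0) :
    (spherePoint x : EuclideanSpace ℝ (Fin 3)) = ‖x‖⁻¹ • x := by simp [spherePoint, h]

theorem contMDiffAt_spherePoint {x : EuclideanSpace ℝ (Fin 3)} (h : x ≠ 0) :
    ContMDiffAt 𝓘(ℝ, EuclideanSpace ℝ (Fin 3)) (𝓡 2) ∞ spherePoint x := by
  let U : TopologicalSpace.Opens (EuclideanSpace ℝ (Fin 3)) := ⟨{0}ᶜ, isOpen_compl_singleton⟩
  have hx : x ∈ U := h
  rw [← contMDiffAt_subtype_iff (U := U) (x := ⟨x, hx⟩)]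
  have hf : ContMDiff 𝓘(ℝ, EuclideanSpace ℝ (Fin 3)) 𝓘(ℝ, EuclideanSpace ℝ (Fin 3)) ∞
      (fun y : U => ‖(y : EuclideanSpace ℝ (Fin 3))‖⁻¹ • (y : EuclideanSpace ℝ (Fin 3))) := by
    intro y
    have hy : (y : EuclideanSpace ℝ (Fin 3)) ≠ 0 := y.2
    refine contMDiffAt_subtype_iff (U := U)
      (f := fun y : EuclideanSpace ℝ (Fin 3) => ‖y‖⁻¹ • y) |>.2 ?_
    refine ContDiffAt.contMDiffAt ?_
    exact ((contDiffAt_norm ℝ hy).inv (norm_ne_zero_iff.2 hy)).smul contDiffAt_id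
  have : Fact (Module.finrank ℝ (EuclideanSpace ℝ (Fin 3)) = 2 + 1) := ⟨by simp⟩
  have hs := hf.codRestrict_sphere (n := 2) (fun y => by
    have hy : (y : EuclideanSpace ℝ (Fin 3)) ≠ 0 := y.2
    simp [norm_smul, hy])
  refine (hs ⟨x, hx⟩).congr_of_eventuallyEq (Eventually.of_forall fun y => ?_)
  have hy : (y : EuclideanSpace ℝ (Fin 3)) ≠ 0 := y.2
  exact Subtype.ext (coe_spherePoint hy)

/-- The projection of the cone to the double null spacetime. -/
def conePoint (x : ConeSpace) : DoubleNull := (negPoint x.1, negPoint x.2.1, spherePoint x.2.2)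

theorem contMDiffAt_conePoint {x : ConeSpace} (hx : x ∈ coneDomain) :
    ContMDiffAt 𝓘(ℝ, ConeSpace) DoubleNullModel ∞ conePoint x := by
  have h1 : ContMDiffAt 𝓘(ℝ, ConeSpace) 𝓘(ℝ, ℝ) ∞ (fun x : ConeSpace => x.1) x :=
    contDiff_fst.contDiffAt.contMDiffAt
  have h2 : ContMDiffAt 𝓘(ℝ, ConeSpace) 𝓘(ℝ, ℝ) ∞ (fun x : ConeSpace => x.2.1) x :=
    (contDiff_fst.comp contDiff_snd).contDiffAt.contMDiffAt
  have h3 : ContMDiffAt 𝓘(ℝ, ConeSpace) 𝓘(ℝ, EuclideanSpace ℝ (Fin 3)) ∞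
    (fun x : ConeSpace => x.2.2) x := (contDiff_snd.comp contDiff_snd).contDiffAt.contMDiffAt
  exact ((contMDiffAt_negPoint hx.1).comp x h1).prodMk
    (((contMDiffAt_negPoint hx.2.1).comp x h2).prodMk ((contMDiffAt_spherePoint hx.2.2).comp x h3))

theorem conePoint_val (p : DoubleNull) :
    conePoint ((p.1 : ℝ), (p.2.1 : ℝ), (p.2.2 : EuclideanSpace ℝ (Fin 3))) = p := by
  have h1 : ((p.1 : NegLine) : ℝ) < 0 := p.1.2
  have h2 : ((p.2.1 : NegLine) : ℝ) < 0 := p.2.1.2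
  have h3 : ‖(p.2.2 : EuclideanSpace ℝ (Fin 3))‖ = 1 := by simp
  have h4 : (p.2.2 : EuclideanSpace ℝ (Fin 3)) ≠ 0 := by
    intro h; rw [h] at h3; simp at h3
  refine Prod.ext (Subtype.ext (coe_negPoint h1)) (Prod.ext (Subtype.ext (coe_negPoint h2))
    (Subtype.ext ?_))
  refine (coe_spherePoint h4).trans ?_
  rw [h3]; simp

theorem mem_coneDomain_val (p : DoubleNull) :
    ((p.1 : ℝ), (p.2.1 : ℝ), (p.2.2 : EuclideanSpace ℝ (Fin 3))) ∈ coneDomain := by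
  refine ⟨p.1.2, p.2.1.2, fun h => ?_⟩
  have h3 : ‖(p.2.2 : EuclideanSpace ℝ (Fin 3))‖ = 1 := by simp
  simp only at h
  rw [h] at h3
  simp at h3

theorem hasFDerivAt_normalize {x : EuclideanSpace ℝ (Fin 3)} (hx : x ≠ 0) :
    ∃ D : EuclideanSpace ℝ (Fin 3) →L[ℝ] EuclideanSpace ℝ (Fin 3),
      HasFDerivAt (fun y : EuclideanSpace ℝ (Fin 3) => ‖y‖⁻¹ • y) D x ∧
      ∀ a, D a = ‖x‖⁻¹ • a - (‖x‖⁻¹ ^ 3 * inner ℝ x a) • x := by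
  have hx0 : ‖x‖ ≠ 0 := norm_ne_zero_iff.2 hx
  have hn : HasFDerivAt (fun y : EuclideanSpace ℝ (Fin 3) => √(‖y‖ ^ 2)) _ x :=
    ((hasStrictFDerivAt_norm_sq x).hasFDerivAt).sqrt (by positivity)
  simp only [Real.sqrt_sq (norm_nonneg _)] at hn
  refine ⟨_, (((hasDerivAt_inv hx0).comp_hasFDerivAt x hn)).smul (hasFDerivAt_id x), fun a => ?_⟩
  simp [smul_smul]
  rw [sub_eq_add_neg, ← neg_smul, ← neg_smul]
  congr 2
  field_simp

/-- The derivative of `x / ‖x‖` is the orthogonal projection off `x`, divided by `‖x‖`; its Gram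
form is `coneRound`. -/
theorem coneMetric_eq (Ω r : ℝ → ℝ → ℝ) {x : ConeSpace} (hx : x ∈ coneDomain) (z w : ConeSpace) :
    doubleNullMetric Ω r (conePoint x)
      (mfderiv 𝓘(ℝ, ConeSpace) DoubleNullModel conePoint x z)
      (mfderiv 𝓘(ℝ, ConeSpace) DoubleNullModel conePoint x w) =
    coneMetric (fun u v => Ω u v ^ 2) (fun u v => r u v ^ 2) x z w := by
  have hd := ((contMDiffAt_conePoint hx).mdifferentiableAt (by simp))
  have hdom := isOpen_coneDomain.mem_nhds hx
  have hU : ∀ z, diffU (conePoint x) (mfderiv 𝓘(ℝ, ConeSpace) DoubleNullModel conePoint x z)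
      = z.1 := by
    intro z
    have h1 := (hasMFDerivAt_u (conePoint x)).mdifferentiableAt
    have h2 := mfderiv_comp_apply x h1 hd z
    refine h2.symm.trans ?_
    rw [mfderiv_eq_fderiv]
    have : ((fun x : DoubleNull => (x.1 : ℝ)) ∘ conePoint) =ᶠ[𝓝 x] fun x => x.1 := by
      filter_upwards [hdom] with y hy using coe_negPoint hy.1
    rw [this.fderiv_eq, fderiv_fst]
    rfl
  have hV : ∀ z, diffV (conePoint x) (mfderiv 𝓘(ℝ, ConeSpace) DoubleNullModel conePoint x z)
      = z.2.1 := by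
    intro z
    have h1 := (hasMFDerivAt_v (conePoint x)).mdifferentiableAt
    have h2 := mfderiv_comp_apply x h1 hd z
    refine h2.symm.trans ?_
    rw [mfderiv_eq_fderiv]
    have : ((fun x : DoubleNull => (x.2.1 : ℝ)) ∘ conePoint) =ᶠ[𝓝 x] fun x => x.2.1 := by
      filter_upwards [hdom] with y hy using coe_negPoint hy.2.1
    rw [this.fderiv_eq]
    have h3 : HasFDerivAt (fun x : ConeSpace => x.2.1)
      ((ContinuousLinearMap.fst ℝ ℝ (EuclideanSpace ℝ (Fin 3))).comp
        (ContinuousLinearMap.snd ℝ ℝ (ℝ × EuclideanSpace ℝ (Fin 3)))) x :=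
      ((ContinuousLinearMap.fst ℝ ℝ (EuclideanSpace ℝ (Fin 3))).comp
        (ContinuousLinearMap.snd ℝ ℝ (ℝ × EuclideanSpace ℝ (Fin 3)))).hasFDerivAt
    rw [h3.fderiv]
    rfl
  obtain ⟨D, hD, hDa⟩ := hasFDerivAt_normalize hx.2.2
  have hS : ∀ z, diffSphere (conePoint x) (mfderiv 𝓘(ℝ, ConeSpace) DoubleNullModel conePoint x z)
      = D z.2.2 := by
    intro z
    have h1 := (hasMFDerivAt_sphere (conePoint x)).mdifferentiableAt
    have h2 := mfderiv_comp_apply x h1 hd z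
    refine h2.symm.trans ?_
    rw [mfderiv_eq_fderiv]
    have : ((fun x : DoubleNull => (x.2.2 : EuclideanSpace ℝ (Fin 3))) ∘ conePoint) =ᶠ[𝓝 x]
        fun x => ‖x.2.2‖⁻¹ • x.2.2 := by
      filter_upwards [hdom] with y hy using coe_spherePoint hy.2.2
    rw [this.fderiv_eq]
    have h3 : HasFDerivAt (fun x : ConeSpace => x.2.2)
      ((ContinuousLinearMap.snd ℝ ℝ (EuclideanSpace ℝ (Fin 3))).comp
        (ContinuousLinearMap.snd ℝ ℝ (ℝ × EuclideanSpace ℝ (Fin 3)))) x :=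
      ((ContinuousLinearMap.snd ℝ ℝ (EuclideanSpace ℝ (Fin 3))).comp
        (ContinuousLinearMap.snd ℝ ℝ (ℝ × EuclideanSpace ℝ (Fin 3)))).hasFDerivAt
    exact DFunLike.congr_fun (hD.comp x h3).fderiv z
  have c1 : ((conePoint x).1 : ℝ) = x.1 := coe_negPoint hx.1
  have c2 : ((conePoint x).2.1 : ℝ) = x.2.1 := coe_negPoint hx.2.1
  refine (doubleNullMetric_apply Ω r _ _ _).trans ?_
  rw [c1, c2, hU z, hV z, hS z, hU w, hV w, hS w]
  simp only [coneMetric, coneRound, hDa, inner_sub_left, inner_sub_right, inner_smul_left,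
    inner_smul_right, real_inner_self_eq_norm_sq, real_inner_comm x.2.2 z.2.2]
  have hx0 : ‖x.2.2‖ ≠ 0 := norm_ne_zero_iff.2 hx.2.2
  simp
  field_simp
  ring_nf
  simp

/-! ### Quantitative Lorentzian linear algebra -/

theorem IsLorentzForm.symm {V : Type*} [AddCommGroup V] [Module ℝ V] {d : ℕ}
    {B : LinearMap.BilinForm ℝ V} (hB : IsLorentzForm d B) (x y : V) : B x y = B y x := by
  obtain ⟨b, hb⟩ := hB
  have : B = B.flip := by
    refine b.ext fun i => b.ext fun j => ?_
    refine (hb i j).trans (Eq.trans ?_ (hb j i).symm)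
    rcases eq_or_ne i j with h | h
    · simp [h]
    · simp [h, h.symm]
  conv_lhs => rw [this]
  rfl

theorem IsLorentzForm.apply_eq {V : Type*} [AddCommGroup V] [Module ℝ V] {d : ℕ}
    {B : LinearMap.BilinForm ℝ V} {b : Module.Basis (Fin (d + 1)) ℝ V}
    (hb : ∀ i j, B (b i) (b j) = if i = j then (if i = 0 then -1 else 1) else 0) (x y : V) :
    B x y = ∑ i, b.repr x i * b.repr y i - 2 * (b.repr x 0 * b.repr y 0) := by
  conv_lhs => rw [← b.sum_repr x, ← b.sum_repr y]
  simp only [map_sum, LinearMap.sum_apply, map_smul, LinearMap.smul_apply, hb, smul_eq_mul,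
    mul_ite, mul_zero, mul_neg, mul_one]
  have : ∀ i : Fin (d + 1), (if i = 0 then -(b.repr y i * b.repr x i) else b.repr y i * b.repr x i)
      = b.repr x i * b.repr y i - if i = 0 then 2 * (b.repr x i * b.repr y i) else 0 := by
    intro i
    split_ifs <;> ring
  simp [Finset.sum_sub_distrib, this, mul_ite]

/-- In an orthonormal basis take `τ` to be the time coordinate: a causal vector has Euclidean square
at most `2 τ²`. Both this and nondegeneracy persist, with worse constants, for nearby forms, and
nearby forms need not be symmetric. -/
theorem IsLorentzForm.eventually_estimates {E : Type*} [NormedAddCommGroup E] [NormedSpace ℝ E]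
    [FiniteDimensional ℝ E] {d : ℕ} {B : E →L[ℝ] E →L[ℝ] ℝ} {B' : LinearMap.BilinForm ℝ E}
    (hB' : IsLorentzForm d B') (hBB' : ∀ x y, B x y = B' x y) :
    ∃ τ : E →L[ℝ] ℝ, ∃ C > 0, ∀ᶠ A in 𝓝 B, (∀ V, ‖V‖ ≤ C * ‖A V‖) ∧ ‖A‖ ≤ C ∧
      ∀ V, A V V ≤ 0 → ‖V‖ ≤ C * |τ V| := by
  obtain ⟨b, hb⟩ := hB'
  have hform : ∀ x y, B x y = ∑ i, b.repr x i * b.repr y i - 2 * (b.repr x 0 * b.repr y 0) :=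
    fun x y => (hBB' x y).trans (IsLorentzForm.apply_eq hb x y)
  have hK : ∃ K > 0, ∀ x, ‖x‖ ^ 2 ≤ K * ∑ i, b.repr x i ^ 2 := by
    refine ⟨(∑ i, ‖b i‖ ^ 2) + 1, by positivity, fun x => ?_⟩
    have h1 : ‖x‖ ≤ ∑ i, |b.repr x i| * ‖b i‖ := by
      conv_lhs => rw [← b.sum_repr x]
      refine (norm_sum_le _ _).trans (le_of_eq ?_)
      simp [norm_smul]
    have h2 := Finset.sum_mul_sq_le_sq_mul_sq Finset.univ (fun i => |b.repr x i|) (fun i => ‖b i‖)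
    have h3 : ‖x‖ ^ 2 ≤ (∑ i, |b.repr x i| * ‖b i‖) ^ 2 := by gcongr
    simp only [sq_abs] at h2
    have h4 : 0 ≤ ∑ i, b.repr x i ^ 2 := by positivity
    linarith [h2, h3]
  obtain ⟨K, hK0, hK⟩ := hK
  let τ : E →L[ℝ] ℝ := LinearMap.toContinuousLinearMap (b.coord 0)
  have hτ : ∀ x, τ x = b.repr x 0 := fun x => rfl
  have hnd : ∀ V, ‖V‖ ≤ K * ‖B V‖ := by
    intro V
    set S := ∑ i, b.repr V i ^ 2 with hS
    have hS0 : 0 ≤ S := by positivity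
    -- Reflecting the time component makes the pairing with `V` equal to the Euclidean square `S`.
    set W := V - (2 * b.repr V 0) • b 0 with hW
    have hrW : ∀ i, b.repr W i = if i = 0 then -b.repr V i else b.repr V i := by
      intro i
      rw [hW, map_sub, map_smul, Module.Basis.repr_self, Finsupp.sub_apply, Finsupp.smul_apply]
      split_ifs with h
      · subst h; simp; ring
      · simp [Ne.symm h]
    have hSW : ∑ i, b.repr W i ^ 2 = S := by
      refine Finset.sum_congr rfl fun i _ => ?_
      rw [hrW]; split_ifs <;> ring
    have hBW : B V W = S := by
      rw [hform, hS]
      have : ∀ i, b.repr V i * b.repr W i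
          = b.repr V i ^ 2 - if i = 0 then 2 * b.repr V i ^ 2 else 0 := by
        intro i
        rw [hrW]; split_ifs <;> ring
      simp only [Finset.sum_sub_distrib, this]
      simp
      ring
    have h1 : ‖W‖ ^ 2 ≤ K * S := hSW ▸ hK W
    have h2 : ‖V‖ ^ 2 ≤ K * S := hK V
    have h3 : S ≤ ‖B V‖ * ‖W‖ := by
      rw [← hBW]; exact (le_abs_self _).trans ((B V).le_opNorm W)
    have h4 : max ‖V‖ ‖W‖ ^ 2 ≤ K * S := by
      rcases max_choice ‖V‖ ‖W‖ with h | h <;> rw [h] <;> assumption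
    rcases (le_max_of_le_left (norm_nonneg V) : 0 ≤ max ‖V‖ ‖W‖).eq_or_lt with h | h
    · exact (le_max_left _ _).trans (h.symm.le.trans (by positivity))
    · refine (le_max_left _ ‖W‖).trans ?_
      refine le_of_mul_le_mul_right ?_ h
      calc max ‖V‖ ‖W‖ * max ‖V‖ ‖W‖ = max ‖V‖ ‖W‖ ^ 2 := by ring
        _ ≤ K * S := h4
        _ ≤ K * (‖B V‖ * ‖W‖) := by gcongr
        _ ≤ K * (‖B V‖ * max ‖V‖ ‖W‖) := by gcongr; exact le_max_right _ _
        _ = _ := by ring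
  refine ⟨τ, 2 * K + 2 * √K + ‖B‖ + 1, by positivity, ?_⟩
  -- The radius `1 / (2K)` lets the perturbation be absorbed into half of the main term; `1` bounds
  -- the norm.
  have hδ : 0 < min 1 (1 / (2 * K)) := by positivity
  filter_upwards [Metric.ball_mem_nhds B hδ] with A hA
  replace hA := lt_min_iff.1 ((mem_ball_iff_norm (E := E →L[ℝ] E →L[ℝ] ℝ)).1 hA)
  have hAK : K * ‖A - B‖ ≤ 1 / 2 := by
    have := mul_le_mul_of_nonneg_left hA.2.le hK0.le
    refine this.trans (le_of_eq ?_)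
    field_simp
  refine ⟨fun V => ?_, ?_, fun V hV => ?_⟩
  · have h1 : ‖B V‖ ≤ ‖A V‖ + ‖A - B‖ * ‖V‖ := by
      have : B V = A V - (A - B) V := by simp
      rw [this]
      exact (norm_sub_le _ _).trans (by gcongr; exact (A - B).le_opNorm V)
    have h2 : ‖V‖ ≤ K * ‖A V‖ + (K * ‖A - B‖) * ‖V‖ := by
      calc ‖V‖ ≤ K * ‖B V‖ := hnd V
        _ ≤ K * (‖A V‖ + ‖A - B‖ * ‖V‖) := by gcongr
        _ = _ := by ring
    have h3 : (K * ‖A - B‖) * ‖V‖ ≤ 1 / 2 * ‖V‖ := by gcongr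
    have h4 : 0 ≤ (2 * √K + ‖B‖ + 1) * ‖A V‖ := by positivity
    nlinarith
  · have h1 : ‖A‖ - ‖B‖ ≤ ‖A - B‖ := norm_sub_norm_le (E := E →L[ℝ] E →L[ℝ] ℝ) A B
    have h2 : 0 ≤ 2 * K + 2 * √K := by positivity
    linarith [hA.1]
  · set S := ∑ i, b.repr V i ^ 2 with hS
    have h1 : B V V = S - 2 * τ V ^ 2 := by
      rw [hform, hτ, hS]
      simp only [sq]
    have h2 : |(A - B) V V| ≤ ‖A - B‖ * ‖V‖ * ‖V‖ := (A - B).le_opNorm₂ V V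
    have h3 : (A - B) V V = A V V - B V V := rfl
    have h4 : ‖A - B‖ * ‖V‖ ^ 2 ≤ S / 2 := by
      have : ‖A - B‖ * ‖V‖ ^ 2 ≤ ‖A - B‖ * (K * S) := by gcongr; exact hK V
      have hS0 : 0 ≤ S := by positivity
      nlinarith
    have h5 : S ≤ 4 * τ V ^ 2 := by
      have := neg_le_of_abs_le h2
      nlinarith
    have h6 : ‖V‖ ^ 2 ≤ (2 * √K * |τ V|) ^ 2 := by
      rw [mul_pow, mul_pow, Real.sq_sqrt hK0.le, sq_abs]
      calc ‖V‖ ^ 2 ≤ K * S := hK V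
        _ ≤ K * (4 * τ V ^ 2) := by gcongr
        _ = _ := by ring
    have h7 := abs_le_of_sq_le_sq h6 (by positivity)
    have h8 : 0 ≤ (2 * K + ‖B‖ + 1) * |τ V| := by positivity
    have := le_of_abs_le h7
    nlinarith

/-! ### The metric in a chart -/

section ChartMetric

variable {d : ℕ} {N : Type*} [TopologicalSpace N] [ChartedSpace (EuclideanSpace ℝ (Fin d)) N]

/-- The metric in the coordinates of a chart, as a field of continuous bilinear forms. -/
def chartMetric (g : BilinField (𝓡 d) N)
    (φ : OpenPartialHomeomorph N (EuclideanSpace ℝ (Fin d))) (x : EuclideanSpace ℝ (Fin d)) :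
    EuclideanSpace ℝ (Fin d) →L[ℝ] EuclideanSpace ℝ (Fin d) →L[ℝ] ℝ :=
  ∑ μ, ∑ ν, metricComponent g φ μ ν x •
    (EuclideanSpace.proj (𝕜 := ℝ) μ).smulRight (EuclideanSpace.proj (𝕜 := ℝ) ν)

/-- The pullback of the metric at `φ⁻¹ x` to the coordinate space of the chart `φ`. -/
def pullbackForm (g : BilinField (𝓡 d) N)
    (φ : OpenPartialHomeomorph N (EuclideanSpace ℝ (Fin d))) (x : EuclideanSpace ℝ (Fin d)) :
    LinearMap.BilinForm ℝ (EuclideanSpace ℝ (Fin d)) :=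
  LinearMap.compl₁₂ (g (φ.symm x)) (mfderiv (𝓡 d) (𝓡 d) φ.symm x).toLinearMap
    (mfderiv (𝓡 d) (𝓡 d) φ.symm x).toLinearMap

theorem chartMetric_apply (g : BilinField (𝓡 d) N)
    (φ : OpenPartialHomeomorph N (EuclideanSpace ℝ (Fin d))) (x V W : EuclideanSpace ℝ (Fin d)) :
    chartMetric g φ x V W = pullbackForm g φ x V W := by
  have h : ∀ V : EuclideanSpace ℝ (Fin d), V = ∑ μ, V μ • EuclideanSpace.single μ (1 : ℝ) := by
    intro V
    ext i
    simp [Finset.sum_apply, Pi.single_apply]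
  conv_rhs => rw [h V, h W]
  simp only [map_sum, LinearMap.sum_apply, map_smul, LinearMap.smul_apply, smul_eq_mul]
  rw [chartMetric]
  simp only [sum_apply, smul_apply,
    ContinuousLinearMap.smulRight_apply, smul_eq_mul]
  rw [Finset.sum_comm]
  refine Finset.sum_congr rfl fun ν _ => ?_
  rw [Finset.mul_sum]
  refine Finset.sum_congr rfl fun μ _ => ?_
  have : pullbackForm g φ x (EuclideanSpace.single μ (1 : ℝ)) (EuclideanSpace.single ν (1 : ℝ))
    = metricComponent g φ μ ν x := rfl
  rw [this, EuclideanSpace.proj, EuclideanSpace.proj]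
  simp only [PiLp.proj_apply]
  ring

theorem lipschitz_chartMetric {g : BilinField (𝓡 d) N} (hg : IsLocLipschitzField g)
    {φ : OpenPartialHomeomorph N (EuclideanSpace ℝ (Fin d))}
    (hφ : φ ∈ IsManifold.maximalAtlas (𝓡 d) ∞ N) {K : Set (EuclideanSpace ℝ (Fin d))}
    (hK : K ⊆ φ.target) (hKc : IsCompact K) :
    ∃ Λ ≥ 0, ∀ x ∈ K, ∀ y ∈ K, ‖chartMetric g φ x - chartMetric g φ y‖ ≤ Λ * ‖x - y‖ := by
  choose Λ hΛ using hg φ hφ K hK hKc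
  refine ⟨∑ μ, ∑ ν, (Λ μ ν : ℝ) * ‖(EuclideanSpace.proj (𝕜 := ℝ) μ).smulRight
    (EuclideanSpace.proj (𝕜 := ℝ) (ι := Fin d) ν)‖, by positivity, fun x hx y hy => ?_⟩
  have hsub : chartMetric g φ x - chartMetric g φ y = ∑ μ, ∑ ν,
      (metricComponent g φ μ ν x - metricComponent g φ μ ν y) •
        (EuclideanSpace.proj (𝕜 := ℝ) μ).smulRight (EuclideanSpace.proj (𝕜 := ℝ) ν) := by
    ext V W
    simp [chartMetric, sub_mul, Finset.sum_sub_distrib]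
  rw [hsub, Finset.sum_mul]
  refine (norm_sum_le (E := EuclideanSpace ℝ (Fin d) →L[ℝ] EuclideanSpace ℝ (Fin d) →L[ℝ] ℝ)
    _ _).trans (Finset.sum_le_sum fun μ _ => ?_)
  rw [Finset.sum_mul]
  refine (norm_sum_le (E := EuclideanSpace ℝ (Fin d) →L[ℝ] EuclideanSpace ℝ (Fin d) →L[ℝ] ℝ)
    _ _).trans (Finset.sum_le_sum fun ν _ => ?_)
  refine (ContinuousLinearMap.opNorm_smul_le _ _).trans ?_
  rw [mul_right_comm]
  gcongr
  exact (hΛ μ ν).norm_sub_le hx hy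

theorem isLorentzForm_pullbackForm {d : ℕ} {N : Type*} [TopologicalSpace N]
    [ChartedSpace (EuclideanSpace ℝ (Fin (d + 1))) N] {g : BilinField (𝓡 (d + 1)) N}
    (hg : ∀ q, IsLorentzForm d (g q))
    {φ : OpenPartialHomeomorph N (EuclideanSpace ℝ (Fin (d + 1)))}
    (hφ : φ.MDifferentiable (𝓡 (d + 1)) (𝓡 (d + 1))) {x : EuclideanSpace ℝ (Fin (d + 1))}
    (hx : x ∈ φ.target) : IsLorentzForm d (pullbackForm g φ x) := by
  obtain ⟨b, hb⟩ := hg (φ.symm x)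
  let e := hφ.symm.mfderiv (x := x) hx
  refine ⟨b.map e.symm.toLinearEquiv, fun i j => ?_⟩
  rw [← hb i j]
  have h : ∀ i, mfderiv (𝓡 (d + 1)) (𝓡 (d + 1)) φ.symm x (b.map e.symm.toLinearEquiv i) = b i :=
    fun i => e.apply_symm_apply (b i)
  exact congr_arg₂ (fun X Y => g (φ.symm x) X Y) (h i) (h j)

end ChartMetric

/-! ### Construction of the boundary chart and bounds on the coefficients -/

/-- The radius is small enough for the closed ball to lie in the chart and for the metric,
continuous because Lipschitz, to stay where the Lorentzian estimates at `q` hold. -/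
theorem exists_boundaryChart {Ω r : ℝ → ℝ → ℝ} {d : ℕ} {N : Type*} [TopologicalSpace N]
    [T2Space N] [ChartedSpace (EuclideanSpace ℝ (Fin (d + 1))) N] [IsManifold (𝓡 (d + 1)) ∞ N]
    {g' : BilinField (𝓡 (d + 1)) N} {ι : DoubleNull → N}
    (hι : IsLocLipExtension DoubleNullModel (doubleNullMetric Ω r) g' ι) (q : N) :
    ∃ G τ ρ Λ C, 0 < ρ ∧ BoundaryChart (fun u v => Ω u v ^ 2) (fun u v => r u v ^ 2)
      (fun x => chartAt (EuclideanSpace ℝ (Fin (d + 1))) q (ι (conePoint x)))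
      {x ∈ coneDomain | ι (conePoint x) ∈ (chartAt (EuclideanSpace ℝ (Fin (d + 1))) q).source} G τ
      (chartAt (EuclideanSpace ℝ (Fin (d + 1))) q q) ρ Λ C := by
  set φ := chartAt (EuclideanSpace ℝ (Fin (d + 1))) q with hφdef
  have hφ : φ ∈ IsManifold.maximalAtlas (𝓡 (d + 1)) ∞ N := IsManifold.chart_mem_maximalAtlas q
  have : IsManifold (𝓡 (d + 1)) 1 N := IsManifold.of_le (n := ∞) (by simp)
  have hφd : φ.MDifferentiable (𝓡 (d + 1)) (𝓡 (d + 1)) := mdifferentiable_chart q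
  have hq : φ q ∈ φ.target := φ.map_source (mem_chart_source _ q)
  have hιs : ContMDiff DoubleNullModel (𝓡 (d + 1)) ∞ ι := hι.smoothEmbedding.contMDiff
  obtain ⟨ρ₀, hρ₀, hball⟩ := Metric.nhds_basis_closedBall.mem_iff.1 (φ.open_target.mem_nhds hq)
  obtain ⟨Λ, hΛ, hLip⟩ := lipschitz_chartMetric hι.locLipschitz hφ hball
    (isCompact_closedBall (φ q) ρ₀)
  obtain ⟨τ, C, hC, hev⟩ := (isLorentzForm_pullbackForm hι.lorentzian hφd hq).eventually_estimates
    (chartMetric_apply g' φ (φ q))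
  have hcont : ContinuousAt (chartMetric g' φ) (φ q) := by
    have : LipschitzOnWith ⟨Λ, hΛ⟩ (chartMetric g' φ) (Metric.closedBall (φ q) ρ₀) :=
      LipschitzOnWith.of_dist_le_mul fun x hx y hy => by
        rw [dist_eq_norm x y]
        exact (dist_eq_norm (E := EuclideanSpace ℝ (Fin (d + 1)) →L[ℝ]
          EuclideanSpace ℝ (Fin (d + 1)) →L[ℝ] ℝ) _ _).le.trans (hLip x hx y hy)
    exact this.continuousOn.continuousAt (Metric.closedBall_mem_nhds _ hρ₀)
  obtain ⟨ρ₁, hρ₁, hball₁⟩ := Metric.nhds_basis_closedBall.mem_iff.1 (hcont.eventually hev)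
  have hb₀ : Metric.closedBall (φ q) (min ρ₀ ρ₁) ⊆ Metric.closedBall (φ q) ρ₀ :=
    Metric.closedBall_subset_closedBall (min_le_left _ _)
  have hb₁ : Metric.closedBall (φ q) (min ρ₀ ρ₁) ⊆ Metric.closedBall (φ q) ρ₁ :=
    Metric.closedBall_subset_closedBall (min_le_right _ _)
  have hfs : ∀ x ∈ coneDomain, ContMDiffAt 𝓘(ℝ, ConeSpace) (𝓡 (d + 1)) ∞
      (fun x => ι (conePoint x)) x := fun x hx =>
    (hιs (conePoint x)).comp x (contMDiffAt_conePoint hx)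
  have hO : IsOpen {x ∈ coneDomain | ι (conePoint x) ∈ φ.source} := by
    have hc : ContinuousOn (fun x => ι (conePoint x)) coneDomain := fun x hx =>
      (hfs x hx).continuousAt.continuousWithinAt
    exact hc.isOpen_inter_preimage isOpen_coneDomain φ.open_source
  have hYs : ∀ x ∈ coneDomain, ι (conePoint x) ∈ φ.source →
      ContDiffAt ℝ ∞ (fun x => φ (ι (conePoint x))) x := fun x hx hx' =>
    ((contMDiffAt_of_mem_maximalAtlas hφ hx').comp x (hfs x hx)).contDiffAt
  refine ⟨chartMetric g' φ, τ, min ρ₀ ρ₁, Λ, C, lt_min hρ₀ hρ₁, ?_⟩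
  exact
  { finrank_eq := by
      have := hι.same_dim
      simp at this
      simp [← this]
    isOpen := hO
    subset := fun x hx => hx.1
    smooth := fun x hx => (hYs x hx.1 hx.2).contDiffWithinAt
    closed := by
      intro x hx hxc
      -- The preimage of the closed ball in `N` is compact, hence closed as `N` is Hausdorff; a
      -- limit in the cone domain therefore cannot leave the chart.
      have hK : IsCompact (φ.symm '' Metric.closedBall (φ q) (min ρ₀ ρ₁)) :=
        (isCompact_closedBall _ _).image_of_continuousOn
          (φ.continuousOn_symm.mono (hb₀.trans hball))
      have h1 := ((hfs x hx).continuousAt.continuousWithinAt (s := {p ∈ {x ∈ coneDomain |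
        ι (conePoint x) ∈ φ.source} | φ (ι (conePoint p)) ∈
          Metric.closedBall (φ q) (min ρ₀ ρ₁)})).mem_closure_image hxc
      have h2 := closure_minimal (t := φ.symm '' Metric.closedBall (φ q) (min ρ₀ ρ₁))
        (by
          rintro _ ⟨p, hp, rfl⟩
          exact ⟨_, hp.2, φ.left_inv hp.1.2⟩) hK.isClosed h1
      obtain ⟨y, hy, hyx⟩ := h2
      exact ⟨hx, hyx ▸ φ.map_target (hball (hb₀ hy))⟩
    isometric := by
      intro x hx z w
      have hY := (hYs x hx.1 hx.2).differentiableAt (by simp)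
      have hsymm := hφd.symm.mdifferentiableAt (x := φ (ι (conePoint x))) (φ.map_source hx.2)
      have hev : (φ.symm ∘ fun x => φ (ι (conePoint x))) =ᶠ[𝓝 x] fun x => ι (conePoint x) := by
        filter_upwards [hO.mem_nhds hx] with y hy using φ.left_inv hy.2
      have key : ∀ z : ConeSpace, mfderiv (𝓡 (d + 1)) (𝓡 (d + 1)) φ.symm (φ (ι (conePoint x)))
          (fderiv ℝ (fun x => φ (ι (conePoint x))) x z) =
          mfderiv DoubleNullModel (𝓡 (d + 1)) ι (conePoint x)
            (mfderiv 𝓘(ℝ, ConeSpace) DoubleNullModel conePoint x z) := by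
        intro z
        have e1 := mfderiv_comp_apply x hsymm hY.mdifferentiableAt z
        have e2 := mfderiv_comp_apply x ((hιs (conePoint x)).mdifferentiableAt (by simp))
          ((contMDiffAt_conePoint hx.1).mdifferentiableAt (by simp)) z
        rw [mfderiv_eq_fderiv] at e1
        refine e1.symm.trans (Eq.trans ?_ e2)
        exact DFunLike.congr_fun (hev.mfderiv_eq (I := 𝓘(ℝ, ConeSpace)) (I' := 𝓡 (d + 1))) z
      rw [chartMetric_apply, ← coneMetric_eq Ω r hx.1, ← hι.isometric, ← key, ← key]
      have e : φ.symm (φ (ι (conePoint x))) = ι (conePoint x) := φ.left_inv hx.2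
      -- All tangent spaces are the same model space, so the metric is viewed as a nondependent
      -- function in order to rewrite the base point.
      let gE : N → LinearMap.BilinForm ℝ (EuclideanSpace ℝ (Fin (d + 1))) := g'
      change gE (φ.symm (φ (ι (conePoint x)))) _ _ = gE (ι (conePoint x)) _ _
      rw [e]
      rfl
    Lip_nonneg := hΛ
    lipschitz := fun x hx y hy => hLip x (hb₀ hx) y (hb₀ hy)
    C_pos := hC
    symm := fun y hy V W => by
      rw [chartMetric_apply, chartMetric_apply]
      exact (isLorentzForm_pullbackForm hι.lorentzian hφd (hball (hb₀ hy))).symm V W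
    nondegenerate := fun y hy => (hball₁ (hb₁ hy)).1
    bounded := fun y hy => (hball₁ (hb₁ hy)).2.1
    cone := fun y hy => (hball₁ (hb₁ hy)).2.2 }

theorem IsAdmissibleCoefficient.isBoundedCoefficient {f : ℝ → ℝ → ℝ}
    (hf : IsAdmissibleCoefficient f) : IsBoundedCoefficient f := by
  obtain ⟨F, hF, hFf, hFpos⟩ := hf.extends_pos
  refine ⟨hf.smooth, fun a ha => ?_⟩
  have hK : IsCompact (Icc a 0 ×ˢ Icc a 0) := isCompact_Icc.prod isCompact_Icc
  have hne : (Icc a 0 ×ˢ Icc a 0).Nonempty := ⟨(0, 0), by simp [ha.le]⟩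
  have hFK : ContinuousOn F (Icc a 0 ×ˢ Icc a 0) :=
    hF.mono (prod_mono Icc_subset_Iic_self Icc_subset_Iic_self)
  obtain ⟨p, hp, hmin⟩ := hK.exists_isMinOn hne hFK
  obtain ⟨q, hq, hmax⟩ := hK.exists_isMaxOn hne hFK
  refine ⟨F p, hFpos p.1 hp.1.2 p.2 hp.2.2, F q, fun u hu v hv => ?_⟩
  have huv : (u, v) ∈ Icc a 0 ×ˢ Icc a 0 := ⟨Ico_subset_Icc_self hu, Ico_subset_Icc_self hv⟩
  rw [← hFf u hu.2 v hv.2]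
  exact ⟨hmin huv, hmax huv⟩

namespace IsBoundedCoefficient

variable {r : ℝ → ℝ → ℝ}

theorem sq (hr : IsBoundedCoefficient r) : IsBoundedCoefficient (fun u v => r u v ^ 2) := by
  refine ⟨hr.smooth.pow 2, fun a ha => ?_⟩
  obtain ⟨m, hm, M, h⟩ := hr.bounds a ha
  refine ⟨m ^ 2, by positivity, M ^ 2, fun u hu v hv => ?_⟩
  obtain ⟨h1, h2⟩ := h u hu v hv
  have := hr.pos hu.2 hv.2
  constructor <;> gcongr

theorem hasDerivAt_left (hr : IsBoundedCoefficient r) {u v : ℝ} (hu : u < 0) (hv : v < 0) :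
    HasDerivAt (fun x => r x v) (fderiv ℝ (fun x : ℝ × ℝ => r x.1 x.2) (u, v) (1, 0)) u := by
  have h : HasDerivAt (fun x : ℝ => (x, v)) (1, 0) u :=
    (hasDerivAt_id u).prodMk (hasDerivAt_const u v)
  exact (hr.hasFDerivAt hu hv).comp_hasDerivAt u h

theorem fderiv_sq_apply (hr : IsBoundedCoefficient r) {u v : ℝ} (hu : u < 0) (hv : v < 0)
    (z : ℝ × ℝ) : fderiv ℝ (fun x : ℝ × ℝ => r x.1 x.2 ^ 2) (u, v) z =
      2 * r u v * fderiv ℝ (fun x : ℝ × ℝ => r x.1 x.2) (u, v) z := by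
  rw [((hr.hasFDerivAt hu hv).pow 2).fderiv]
  simp

/-- The divergence passes from `r` to `r²` because `r` is bounded away from zero. -/
theorem tendsto_fderiv_sq (hr : IsBoundedCoefficient r) {u : ℝ} (hu : u < 0)
    (h : Tendsto (fun v => deriv (fun y => r u y) v) (𝓝[<] 0) atBot) :
    Tendsto (fun v => fderiv ℝ (fun x : ℝ × ℝ => r x.1 x.2 ^ 2) (u, v) (0, 1)) (𝓝[<] 0) atBot := by
  obtain ⟨m, hm, M, hb⟩ := hr.bounds u hu
  refine tendsto_atBot_mono' _ ?_ (h.const_mul_atBot (r := 2 * m) (by positivity))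
  filter_upwards [h.eventually_le_atBot 0, Ico_mem_nhdsLT hu] with v hv huv
  have h1 := (hb u ⟨le_rfl, hu⟩ v huv).1
  rw [hr.fderiv_sq_apply hu huv.2, ← (hr.hasDerivAt_right hu huv.2).deriv]
  exact mul_le_mul_of_nonpos_right (by gcongr) hv

theorem eventually_fderiv_sq_nonpos (hr : IsBoundedCoefficient r) {u : ℝ} (hu : u < 0)
    (h : ∃ v₀ < 0, ∀ v ∈ Ico v₀ 0, deriv (fun x => r x v) u < 0) :
    ∀ᶠ v in 𝓝[<] 0, fderiv ℝ (fun x : ℝ × ℝ => r x.1 x.2 ^ 2) (u, v) (1, 0) ≤ 0 := by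
  obtain ⟨v₀, hv₀, h⟩ := h
  filter_upwards [Ico_mem_nhdsLT hv₀] with v hv
  rw [hr.fderiv_sq_apply hu hv.2, ← (hr.hasDerivAt_left hu hv.2).deriv]
  have := hr.pos hu hv.2
  exact mul_nonpos_of_nonneg_of_nonpos (by positivity) (h v hv).le

end IsBoundedCoefficient

/-! ### Gluing piecewise smooth data -/

section Pieces

variable {t : ℕ → ℝ} {a b : ℝ}

theorem exists_mem_Ico_of_strictMono (ht0 : t 0 = a)
    (htb : Tendsto t atTop (𝓝 b)) {s : ℝ} (hs : s ∈ Ico a b) :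
    ∃ n, s ∈ Ico (t n) (t (n + 1)) := by
  have hex : ∃ n, s < t n := (htb.eventually_const_lt hs.2).exists
  classical
  have h0 : Nat.find hex ≠ 0 := by
    intro h
    have := Nat.find_spec hex
    rw [h, ht0] at this
    exact this.not_ge hs.1
  obtain ⟨n, hn⟩ := Nat.exists_eq_succ_of_ne_zero h0
  refine ⟨n, not_lt.1 (Nat.find_min hex (by omega)), ?_⟩
  have := Nat.find_spec hex
  rwa [hn] at this

theorem Icc_mem_nhdsWithin_Ico {s c : ℝ} (hs : s < c) : Icc a c ∈ 𝓝[Ico a b] s := by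
  filter_upwards [self_mem_nhdsWithin, mem_nhdsWithin_of_mem_nhds (Iio_mem_nhds hs)] with x h1 h2
  exact ⟨h1.1, le_of_lt h2⟩

theorem continuousOn_Ico_of_pieces {X : Type*} [TopologicalSpace X] (ht : StrictMono t)
    (ht0 : t 0 = a) (htb : Tendsto t atTop (𝓝 b)) {f : ℝ → X}
    (hf : ∀ n, ContinuousOn f (Icc (t n) (t (n + 1)))) : ContinuousOn f (Ico a b) := by
  have h : ∀ n, ContinuousOn f (Icc a (t n)) := by
    intro n
    induction n with
    | zero => simp [ht0]
    | succ n ih =>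
      rw [← Icc_union_Icc_eq_Icc (b := t n) (ht0 ▸ ht.monotone (Nat.zero_le n))
        (ht.monotone (Nat.le_succ n))]
      exact ih.union_of_isClosed (hf n) isClosed_Icc isClosed_Icc
  intro s hs
  obtain ⟨n, hn⟩ := exists_mem_Ico_of_strictMono ht0 htb hs
  exact ((h (n + 1)) s ⟨hs.1, hn.2.le⟩).mono_of_mem_nhdsWithin (Icc_mem_nhdsWithin_Ico hn.2)

/-- The integral of `f` works: `f` may jump at break points but is continuous from the right, which
suffices for right derivatives. -/
theorem exists_right_primitive (ht : StrictMono t) (ht0 : t 0 = a)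
    (htb : Tendsto t atTop (𝓝 b)) {f : ℝ → ℝ} {g : ℕ → ℝ → ℝ}
    (hg : ∀ n, ContinuousOn (g n) (Icc (t n) (t (n + 1))))
    (hfg : ∀ n, ∀ s ∈ Ico (t n) (t (n + 1)), f s = g n s) :
    ∃ F : ℝ → ℝ, ContinuousOn F (Ico a b) ∧
      ∀ s ∈ Ico a b, HasDerivWithinAt F (f s) (Ici s) s := by
  have hint : ∀ n, IntervalIntegrable f MeasureTheory.volume (t n) (t (n + 1)) := by
    intro n
    have hlt := ht (Nat.lt_succ_self n)
    have h1 : IntervalIntegrable (g n) MeasureTheory.volume (t n) (t (n + 1)) :=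
      ContinuousOn.intervalIntegrable_of_Icc hlt.le (hg n)
    rw [intervalIntegrable_iff_integrableOn_Ico_of_le hlt.le] at h1 ⊢
    exact h1.congr_fun (fun s hs => (hfg n s hs).symm) measurableSet_Ico
  have hint' : ∀ n, IntervalIntegrable f MeasureTheory.volume a (t n) := by
    intro n
    rw [← ht0]
    exact IntervalIntegrable.trans_iterate fun k _ => hint k
  refine ⟨fun s => ∫ x in a..s, f x, fun s hs => ?_, fun s hs => ?_⟩
  all_goals obtain ⟨n, hn⟩ := exists_mem_Ico_of_strictMono ht0 htb hs
  · have hle : a ≤ t (n + 1) := hs.1.trans hn.2.le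
    have h1 := intervalIntegral.continuousOn_primitive_interval' (hint' (n + 1)) left_mem_uIcc
    rw [uIcc_of_le hle] at h1
    exact (h1 s ⟨hs.1, hn.2.le⟩).mono_of_mem_nhdsWithin (Icc_mem_nhdsWithin_Ico hn.2)
  · have h1 : IntervalIntegrable f MeasureTheory.volume a s :=
      (hint' (n + 1)).mono_set (by
        rw [uIcc_of_le hs.1, uIcc_of_le (hs.1.trans hn.2.le)]
        exact Icc_subset_Icc_right hn.2.le)
    refine intervalIntegral.integral_hasDerivWithinAt_right h1 (t := Ioi s) ?_ ?_
    · refine ⟨Ioc (t n) (t (n + 1)), mem_of_superset (Ioc_mem_nhdsGT hn.2)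
        (Ioc_subset_Ioc_left hn.1), ?_⟩
      exact (hint n).1.aestronglyMeasurable
    · have h2 : ContinuousWithinAt (g n) (Ioi s) s :=
        ((hg n) s ⟨hn.1, hn.2.le⟩).mono_of_mem_nhdsWithin
          (mem_of_superset (Ioc_mem_nhdsGT hn.2) fun x hx => ⟨hn.1.trans hx.1.le, hx.2⟩)
      refine h2.congr_of_eventuallyEq ?_ (hfg n s hn)
      filter_upwards [Ioo_mem_nhdsGT hn.2] with x hx
      exact hfg n x ⟨hn.1.trans hx.1.le, hx.2⟩

end Pieces

/-! ### From timelike curves in the spacetime to cone curves -/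

theorem hasDerivWithinAt_Ici_of_Icc {E : Type*} [NormedAddCommGroup E] [NormedSpace ℝ E] {f : ℝ → E}
    {c d s : ℝ} (hf : DifferentiableOn ℝ f (Icc c d)) (hs : s ∈ Ico c d) :
    HasDerivWithinAt f (derivWithin f (Icc c d) s) (Ici s) s := by
  refine ((hf s (Ico_subset_Icc_self hs)).hasDerivWithinAt).mono_of_mem_nhdsWithin ?_
  exact mem_of_superset (Ico_mem_nhdsGE hs.2) fun x hx => ⟨hs.1.trans hx.1, hx.2.le⟩

/-- Timelikeness makes the product of the two null components positive; the time orientation makes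
their sum positive. -/
theorem IsFutureTimelike.inequalities {Ω r : ℝ → ℝ → ℝ} {p : DoubleNull}
    {X : TangentSpace DoubleNullModel p}
    (h : IsFutureTimelike (doubleNullMetric Ω r) timeVector p X) :
    0 < diffU p X ∧ 0 < diffV p X ∧
      r p.1 p.2.1 ^ 2 * ‖diffSphere p X‖ ^ 2 < Ω p.1 p.2.1 ^ 2 * (diffU p X * diffV p X) := by
  obtain ⟨h1, h2⟩ := h
  rw [doubleNullMetric_apply] at h1 h2
  rw [diffU_timeVector, diffV_timeVector, diffSphere_timeVector, inner_zero_right] at h2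
  rw [real_inner_self_eq_norm_sq] at h1
  have h3 : 0 ≤ r p.1 p.2.1 ^ 2 * ‖diffSphere p X‖ ^ 2 := by positivity
  have h4 : r p.1 p.2.1 ^ 2 * ‖diffSphere p X‖ ^ 2 <
    Ω p.1 p.2.1 ^ 2 * (diffU p X * diffV p X) := by linarith
  have h5 : 0 < diffU p X * diffV p X := by
    by_contra! h
    have := mul_nonpos_of_nonneg_of_nonpos (sq_nonneg (Ω p.1 p.2.1)) h
    linarith
  have h6 : 0 < diffU p X + diffV p X := by
    by_contra! h
    have := mul_nonpos_of_nonneg_of_nonpos (sq_nonneg (Ω p.1 p.2.1)) h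
    linarith
  rcases pos_and_pos_or_neg_and_neg_of_mul_pos h5 with h | h
  · exact ⟨h.1, h.2, h4⟩
  · linarith [h.1, h.2]

theorem derivWithin_comp_curve {F : Type*} [NormedAddCommGroup F] [NormedSpace ℝ F]
    {P : DoubleNull → F} {γ : ℝ → DoubleNull} {S : Set ℝ} {s : ℝ}
    (hP : MDifferentiableAt DoubleNullModel 𝓘(ℝ, F) P (γ s))
    (hγ : MDifferentiableWithinAt 𝓘(ℝ, ℝ) DoubleNullModel γ S s) (hS : UniqueDiffWithinAt ℝ S s) :
    derivWithin (fun s => P (γ s)) S s = mfderiv DoubleNullModel 𝓘(ℝ, F) P (γ s)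
      (mfderivWithin 𝓘(ℝ, ℝ) DoubleNullModel γ S s (1 : ℝ)) := by
  let D : ℝ →L[ℝ] F := (mfderiv DoubleNullModel 𝓘(ℝ, F) P (γ s)).comp
    (mfderivWithin 𝓘(ℝ, ℝ) DoubleNullModel γ S s)
  have h : HasFDerivWithinAt (fun s => P (γ s)) D S s :=
    (hP.hasMFDerivAt.comp_hasMFDerivWithinAt s hγ.hasMFDerivWithinAt).hasFDerivWithinAt
  exact h.hasDerivWithinAt.derivWithin hS

theorem contMDiff_u : ContMDiff DoubleNullModel 𝓘(ℝ, ℝ) ∞ (fun x : DoubleNull => (x.1 : ℝ)) :=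
  contMDiff_subtype_val.comp contMDiff_fst

theorem contMDiff_v : ContMDiff DoubleNullModel 𝓘(ℝ, ℝ) ∞ (fun x : DoubleNull => (x.2.1 : ℝ)) :=
  contMDiff_subtype_val.comp (contMDiff_fst.comp contMDiff_snd)

theorem contMDiff_sphere : ContMDiff DoubleNullModel 𝓘(ℝ, EuclideanSpace ℝ (Fin 3)) ∞
    (fun x : DoubleNull => (x.2.2 : EuclideanSpace ℝ (Fin 3))) := by
  have : Fact (Module.finrank ℝ (EuclideanSpace ℝ (Fin 3)) = 2 + 1) := ⟨by simp⟩
  exact (contMDiff_coe_sphere (n := 2)).comp (contMDiff_snd.comp contMDiff_snd)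

theorem IsFutureTimelikeCurve.exists_isConeCurve {Ω r : ℝ → ℝ → ℝ}
    (hΩ : IsBoundedCoefficient Ω) (hr : IsBoundedCoefficient r) {γ : ℝ → DoubleNull} {a b : ℝ}
    (hγ : IsFutureTimelikeCurve (doubleNullMetric Ω r) timeVector γ a b) :
    ∃ u' v' F l θ', IsConeCurve (fun u v => Ω u v ^ 2) (fun u v => r u v ^ 2)
      (fun s => ((γ s).1 : ℝ)) (fun s => ((γ s).2.1 : ℝ)) u' v' F l
      (fun s => ((γ s).2.2 : EuclideanSpace ℝ (Fin 3))) θ' a b := by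
  obtain ⟨t, ht, ht0, htb, h⟩ := hγ
  set u : ℝ → ℝ := fun s => ((γ s).1 : ℝ) with hu
  set v : ℝ → ℝ := fun s => ((γ s).2.1 : ℝ) with hv
  set θ : ℝ → EuclideanSpace ℝ (Fin 3) := fun s => ((γ s).2.2 : EuclideanSpace ℝ (Fin 3)) with hθ
  have hlt : ∀ n, t n < t (n + 1) := fun n => ht (Nat.lt_succ_self n)
  have hab : a < b := by
    have := ht.monotone.ge_of_tendsto htb 1
    rw [← ht0]
    exact (hlt 0).trans_le this
  have hu0 : ∀ s, u s < 0 := fun s => (γ s).1.2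
  have hv0 : ∀ s, v s < 0 := fun s => (γ s).2.1.2
  have huds : ∀ n, UniqueDiffOn ℝ (Icc (t n) (t (n + 1))) := fun n => uniqueDiffOn_Icc (hlt n)
  have hus : ∀ n, ContDiffOn ℝ ∞ u (Icc (t n) (t (n + 1))) := fun n =>
    (contMDiff_u.comp_contMDiffOn (h n).1).contDiffOn
  have hvs : ∀ n, ContDiffOn ℝ ∞ v (Icc (t n) (t (n + 1))) := fun n =>
    (contMDiff_v.comp_contMDiffOn (h n).1).contDiffOn
  have hθs : ∀ n, ContDiffOn ℝ ∞ θ (Icc (t n) (t (n + 1))) := fun n =>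
    (contMDiff_sphere.comp_contMDiffOn (h n).1).contDiffOn
  have hineq : ∀ n, ∀ s ∈ Ico (t n) (t (n + 1)),
      0 < derivWithin u (Icc (t n) (t (n + 1))) s ∧ 0 < derivWithin v (Icc (t n) (t (n + 1))) s ∧
      r (u s) (v s) ^ 2 * ‖derivWithin θ (Icc (t n) (t (n + 1))) s‖ ^ 2 < Ω (u s) (v s) ^ 2 *
        (derivWithin u (Icc (t n) (t (n + 1))) s * derivWithin v (Icc (t n) (t (n + 1))) s) := by
    intro n s hs
    have hs' := Ico_subset_Icc_self hs
    have hd := ((h n).1 s hs').mdifferentiableWithinAt (by simp)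
    rw [hu, hv, hθ, derivWithin_comp_curve (contMDiff_u _ |>.mdifferentiableAt (by simp)) hd
      (huds n s hs'), derivWithin_comp_curve (contMDiff_v _ |>.mdifferentiableAt (by simp)) hd
      (huds n s hs'), derivWithin_comp_curve (contMDiff_sphere _ |>.mdifferentiableAt (by simp)) hd
      (huds n s hs')]
    exact ((h n).2 s hs').inequalities
  -- At a break point the later piece determines the velocity, hence the half-open intervals.
  have hright : ∀ {E : Type} [NormedAddCommGroup E] [NormedSpace ℝ E] {f : ℝ → E},
      (∀ n, ContDiffOn ℝ ∞ f (Icc (t n) (t (n + 1)))) → ∀ n, ∀ s ∈ Ico (t n) (t (n + 1)),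
      derivWithin f (Ici s) s = derivWithin f (Icc (t n) (t (n + 1))) s := fun hf n s hs =>
    (hasDerivWithinAt_Ici_of_Icc ((hf n).differentiableOn (by simp)) hs).derivWithin
      (uniqueDiffOn_Ici s s self_mem_Ici)
  have hderiv : ∀ {E : Type} [NormedAddCommGroup E] [NormedSpace ℝ E] {f : ℝ → E},
      (∀ n, ContDiffOn ℝ ∞ f (Icc (t n) (t (n + 1)))) → ∀ s ∈ Ico a b,
      HasDerivWithinAt f (derivWithin f (Ici s) s) (Ici s) s := by
    intro E _ _ f hf s hs
    obtain ⟨n, hn⟩ := exists_mem_Ico_of_strictMono ht0 htb hs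
    rw [hright hf n s hn]
    exact hasDerivWithinAt_Ici_of_Icc ((hf n).differentiableOn (by simp)) hn
  have hdc : ∀ {E : Type} [NormedAddCommGroup E] [NormedSpace ℝ E] {f : ℝ → E},
      (∀ n, ContDiffOn ℝ ∞ f (Icc (t n) (t (n + 1)))) → ∀ n,
      ContinuousOn (derivWithin f (Icc (t n) (t (n + 1)))) (Icc (t n) (t (n + 1))) :=
    fun hf n => (hf n).continuousOn_derivWithin (huds n) (by simp)
  have hcoef : ∀ {Q : ℝ → ℝ → ℝ}, IsBoundedCoefficient Q → ∀ n,
      ContinuousOn (fun s => Q (u s) (v s)) (Icc (t n) (t (n + 1))) := fun hQ n =>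
    hQ.smooth.continuousOn.comp ((hus n).continuousOn.prodMk (hvs n).continuousOn)
      fun s _ => ⟨hu0 s, hv0 s⟩
  obtain ⟨F, hF, hF'⟩ := exists_right_primitive ht ht0 htb
    (f := fun s => √(Ω (u s) (v s) ^ 2 / r (u s) (v s) ^ 2 *
      (derivWithin u (Ici s) s * derivWithin v (Ici s) s)))
    (g := fun n s => √(Ω (u s) (v s) ^ 2 / r (u s) (v s) ^ 2 *
      (derivWithin u (Icc (t n) (t (n + 1))) s * derivWithin v (Icc (t n) (t (n + 1))) s)))
    (fun n => (((hcoef hΩ.sq n).div (hcoef hr.sq n) fun s _ =>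
      (hr.sq.pos (hu0 s) (hv0 s)).ne').mul ((hdc hus n).mul (hdc hvs n))).sqrt)
    fun n s hs => by simp only [hright hus n s hs, hright hvs n s hs]
  obtain ⟨l, hl, hl'⟩ := exists_right_primitive ht ht0 htb
    (f := fun s => ‖derivWithin θ (Ici s) s‖) (fun n => (hdc hθs n).norm)
    fun n s hs => by simp only [hright hθs n s hs]
  refine ⟨fun s => derivWithin u (Ici s) s, fun s => derivWithin v (Ici s) s, F, l,
    fun s => derivWithin θ (Ici s) s, ?_⟩
  exact
  { lt := hab
    u_neg := fun s _ => hu0 s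
    v_neg := fun s _ => hv0 s
    norm_eq := fun s _ => by simp [hθ]
    u_cont := continuousOn_Ico_of_pieces ht ht0 htb fun n => (hus n).continuousOn
    v_cont := continuousOn_Ico_of_pieces ht ht0 htb fun n => (hvs n).continuousOn
    θ_cont := continuousOn_Ico_of_pieces ht ht0 htb fun n => (hθs n).continuousOn
    F_cont := hF
    l_cont := hl
    u_deriv := hderiv hus
    v_deriv := hderiv hvs
    θ_deriv := hderiv hθs
    F_deriv := hF'
    l_deriv := hl'
    u'_pos := fun s hs => by
      obtain ⟨n, hn⟩ := exists_mem_Ico_of_strictMono ht0 htb hs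
      simpa only [hright hus n s hn] using (hineq n s hn).1
    v'_pos := fun s hs => by
      obtain ⟨n, hn⟩ := exists_mem_Ico_of_strictMono ht0 htb hs
      simpa only [hright hvs n s hn] using (hineq n s hn).2.1
    timelike := fun s hs => by
      obtain ⟨n, hn⟩ := exists_mem_Ico_of_strictMono ht0 htb hs
      simpa only [hright hus n s hn, hright hvs n s hn, hright hθs n s hn] using
        (hineq n s hn).2.2 }

end

/-! ### Conclusion -/

theorem theorem1p2 (Ω r : ℝ → ℝ → ℝ)
    (hΩ : IsAdmissibleCoefficient Ω) (hr : IsAdmissibleCoefficient r)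
    (hrv : ∀ u < 0, Tendsto (fun v => deriv (fun y => r u y) v) (𝓝[<] 0) atBot)
    (hru : ∀ v < 0, Tendsto (fun u => deriv (fun x => r x v) u) (𝓝[<] 0) atBot)
    (hru_neg : ∀ u < 0, ∃ v₀ < 0, ∀ v ∈ Ico v₀ 0, deriv (fun x => r x v) u < 0)
    (hrv_neg : ∀ v < 0, ∃ u₀ < 0, ∀ u ∈ Ico u₀ 0, deriv (fun y => r u y) v < 0) :
    FutureLocLipInextendible.{w} (doubleNullMetric Ω r) timeVector := by
  rintro d N _ _ _ _ g' ι hι ⟨γ, a, b, hγ, hinext, q, hq⟩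
  have hΩb := hΩ.isBoundedCoefficient
  have hrb := hr.isBoundedCoefficient
  obtain ⟨G, τ, ρ, Λ, C, hρ, hchart⟩ := exists_boundaryChart hι q
  obtain ⟨u', v', F, l, θ', hc⟩ := hγ.exists_isConeCurve hΩb hrb
  obtain ⟨U, hU, hUle⟩ := exists_tendsto_of_monotoneOn hc.lt hc.u_strictMono.monotoneOn
    fun s hs => (hc.u_neg s hs).le
  obtain ⟨V, hV, hVle⟩ := exists_tendsto_of_monotoneOn hc.lt hc.v_strictMono.monotoneOn
    fun s hs => (hc.v_neg s hs).le
  obtain ⟨e, he, hθ⟩ := hc.exists_tendsto_θ hΩb.sq hrb.sq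
  have hU0 : U ≤ 0 := le_of_tendsto hU (Eventually.of_forall fun s => (γ s).1.2.le)
  have hV0 : V ≤ 0 := le_of_tendsto hV (Eventually.of_forall fun s => (γ s).2.1.2.le)
  -- All three components converge, so if both null coordinates had negative limits the curve would
  -- converge in the spacetime.
  have hor : V = 0 ∨ U = 0 := by
    by_contra! hne
    refine hinext ⟨(⟨U, hU0.lt_of_ne hne.2⟩, ⟨V, hV0.lt_of_ne hne.1⟩, ⟨e, by simpa using he⟩), ?_⟩
    exact Tendsto.prodMk_nhds (tendsto_subtype_rng.2 hU)
      (Tendsto.prodMk_nhds (tendsto_subtype_rng.2 hV) (tendsto_subtype_rng.2 hθ))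
  set φ := chartAt (EuclideanSpace ℝ (Fin (d + 1))) q with hφ
  have hqs : q ∈ φ.source := mem_chart_source _ q
  have hO : ∀ᶠ s in 𝓝[<] b, (((γ s).1 : ℝ), ((γ s).2.1 : ℝ), ((γ s).2.2 : EuclideanSpace ℝ (Fin 3)))
      ∈ {x ∈ coneDomain | ι (conePoint x) ∈ φ.source} := by
    filter_upwards [hq.eventually (φ.open_source.mem_nhds hqs)] with s hs
    exact ⟨mem_coneDomain_val (γ s), by rw [conePoint_val]; exact hs⟩
  have hY : Tendsto (fun s => φ (ι (conePoint (((γ s).1 : ℝ), ((γ s).2.1 : ℝ),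
      ((γ s).2.2 : EuclideanSpace ℝ (Fin 3)))))) (𝓝[<] b) (𝓝 (φ q)) := by
    simp only [conePoint_val]
    exact (φ.continuousAt hqs).tendsto.comp hq
  rcases hor with h0 | h0
  · rw [h0] at hV
    exact hchart.false_of_curve hρ hΩb.sq hrb.sq hc hO hY hV
      (fun u hu => hrb.tendsto_fderiv_sq hu (hrv u hu))
      fun u hu => hrb.eventually_fderiv_sq_nonpos hu (hru_neg u hu)
  · rw [h0] at hU
    exact hchart.swap.false_of_curve hρ hΩb.sq.swap hrb.sq.swap hc.swap hO hY hU
      (fun v hv => hrb.swap.tendsto_fderiv_sq hv (hru v hv))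
      fun v hv => hrb.swap.eventually_fderiv_sq_nonpos hv (hrv_neg v hv)
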